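/- Conventions. Graphs and complexes are finite. A \emph{2-complex} is a graph (loops and parallel edges allowed) together with a family of closed trails in it, its \emph{faces}. A \emph{simplicial complex} here is 2-dimensional, every edge of it is incident with a face (triangle), and it is viewed as a 2-complex. The \emph{link graph} $L(v)$ of a 2-complex at a vertex $v$ has as vertices the edges incident with $v$ (loops counted twice) and as edges the traversals of $v$ by faces, joining the two edges traversed. A \emph{rotation system} of a graph assigns to every vertex a cyclic orientation (the \emph{rotator}) of its incident edges; it is \emph{planar} if the surface it induces is a disjoint union of spheres, one for each component. A \emph{rotation system} of a 2-complex assigns to every directed edge a cyclic orientation of the faces incident with it, where reversing the edge reverses the orientation; it is \emph{planar} if it induces planar rotation systems of all link graphs. A link graph $L(v)$ is \emph{loop planar} if it has a planar rotation system in which, for every loop at $v$, the rotators at the two vertices of $L(v)$ belonging to that loop are reverse to each other; a 2-complex is \emph{locally planar at $v$} if $L(v)$ is loop planar, and \emph{locally planar} if this holds at every vertex. For a set $S$ of edges, $C/S$ is obtained by identifying the ends of the edges of $S$ and deleting these edges from the graph and from all faces. A \emph{parallel graph} consists of two vertices (its \emph{branching vertices}) and a set of internally disjoint paths between them. A \emph{free-graph}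 is a subdivision of a 3-star, a path, or a cycle with an attached path. A graph is \emph{almost 3-connected} if it is a subdivision of a 3-connected graph, a parallel graph or a free-graph; $C$ is \emph{locally almost 3-connected} if all its link graphs are almost 3-connected. $C$ is \emph{stretched out} if every edge incident with exactly two faces has an endvertex $x$ such that $L(x)$ is neither a subdivision of a 3-connected graph nor a parallel graph whose branching vertices have degree at least three. A path $P$ in $C$ is a \emph{para-path} if the link graphs at its interior vertices are parallel graphs whose branching vertices have degree at least three and the link graphs at its endvertices are subdivisions of 3-connected graphs; the vertex of $C/P$ onto which $P$ is contracted is again denoted by $P$. A cycle $o$ is \emph{chordless} if every edge of $C$ joining two vertices of $o$ is an edge of $o$. \textbf{Lemma.} Let $C$ be a simplicial complex that is locally almost 3-connected and stretched out. Then at least one of the following holds: \begin{itemize} \item $C$ has a planar rotation system; \item $C$ is not locally planar; \item there is a para-path $P$ in $C$ such that $C/P$ is not locally planar at the vertex $P$; \item there are a chordless cycle $o$ of $C$ and an edge $e$ of $o$, where $o$ contains an edge aside from $e$, such that $C/(o-e)$ is not locally planar. \end{itemize} -/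

import Mathlib

open Equiv

universe u

/-! ### Finite multigraphs and their rotation systems -/

/-- A multigraph with vertex set `V` and edge set `E`; the edge `e` has the two ends
`ends e false` and `ends e true`. Loops and parallel edges are allowed. The pairs `(e, b)` are the
*half-edges*; `(e, b)` is attached to the vertex `ends e b`. -/
structure MultiGraph (V E : Type*) where
  ends : E → Bool → V

namespace MultiGraph

variable {V E : Type*} (G : MultiGraph V E)

/-- The simple graph obtained by forgetting loops and multiplicities. -/
def toSimpleGraph : SimpleGraph V :=
  SimpleGraph.fromRel fun u v => ∃ e, G.ends e false = u ∧ G.ends e true = v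

/-- No loops and no parallel edges. -/
def IsSimple : Prop :=
  (∀ e, G.ends e false ≠ G.ends e true) ∧
    Function.Injective fun e => s(G.ends e false, G.ends e true)

/-- The vertex to which a half-edge is attached. -/
def vert (h : E × Bool) : V := G.ends h.1 h.2

/-- A rotation system of a multigraph: a permutation of the half-edges which, for every vertex `v`,
cyclically permutes the half-edges attached to `v` (the rotator at `v`). -/
def IsRotationSystem (ρ : Perm (E × Bool)) : Prop :=
  ∀ v, ρ.IsCycleOn {h | G.vert h = v}

/-- The permutation that exchanges the two halves of every edge. -/
def flip (E : Type*) : Perm (E × Bool) := (Equiv.refl E).prodCongr Equiv.boolNot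

/-- The number of faces of the (oriented) surface in which a rotation system embeds a finite
multigraph: face boundary walks are the cycles of `ρ * flip`, and every
isolated vertex has a face (and a sphere) of its own. -/
noncomputable def numFaces (ρ : Perm (E × Bool)) : ℕ :=
  Nat.card (Quotient (Perm.SameCycle.setoid (ρ * flip E))) +
    Nat.card {v : V // ∀ h, G.vert h ≠ v}

/-- A rotation system of a finite multigraph is *planar* if the surface that it induces is a
disjoint union of spheres, one for each connected component. As a connected component has Euler
characteristic at most `2`, this says that the total Euler characteristic is twice the number
of connected components. -/
def IsPlanarRotationSystem (ρ : Perm (E × Bool)) : Prop :=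
  G.IsRotationSystem ρ ∧
    (Nat.card V : ℤ) - Nat.card E + G.numFaces ρ = 2 * Nat.card G.toSimpleGraph.ConnectedComponent

/-- A `3`-connected graph: a simple graph with more than three vertices that stays connected
whenever at most two vertices are deleted. -/
def IsThreeConnected : Prop :=
  G.IsSimple ∧ 3 < Nat.card V ∧
    ∀ S : Finset V, S.card ≤ 2 → (G.toSimpleGraph.induce (S : Set V)ᶜ).Connected

/-- Two vertices and `k` parallel edges between them. -/
def bond (k : ℕ) : MultiGraph Bool (Fin k) where
  ends _ b := b

/-- The star with three leaves (`0` is the centre). -/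
def threeStar : MultiGraph (Fin 4) (Fin 3) where
  ends e b := if b then e.succ else 0

/-- A cycle of length two on the vertices `0` and `1`, with a leaf `2` attached to `1`. -/
def lollipop : MultiGraph (Fin 3) (Fin 3) where
  ends := ![fun b => if b then 1 else 0, fun b => if b then 1 else 0, fun b => if b then 2 else 1]

end MultiGraph

/-- The simple graph `G` is a subdivision of the (loopless) multigraph `H`: the edges of
`H` are replaced by internally disjoint paths between their ends. -/
def SimpleGraph.IsSubdivisionOf {V W E : Type*} (G : SimpleGraph V) (H : MultiGraph W E) : Prop :=
  ∃ (φ : W ↪ V) (P : ∀ e, G.Walk (φ (H.ends e false)) (φ (H.ends e true))),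
    (∀ e, (P e).IsPath) ∧
    -- inner vertices of the paths are not branch vertices
    (∀ e w, φ w ∈ (P e).support → w = H.ends e false ∨ w = H.ends e true) ∧
    -- distinct paths share at most branch vertices
    (∀ e e' x, e ≠ e' → x ∈ (P e).support → x ∈ (P e').support → x ∈ Set.range φ) ∧
    -- every vertex and every edge is used, and edges are used only once
    (∀ x, x ∈ Set.range φ ∨ ∃ e, x ∈ (P e).support) ∧
    (∀ a ∈ G.edgeSet, ∃! e, a ∈ (P e).edges)

namespace SimpleGraph

variable {V : Type*} (G : SimpleGraph V)

/-- `G` is a subdivision of a (finite) `3`-connected graph. -/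
def IsSubdivisionOfThreeConnected : Prop :=
  ∃ (n m : ℕ) (H : MultiGraph (Fin n) (Fin m)), H.IsThreeConnected ∧ G.IsSubdivisionOf H

/-- A parallel graph: two branch vertices and internally disjoint paths between them. -/
def IsParallelGraph : Prop := ∃ k, G.IsSubdivisionOf (MultiGraph.bond k)

/-- A parallel graph whose branch vertices have degree at least three. -/
def IsThickParallelGraph : Prop := ∃ k, 3 ≤ k ∧ G.IsSubdivisionOf (MultiGraph.bond k)

/-- A free-graph: a subdivision of a `3`-star, a path, or a cycle with an attached path. -/
def IsFreeGraph : Prop :=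
  G.IsSubdivisionOf MultiGraph.threeStar ∨ G.IsSubdivisionOf (MultiGraph.bond 1) ∨
    G.IsSubdivisionOf MultiGraph.lollipop

/-- Almost `3`-connected graphs. -/
def IsAlmostThreeConnected : Prop :=
  G.IsSubdivisionOfThreeConnected ∨ G.IsParallelGraph ∨ G.IsFreeGraph

end SimpleGraph

/-! ### 2-complexes -/

/-- A 2-complex: a graph (loops and parallel edges allowed) with a family of closed trails, its
faces. The graph is given by its darts (edges with a direction): `src d` is the starting vertex of
`d`, and `rev d` is the same edge with the other direction; so the edges are the pairs
`{d, rev d}`. The boundary of a face is a cyclic sequence of darts, each starting where the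
previous one ends, which traverses no edge twice. -/
structure TwoComplex where
  V : Type u
  D : Type u
  F : Type u
  src : D → V
  rev : D → D
  rev_rev : ∀ d, rev (rev d) = d
  rev_ne : ∀ d, rev d ≠ d
  bd : F → Cycle D
  bd_ne_nil : ∀ f, bd f ≠ Cycle.nil
  bd_nodup : ∀ f, (bd f).Nodup
  bd_trail : ∀ f, ∀ d ∈ bd f, rev d ∉ bd f
  bd_closed : ∀ f, (bd f).Chain fun d d' => src (rev d) = src d'

theorem Cycle.exists_eq_cons {α : Type*} {s : Cycle α} {x : α} (hx : x ∈ s) :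
    ∃ l : List α, s = (x :: l : List α) := by
  induction s using Quotient.inductionOn' with
  | h l =>
    have hx' : x ∈ l := hx
    obtain ⟨a, b, rfl⟩ := List.append_of_mem hx'
    refine ⟨b ++ a, ?_⟩
    refine Quot.sound ⟨a.length, ?_⟩
    simp

open Classical in
theorem Cycle.Chain.rel_next {α : Type*} {r : α → α → Prop} {s : Cycle α} (h : s.Chain r)
    (hs : s.Nodup) {x : α} (hx : x ∈ s) : r x (s.next hs x hx) := by
  obtain ⟨l, rfl⟩ := Cycle.exists_eq_cons hx
  cases l with
  | nil =>
    have : Cycle.next (([x] : List α) : Cycle α) hs x hx = x := List.next_singleton x x (by simp)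
    rw [this]
    simpa using h
  | cons y l =>
    have : Cycle.next ((x :: y :: l : List α) : Cycle α) hs x hx = y :=
      List.next_cons_cons_eq l x y (by simp)
    rw [this]
    have h2 := (Cycle.chain_coe_cons r x (y :: l)).1 h
    exact (List.isChain_cons_cons.1 h2).1

/-- Delete entries of a cyclic sequence and rename the others. -/
def Cycle.filterMap {α β : Type*} (g : α → Option β) : Cycle α → Cycle β :=
  Quotient.map' (List.filterMap g) fun l l' h => by
    obtain ⟨n, rfl⟩ := h
    rw [List.rotate_eq_drop_append_take_mod, List.filterMap_append]
    have : l.filterMap g = (l.take (n % l.length)).filterMap g ++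
        (l.drop (n % l.length)).filterMap g := by
      rw [← List.filterMap_append, List.take_append_drop]
    rw [this]
    exact List.isRotated_append

theorem Cycle.mem_filterMap {α β : Type*} {g : α → Option β} {s : Cycle α} {b : β} :
    b ∈ s.filterMap g ↔ ∃ a ∈ s, g a = some b := by
  induction s using Quotient.inductionOn' with
  | h l => exact List.mem_filterMap

theorem Cycle.nodup_filterMap {α β : Type*} {g : α → Option β} {s : Cycle α} (hs : s.Nodup)
    (hg : ∀ a a' b, b ∈ g a → b ∈ g a' → a = a') : (s.filterMap g).Nodup := by
  induction s using Quotient.inductionOn' with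
  | h l => exact List.Nodup.filterMap hg hs

/-- Consecutive entries of a cyclic sequence of arrows remain composable if arrows with equal
ends are deleted. -/
theorem Cycle.chain_filterMap {α β Q : Type*} {g : α → Option β} {s : Cycle α}
    {i t : α → Q} {i' t' : β → Q}
    (hnone : ∀ a, g a = none → i a = t a)
    (hsome : ∀ a b, g a = some b → i' b = i a ∧ t' b = t a)
    (h : s.Chain fun a a' => t a = i a') :
    (s.filterMap g).Chain fun b b' => t' b = i' b' := by
  -- a walk from `x` to `y` along a list stays a walk
  have key : ∀ (l : List α) (x y : Q),
      l.foldr (fun a R x => x = i a ∧ R (t a)) (fun x => x = y) x →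
      (l.filterMap g).foldr (fun b R x => x = i' b ∧ R (t' b)) (fun x => x = y) x := by
    intro l
    induction l with
    | nil => intro x y hx; simpa using hx
    | cons a l ih =>
      intro x y hx
      simp only [List.foldr_cons] at hx
      obtain ⟨h1, h2⟩ := hx
      cases hga : g a with
      | none =>
        rw [List.filterMap_cons_none hga]
        rw [h1, hnone a hga]
        exact ih _ _ h2
      | some b =>
        rw [List.filterMap_cons_some hga]
        simp only [List.foldr_cons]
        obtain ⟨e1, e2⟩ := hsome a b hga
        exact ⟨h1.trans e1.symm, by rw [e2]; exact ih _ _ h2⟩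
  have fwd : ∀ (l : List α) (a z : α),
      List.IsChain (fun a a' => t a = i a') (a :: (l ++ [z])) →
      l.foldr (fun a R x => x = i a ∧ R (t a)) (fun x => x = i z) (t a) := by
    intro l
    induction l with
    | nil => intro a z hc; simpa using hc
    | cons c l ih =>
      intro a z hc
      simp only [List.cons_append, List.isChain_cons_cons] at hc
      exact ⟨hc.1, ih c z (by simpa using hc.2)⟩
  have bwd : ∀ (l : List β) (b z : β),
      l.foldr (fun b R x => x = i' b ∧ R (t' b)) (fun x => x = i' z) (t' b) →
      List.IsChain (fun b b' => t' b = i' b') (b :: (l ++ [z])) := by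
    intro l
    induction l with
    | nil => intro a z hc; simpa using hc
    | cons c l ih =>
      intro a z hc
      simp only [List.cons_append, List.isChain_cons_cons]
      exact ⟨hc.1, ih c z hc.2⟩
  induction s using Quotient.inductionOn' with
  | h l =>
    cases l with
    | nil => trivial
    | cons a l =>
      have h1 := fwd l a a h
      have h2 : (a :: l).foldr (fun a R x => x = i a ∧ R (t a)) (fun x => x = i a) (i a) :=
        ⟨rfl, h1⟩
      have h3 := key (a :: l) _ _ h2
      change Cycle.Chain _ ((List.filterMap g (a :: l) : List β) : Cycle β)
      cases hm : List.filterMap g (a :: l) with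
      | nil => trivial
      | cons b m =>
        rw [hm] at h3
        simp only [List.foldr_cons] at h3
        rw [Cycle.chain_coe_cons]
        apply bwd
        rw [← h3.1]
        exact h3.2

namespace TwoComplex

variable (C : TwoComplex.{u})

/-- The end vertex of a dart. -/
def tgt (d : C.D) : C.V := C.src (C.rev d)

/-- The face `f` is incident with the edge of `d`. -/
def Incident (f : C.F) (d : C.D) : Prop := d ∈ C.bd f ∨ C.rev d ∈ C.bd f

/-- The vertices of the link graph at `v`: the ends of edges at `v`, given as the darts that start
at `v`. A loop at `v` has two of them. -/
abbrev LinkVertex (v : C.V) : Type u := {d : C.D // C.src d = v}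

/-- The edges of the link graph at `v`: the traversals of `v` by faces, given as a face `f` together
with a dart of its boundary that ends at `v`. -/
abbrev LinkEdge (v : C.V) : Type u := {c : (f : C.F) × {d : C.D // d ∈ C.bd f} // C.tgt c.2.1 = v}

open Classical in
/-- The link graph `L(v)`. A traversal of `v` along the dart `d` and the next dart `d'` joins the
end at `v` of the edge of `d` with the end at `v` of the edge of `d'`. -/
noncomputable def link (v : C.V) : MultiGraph (C.LinkVertex v) (C.LinkEdge v) where
  ends c b := match b with
    | false => ⟨C.rev c.1.2.1, c.2⟩
    | true => ⟨(C.bd c.1.1).next (C.bd_nodup c.1.1) c.1.2.1 c.1.2.2,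
        ((C.bd_closed c.1.1).rel_next (C.bd_nodup c.1.1) c.1.2.2).symm.trans c.2⟩

variable {C} in
/-- The face of `C` to which a half-edge of a link graph belongs. -/
def face {v : C.V} (h : C.LinkEdge v × Bool) : C.F := h.1.1.1

/-- A rotation system of a 2-complex: a cyclic orientation `rot d` of the faces incident with the
edge of `d`, for every directed edge `d`, which is reversed when `d` is reversed. -/
structure RotationSystem where
  rot : C.D → Perm C.F
  isCycleOn : ∀ d, (rot d).IsCycleOn {f | C.Incident f d}
  fixed : ∀ d f, ¬ C.Incident f d → rot d f = f
  rot_rev : ∀ d, rot (C.rev d) = (rot d)⁻¹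

variable {C} in
/-- A rotation system `ρ` of the link graph at `v` is induced by the rotation system `σ` of `C`: the
rotator at each vertex `d` of the link graph is `σ.rot d`. (As no face traverses an edge
twice, the half-edges at `d` correspond to the faces incident with the edge of `d`.) -/
def RotationSystem.Induces (σ : C.RotationSystem) (v : C.V) (ρ : Perm (C.LinkEdge v × Bool)) :
    Prop :=
  (C.link v).IsRotationSystem ρ ∧
    ∀ h, face (ρ h) = σ.rot ((C.link v).vert h).1 (face h)

/-- The complex has a planar rotation system: one that induces planar rotation systems of all link
graphs. -/
def HasPlanarRotationSystem : Prop :=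
  ∃ σ : C.RotationSystem, ∀ v, ∃ ρ, σ.Induces v ρ ∧ (C.link v).IsPlanarRotationSystem ρ

/-- The link graph at `v` is loop planar: it has a planar rotation system such that for every loop
at `v` the rotators at the two vertices of the link graph that belong to the loop are
reverse to each other (where half-edges of the same face correspond to each other). -/
def IsLoopPlanarAt (v : C.V) : Prop :=
  ∃ ρ, (C.link v).IsPlanarRotationSystem ρ ∧
    ∀ h h', ((C.link v).vert h').1 = C.rev ((C.link v).vert h).1 → face h = face h' →
      face (ρ h) = face (ρ⁻¹ h')

/-- All link graphs are loop planar. (At a vertex without loops this just says that the link graph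
is planar.) -/
def IsLocallyPlanar : Prop := ∀ v, C.IsLoopPlanarAt v

open Classical in
/-- The contraction of the edges of the darts in `S`: the ends of each of these edges are
identified, the edges are deleted from the graph and from the boundaries of the faces, and faces
without remaining edges (there are none if `S` is the edge set of a forest) are deleted. -/
noncomputable def contract (S : Set C.D) : TwoComplex.{u} where
  V := Quot fun u v => ∃ d ∈ S, C.src d = u ∧ C.tgt d = v
  D := {d : C.D // d ∉ S ∧ C.rev d ∉ S}
  F := {f : C.F // ∃ d ∈ C.bd f, d ∉ S ∧ C.rev d ∉ S}
  src d := Quot.mk _ (C.src d.1)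
  rev d := ⟨C.rev d.1, d.2.2, by rw [C.rev_rev]; exact d.2.1⟩
  rev_rev d := Subtype.ext (C.rev_rev _)
  rev_ne d h := C.rev_ne d.1 (congrArg Subtype.val h)
  bd f := (C.bd f.1).filterMap fun d =>
    if h : d ∉ S ∧ C.rev d ∉ S then some ⟨d, h⟩ else none
  bd_ne_nil f h := by
    obtain ⟨f, d, hd, hS⟩ := f
    have : (⟨d, hS⟩ : {d : C.D // d ∉ S ∧ C.rev d ∉ S}) ∈ (C.bd f).filterMap fun d =>
        if h : d ∉ S ∧ C.rev d ∉ S then some ⟨d, h⟩ else none :=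
      Cycle.mem_filterMap.2 ⟨d, hd, by simp [hS]⟩
    rw [h] at this
    exact Cycle.notMem_nil _ this
  bd_nodup f := Cycle.nodup_filterMap (C.bd_nodup f.1) fun a a' b hb hb' => by
    split_ifs at hb hb' <;> simp_all
    exact (congrArg Subtype.val hb).trans (congrArg Subtype.val hb').symm
  bd_trail f d hd hd' := by
    obtain ⟨a, ha, h⟩ := Cycle.mem_filterMap.1 hd
    obtain ⟨a', ha', h'⟩ := Cycle.mem_filterMap.1 hd'
    split_ifs at h h'
    have e := congrArg Subtype.val (Option.some.inj h)
    have e' := congrArg Subtype.val (Option.some.inj h')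
    simp only at e e'
    subst e'
    subst e
    exact C.bd_trail f.1 _ ha ha'
  bd_closed f := by
    refine Cycle.chain_filterMap (i := fun d => Quot.mk _ (C.src d))
      (t := fun d => Quot.mk _ (C.tgt d)) ?_ ?_ ?_
    · intro d hd
      split_ifs at hd with h
      rw [not_and_or, not_not, not_not] at h
      rcases h with h | h
      · exact Quot.sound ⟨d, h, rfl, rfl⟩
      · exact (Quot.sound ⟨C.rev d, h, rfl, by rw [tgt, C.rev_rev]⟩).symm
    · intro d b hd
      split_ifs at hd with h
      obtain rfl := Option.some.inj hd
      exact ⟨rfl, rfl⟩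
    · have hc := C.bd_closed f.1
      exact hc.imp fun a b hab => congrArg (Quot.mk _) hab

end TwoComplex

/-! ### Simplicial complexes -/

namespace AbstractSimplicialComplex

variable {ι : Type u} (K : AbstractSimplicialComplex ι)

/-- All simplices have dimension at most two, and every edge is incident with a triangle. -/
def IsTwoDimensional : Prop :=
  (∀ s ∈ K.faces, s.card ≤ 3) ∧
    ∀ s ∈ K.faces, s.card = 2 → ∃ t ∈ K.faces, t.card = 3 ∧ s ⊆ t

open Classical in
/-- The 1-skeleton. -/
def skeleton : SimpleGraph ι where
  Adj u v := u ≠ v ∧ ({u, v} : Finset ι) ∈ K.faces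
  symm := ⟨fun u v h => ⟨h.1.symm, by rw [Finset.pair_comm]; exact h.2⟩⟩
  loopless := ⟨fun _ h => h.1 rfl⟩

/-- The three edges of a triangle `xyz`, as a closed trail. -/
def triangle {x y z : ι} (hxy : K.skeleton.Adj x y) (hyz : K.skeleton.Adj y z)
    (hzx : K.skeleton.Adj z x) : Cycle K.skeleton.Dart :=
  ([⟨(x, y), hxy⟩, ⟨(y, z), hyz⟩, ⟨(z, x), hzx⟩] : List K.skeleton.Dart)

/-- The boundary of a triangle of `K`, traversed in one of the two directions. -/
theorem exists_bd (s : {s : Finset ι // s ∈ K.faces ∧ s.card = 3}) :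
    ∃ c : Cycle K.skeleton.Dart, ∃ (x y z : ι) (hxy : K.skeleton.Adj x y)
      (hyz : K.skeleton.Adj y z) (hzx : K.skeleton.Adj z x),
      (∀ a, a ∈ s.1 ↔ a = x ∨ a = y ∨ a = z) ∧ c = K.triangle hxy hyz hzx := by
  classical
  obtain ⟨s, hs, hc⟩ := s
  obtain ⟨x, y, z, hxy, hxz, hyz, rfl⟩ := Finset.card_eq_three.1 hc
  have sub : ∀ a b : ι, a ∈ ({x, y, z} : Finset ι) → b ∈ ({x, y, z} : Finset ι) → a ≠ b →
      K.skeleton.Adj a b := by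
    intro a b ha hb hab
    refine ⟨hab, ?_⟩
    refine (K.isRelLowerSet_faces hs).2 ?_ ⟨a, by simp⟩
    intro c hc
    simp only [Finset.mem_insert, Finset.mem_singleton] at hc ha hb ⊢
    grind
  exact ⟨_, x, y, z, sub _ _ (by simp) (by simp) hxy, sub _ _ (by simp) (by simp) hyz,
    sub _ _ (by simp) (by simp) hxz.symm, by simp, rfl⟩

/-- A simplicial complex as a 2-complex: the graph is the 1-skeleton, and the faces are the
triangles. (The direction in which the boundary of a triangle is traversed is chosen arbitrarily.) -/
noncomputable def toTwoComplex : TwoComplex.{u} where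
  V := ι
  D := K.skeleton.Dart
  F := {s : Finset ι // s ∈ K.faces ∧ s.card = 3}
  src d := d.fst
  rev d := d.symm
  rev_rev d := d.symm_symm
  rev_ne d := d.symm_ne
  bd s := (K.exists_bd s).choose
  bd_ne_nil s := by
    obtain ⟨x, y, z, hxy, hyz, hzx, -, h⟩ := (K.exists_bd s).choose_spec
    rw [h]
    simp [triangle]
  bd_nodup s := by
    obtain ⟨x, y, z, hxy, hyz, hzx, -, h⟩ := (K.exists_bd s).choose_spec
    rw [h]
    have h1 := hxy.ne
    have h2 := hyz.ne
    have h3 := hzx.ne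
    simp only [triangle, Cycle.nodup_coe_iff]
    simp [SimpleGraph.Dart.ext_iff]
    grind
  bd_trail s d hd hd' := by
    obtain ⟨x, y, z, hxy, hyz, hzx, -, h⟩ := (K.exists_bd s).choose_spec
    rw [h] at hd hd'
    have h1 := hxy.ne
    have h2 := hyz.ne
    have h3 := hzx.ne
    simp only [triangle, Cycle.mem_coe_iff] at hd hd'
    simp [SimpleGraph.Dart.ext_iff, Prod.ext_iff] at hd hd'
    grind
  bd_closed s := by
    obtain ⟨x, y, z, hxy, hyz, hzx, -, h⟩ := (K.exists_bd s).choose_spec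
    rw [h]
    simp [triangle]

/-- The link graph at a vertex. (In a simplicial complex link graphs have neither loops nor parallel
edges.) -/
noncomputable def linkGraph (v : ι) : SimpleGraph (K.toTwoComplex.LinkVertex v) :=
  (K.toTwoComplex.link v).toSimpleGraph

/-- All link graphs are almost `3`-connected. -/
def IsLocallyAlmostThreeConnected : Prop := ∀ v, (K.linkGraph v).IsAlmostThreeConnected

/-- Every edge `d` that is incident with only two faces has an endvertex `x` such that the link graph
at `x` is neither a subdivision of a `3`-connected graph nor a parallel graph whose branch
vertices have degree at least three. -/
def IsStretchedOut : Prop :=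
  ∀ d : K.skeleton.Dart, {f | K.toTwoComplex.Incident f d}.ncard = 2 →
    ∃ x, (x = d.fst ∨ x = d.snd) ∧
      ¬ (K.linkGraph x).IsSubdivisionOfThreeConnected ∧ ¬ (K.linkGraph x).IsThickParallelGraph

/-- A path of the 1-skeleton is a para-path if the link graphs at its two endvertices are
subdivisions of `3`-connected graphs, and the link graphs at its interior vertices are parallel
graphs whose branch vertices have degree at least three. -/
def IsParaPath {u v : ι} (P : K.skeleton.Walk u v) : Prop :=
  P.IsPath ∧ (K.linkGraph u).IsSubdivisionOfThreeConnected ∧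
    (K.linkGraph v).IsSubdivisionOfThreeConnected ∧
    ∀ x ∈ P.support, x ≠ u → x ≠ v → (K.linkGraph x).IsThickParallelGraph

/-- The 2-complex obtained from `K` by contracting a set of edges. -/
noncomputable def contractEdges (S : Set (Sym2 ι)) : TwoComplex.{u} :=
  K.toTwoComplex.contract {d : K.skeleton.Dart | d.edge ∈ S}

/-- The vertex of the contraction onto which the vertex `v` is contracted. -/
def contractVertex (S : Set (Sym2 ι)) (v : ι) : (K.contractEdges S).V := Quot.mk _ v

end AbstractSimplicialComplex

/-!
All links of the complex are put together into one multigraph, the total link, whose vertices are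
the darts (directed edges) of the complex. Suppose that the last three alternatives fail. Local
planarity gives a *planar prerotation*: planar rotators at all darts, with no relation between a
dart and its reverse. The aim is to make the rotators at each dart and its reverse *opposite*, that
is, reverse to each other; such rotators form a planar rotation system
(`TwoComplex.IsPlanarPrerotation.hasPlanarRotationSystem`).

Planarity is used in the form of the *Jordan property*: every cycle with coefficients in the field
of two elements is a sum of face boundaries. It is equivalent to Euler's formula
(`MultiGraph.isPlanarRotationSystem_iff`), and it needs neither connectedness nor counting.
Contracting an edge of the complex joins the links at its two ends: the two vertices of the links
that belong to the edge disappear, and the link edges there are joined in pairs, one pair for each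
face at the contracted edge. Conversely, if both sides are connected, then in a planar rotation
system these pairs can be cut and their ends on either side merged into one vertex, with reverse
rotators at the two new vertices (`JordanProperty.split`). So a planar rotation system of the link
at the vertex onto which a path `P` is contracted can be split again, one edge of `P` after the
other. This gives a planar prerotation whose rotators are opposite at all edges with both ends on
`P` (`exists_opposite_on_path`).

The links are rigid. A subdivision of a 3-connected graph has only one planar rotation system up to
reversal (Whitney). A planar rotation system of a parallel graph with branch vertices of degree at
least three is determined by its rotator at one branch vertex, and this rotator can be prescribed.
In the other almost 3-connected graphs any two rotation systems agree up to reversal. Vertices with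
links of the first two kinds are called *solid* here. At the other vertices the rotators can be
copied from the other ends of the edges (`TwoComplex.exists_opposite_completion`), so that only the
edges between solid vertices matter.

As the complex is stretched out, each of these edges is a branch vertex of the links at its two
ends. Hence a solid vertex with a parallel link has at most two solid neighbours, and the vertices
with parallel links form paths and cycles. Along each of them the rotators can be made opposite: by
prescribing one link after the other, or, where this does not suffice, by contracting a para-path or
a chordless cycle without an edge (`exists_opposite_component`). By Whitney's theorem at the
remaining solid vertices there are then planar rotators which at every edge between solid vertices
are opposite or equal (`exists_hasTwist`). This gives a sign at every such edge. By the contraction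
of chordless cycles without an edge, the product of the signs along every chordless cycle is `1`, so
the signs come from signs at the vertices (`SimpleGraph.exists_potential`). Reversing the rotators
at the negative vertices makes all rotators at edges between solid vertices opposite
(`exists_opposite_of_isSolid`).
-/


/-! ### Cyclic permutations and functions with values in the field of two elements -/

open Classical in
/-- The indicator function of a point, with values in the field of two elements. -/
noncomputable def pointMass {H : Type*} (a h : H) : ZMod 2 := if h = a then 1 else 0

@[simp] theorem pointMass_self {H : Type*} (a : H) : pointMass a a = 1 := if_pos rfl

theorem pointMass_of_ne {H : Type*} {a h : H} (hne : h ≠ a) : pointMass a h = 0 := if_neg hne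

theorem pointMass_perm {H : Type*} (π : Perm H) (a h : H) :
    pointMass (π a) (π h) = pointMass a h := by
  by_cases h' : h = a
  · rw [h', pointMass_self, pointMass_self]
  · rw [pointMass_of_ne h', pointMass_of_ne (π.injective.ne h')]

theorem Equiv.Perm.sum_comp_of_mem_iff {H M : Type*} [AddCommMonoid M] (π : Perm H) (s : Finset H)
    (hs : ∀ h, π h ∈ s ↔ h ∈ s) (c : H → M) : ∑ h ∈ s, c (π h) = ∑ h ∈ s, c h :=
  Finset.sum_equiv π (fun h => (hs h).symm) fun _ _ => rfl

theorem Equiv.Perm.IsCycleOn.congr_of_eq {H : Type*} [Finite H] {π σ : Perm H} {s : Set H}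
    (hπ : π.IsCycleOn s) (h : ∀ a ∈ s, σ a = π a) : σ.IsCycleOn s := by
  have hpow : ∀ a ∈ s, ∀ n : ℕ, (σ ^ n) a = (π ^ n) a ∧ (π ^ n) a ∈ s := by
    intro a ha n
    induction n with
    | zero => exact ⟨rfl, ha⟩
    | succ n ih =>
      rw [pow_succ', pow_succ', Perm.mul_apply, Perm.mul_apply, ih.1, h _ ih.2]
      exact ⟨rfl, hπ.1.mapsTo ih.2⟩
  refine ⟨hπ.1.congr fun a ha => (h a ha).symm, fun a ha b hb => ?_⟩
  obtain ⟨n, hn⟩ := (hπ.2 ha hb).exists_nat_pow_eq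
  exact ⟨n, by rw [zpow_natCast, (hpow a ha n).1, hn]⟩

/-- A function that sums to zero over a cycle is a coboundary along this cycle. -/
theorem Equiv.Perm.IsCycleOn.exists_primitive {H : Type*} {π : Perm H} {s : Finset H}
    (hπ : π.IsCycleOn s) {Z : H → ZMod 2} (hZ : ∑ h ∈ s, Z h = 0) :
    ∃ y : H → ZMod 2, ∀ h ∈ s, y (π h) = y h + Z h := by
  classical
  rcases s.eq_empty_or_nonempty with rfl | ⟨a, ha⟩
  · exact ⟨0, by simp⟩
  have hex : ∀ h, ∃ n, h ∈ s → n < s.card ∧ (π ^ n) a = h := by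
    intro h
    by_cases hh : h ∈ s
    · obtain ⟨n, hn, e⟩ := hπ.exists_pow_eq ha hh
      exact ⟨n, fun _ => ⟨hn, e⟩⟩
    · exact ⟨0, fun h' => absurd h' hh⟩
  choose n hn using hex
  have hinj : ∀ i < s.card, ∀ j < s.card, (π ^ i) a = (π ^ j) a → i = j := by
    intro i hi j hj e
    exact Nat.ModEq.eq_of_lt_of_lt ((hπ.pow_apply_eq_pow_apply ha).1 e) hi hj
  have hmem : ∀ i, (π ^ i) a ∈ s := by
    intro i
    induction i with
    | zero => exact ha
    | succ i ih =>
      rw [pow_succ', Perm.mul_apply]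
      exact hπ.apply_mem_iff.2 ih
  have htot : ∑ i ∈ Finset.range s.card, Z ((π ^ i) a) = 0 := by
    rw [← hZ]
    refine Finset.sum_bij (fun i _ => (π ^ i) a) (fun i _ => hmem i) ?_ ?_ fun _ _ => rfl
    · intro i hi j hj e
      exact hinj i (Finset.mem_range.1 hi) j (Finset.mem_range.1 hj) e
    · intro b hb
      obtain ⟨i, hi, e⟩ := hπ.exists_pow_eq ha hb
      exact ⟨i, Finset.mem_range.2 hi, e⟩
  refine ⟨fun h => ∑ i ∈ Finset.range (n h), Z ((π ^ i) a), fun h hh => ?_⟩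
  obtain ⟨h1, h2⟩ := hn h hh
  obtain ⟨h3, h4⟩ := hn (π h) (hπ.apply_mem_iff.2 hh)
  have hsucc : (π ^ (n h + 1)) a = π h := by rw [pow_succ', Perm.mul_apply, h2]
  have hval : ∑ i ∈ Finset.range (n h + 1), Z ((π ^ i) a) =
      ∑ i ∈ Finset.range (n h), Z ((π ^ i) a) + Z h := by
    rw [Finset.sum_range_succ, h2]
  change ∑ i ∈ Finset.range (n (π h)), Z ((π ^ i) a) = _
  rw [← hval]
  rcases lt_or_eq_of_le (Nat.succ_le_of_lt h1) with hlt | heq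
  · rw [hinj _ h3 _ hlt (h4.trans hsucc.symm)]
  · have h0 : n (π h) = 0 := by
      refine hinj _ h3 _ (by omega) (h4.trans ?_)
      rw [← hsucc, ← Nat.succ_eq_add_one, heq, hπ.pow_card_apply ha]
      rfl
    rw [h0, ← Nat.succ_eq_add_one, heq, htot]
    rfl

/-- A potential along a cycle that jumps exactly at `a` and `b` separates `a` from `b`. -/
theorem Equiv.Perm.SameCycle.potential_eq_add_one {H : Type*} [Finite H] {π : Perm H} {a b : H}
    (hab : π.SameCycle a b) (hne : a ≠ b) {N : Set H} (hN : ∀ h ∈ N, π h ∈ N) (ha : a ∈ N)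
    {c : H → ZMod 2} (hc : ∀ h ∈ N, c (π h) = c h + (pointMass a h + pointMass b h)) :
    c b = c a + 1 := by
  classical
  obtain ⟨n, hn, hmin⟩ : ∃ n, (π ^ n) a = b ∧ ∀ m < n, (π ^ m) a ≠ b := by
    have hex : ∃ n, (π ^ n) a = b := hab.exists_nat_pow_eq
    exact ⟨Nat.find hex, Nat.find_spec hex, fun m hm => Nat.find_min hex hm⟩
  have hmem : ∀ i, (π ^ i) a ∈ N := by
    intro i
    induction i with
    | zero => exact ha
    | succ i ih =>
      rw [pow_succ', Perm.mul_apply]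
      exact hN _ ih
  have key : ∀ i, i + 1 ≤ n → c ((π ^ (i + 1)) a) = c a + 1 := by
    intro i
    induction i with
    | zero =>
      intro _
      have := hc a ha
      rw [pointMass_self, pointMass_of_ne hne] at this
      simpa using this
    | succ i ih =>
      intro hi
      have h1 := ih (by omega)
      have h2 : (π ^ (i + 1)) a ≠ b := hmin _ (by omega)
      have h3 : (π ^ (i + 1)) a ≠ a := by
        intro e
        refine hmin (n - (i + 1)) (by omega) ?_
        rw [← hn]
        conv_rhs => rw [← Nat.sub_add_cancel (show i + 1 ≤ n by omega), pow_add,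
          Perm.mul_apply, e]
      have h4 := hc _ (hmem (i + 1))
      rw [pointMass_of_ne h2, pointMass_of_ne h3] at h4
      rw [pow_succ', Perm.mul_apply, h4, h1]
      simp
  obtain ⟨m, rfl⟩ : ∃ m, n = m + 1 := by
    refine Nat.exists_eq_succ_of_ne_zero fun h0 => hne ?_
    rw [h0] at hn
    exact hn
  rw [← hn]
  exact key m le_rfl

/-- A permutation of a finite set is cyclic if any two points can be separated by a potential
that jumps exactly there. -/
theorem Equiv.Perm.isCycleOn_of_potentials {H : Type*} [Finite H] {π : Perm H} {N : Set H}
    (hN : ∀ h, π h ∈ N ↔ h ∈ N)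
    (hpot : ∀ a ∈ N, ∀ b ∈ N, a ≠ b → ∃ c : H → ZMod 2, ∀ h ∈ N,
      c (π h) = c h + (pointMass a h + pointMass b h)) : π.IsCycleOn N := by
  classical
  have := Fintype.ofFinite H
  refine ⟨⟨fun h hh => (hN h).2 hh, π.injective.injOn, fun h hh => ?_⟩, fun a ha b hb => ?_⟩
  · refine ⟨π⁻¹ h, ?_, by simp⟩
    rw [← hN]
    simpa using hh
  · by_contra hab
    have hne : a ≠ b := fun e => hab (e ▸ Perm.SameCycle.refl _ _)
    obtain ⟨c, hc⟩ := hpot a ha b hb hne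
    set s : Finset H := Finset.univ.filter fun h => π.SameCycle a h ∧ h ∈ N with hs
    have h1 : ∑ h ∈ s, c (π h) = ∑ h ∈ s, c h :=
      π.sum_comp_of_mem_iff s (fun h => by simp [hs, hN]) c
    have h2 : ∑ h ∈ s, c (π h) = ∑ h ∈ s, (c h + (pointMass a h + pointMass b h)) :=
      Finset.sum_congr rfl fun h hh => hc h (by simp [hs] at hh; exact hh.2)
    have h3 : ∑ h ∈ s, pointMass a h = 1 := by
      rw [Finset.sum_eq_single a]
      · simp
      · intro h _ hne; exact pointMass_of_ne hne
      · intro h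
        exact absurd (by simp [hs, ha, Perm.SameCycle.refl]) h
    have h4 : ∑ h ∈ s, pointMass b h = 0 := by
      refine Finset.sum_eq_zero fun h hh => pointMass_of_ne ?_
      rintro rfl
      simp [hs] at hh
      exact hab hh.1
    rw [Finset.sum_add_distrib, Finset.sum_add_distrib, h3, h4] at h2
    rw [h1] at h2
    simp at h2

/-- Skipping the points outside `U`, a permutation induces a permutation of `U`; a function that
changes along the permutation by a weight supported on `U` changes in the same way
along the induced permutation. -/
theorem Equiv.Perm.exists_induced {H : Type*} [Finite H] (φ : Perm H) (U : Set H) :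
    ∃ α : Perm H, (∀ h, h ∉ U → α h = h) ∧
      ∀ c w : H → ZMod 2, (∀ h, h ∉ U → w h = 0) → (∀ h, c (φ h) = c h + w (φ h)) →
        ∀ h ∈ U, c (α h) = c h + w (α h) := by
  classical
  have := Fintype.ofFinite H
  have key : ∀ s : Finset H, ∃ α : Perm H, (∀ h ∈ s, α h = h) ∧
      ∀ c w : H → ZMod 2, (∀ h ∈ s, w h = 0) → (∀ h, c (φ h) = c h + w (φ h)) →
        ∀ h, h ∉ s → c (α h) = c h + w (α h) := by
    intro s
    induction s using Finset.induction_on with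
    | empty => exact ⟨φ, by simp, fun c w _ h h' _ => h h'⟩
    | insert x s hx ih =>
      obtain ⟨α, h1, h2⟩ := ih
      refine ⟨swap x (α x) * α, ?_, ?_⟩
      · intro h hh
        rw [Finset.mem_insert] at hh
        rcases hh with rfl | hh
        · simp
        · rw [Perm.mul_apply, h1 h hh]
          refine swap_apply_of_ne_of_ne (fun e => hx (e ▸ hh)) fun e => hx ?_
          have : α h = α x := (h1 h hh).trans e
          exact α.injective this ▸ hh
      · intro c w hw hc h hh
        rw [Finset.mem_insert, not_or] at hh
        have h3 := h2 c w (fun k hk => hw k (Finset.mem_insert_of_mem hk)) hc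
        rw [Perm.mul_apply]
        by_cases hxh : α h = x
        · rw [hxh, swap_apply_left]
          have h4 := h3 h hh.2
          rw [hxh, hw x (Finset.mem_insert_self _ _)] at h4
          rw [h3 x hx, h4]
          ring
        · rw [swap_apply_of_ne_of_ne hxh fun e => hh.1 (α.injective e)]
          exact h3 h hh.2
  obtain ⟨α, h1, h2⟩ := key (Finset.univ.filter fun h => h ∉ U)
  refine ⟨α, fun h hh => h1 h (by simp [hh]), fun c w hw hc h hh => h2 c w ?_ hc h (by simp [hh])⟩
  intro h hh
  exact hw h (by simpa using hh)

/-! ### The Jordan property of combinatorial maps -/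

/-- The *Jordan property* of a combinatorial map, given by the permutation `τ` that exchanges
the two halves of every edge and the rotation `r` of the half-edges. Every mod-2 cycle `Z` (a set
of edges that is even at every vertex, which is expressed by a primitive `y` along the
rotators) is the boundary of a set of faces. Here a set of faces is given by a function `c` on the
angles, where `c h` belongs to the angle just before the half-edge `h`. -/
def JordanProperty {H : Type*} (τ r : Perm H) : Prop :=
  ∀ Z y : H → ZMod 2, (∀ h, Z (τ h) = Z h) → (∀ h, y (r h) = y h + Z h) →
    ∃ c : H → ZMod 2, ∀ h, c (τ h) = c h + Z h ∧ c (r h) = c h + Z h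

/-- The Jordan property does not change under reversal of all rotators: the faces of the mirror
image have the same boundaries. -/
theorem JordanProperty.inv {H : Type*} {τ r : Perm H} (h : JordanProperty τ r) :
    JordanProperty τ r⁻¹ := by
  intro Z y hZ hy
  have hy' : ∀ h, y h = y (r h) + Z (r h) := by
    intro h
    have := hy (r h)
    simpa using this
  obtain ⟨c, hc⟩ := h Z (fun h => y h + Z h) hZ fun h => by
    have := hy' h
    grind
  refine ⟨fun h => c h + Z h, fun h => ⟨?_, ?_⟩⟩
  · have := hc h
    have := hZ h
    grind
  · have := (hc (r⁻¹ h)).2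
    rw [show r (r⁻¹ h) = h by simp] at this
    grind

section Split

variable {H : Type*} {τ r : Perm H} {N U X : Set H}

/-- If the points of `N` are connected by `τ` and by `r` outside `U`, then there is an
edge set with prescribed trace on `N` which is even at all vertices outside `U`. -/
theorem exists_join [Finite H] (hτ : ∀ h, τ (τ h) = h) (hrU : ∀ h, h ∉ U → r h ∉ U)
    (hNU : N ⊆ U) (hXτ : ∀ h, τ h ∈ X ↔ h ∈ X) (hXr : ∀ h, h ∉ U → (r h ∈ X ↔ h ∈ X)) (hNX : N ⊆ X)
    (hconn : ∀ g : H → ZMod 2, (∀ h, g (τ h) = g h) → (∀ h, h ∉ U → g (r h) = g h) →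
      ∀ a ∈ N, ∀ b ∈ N, g a = g b)
    {t : H → ZMod 2} (htN : ∀ h, h ∉ N → t h = 0) (ht : ∑ᶠ h, t h = 0) :
    ∃ W y : H → ZMod 2, (∀ h, W (τ h) = W h) ∧ (∀ h ∈ U, y h = 0 ∧ W h = t h) ∧
      (∀ h, h ∉ U → W h = y (r h) + y h) ∧ ∀ h, h ∉ X → W h = 0 := by
  classical
  have := Fintype.ofFinite H
  rw [finsum_eq_sum_of_fintype] at ht
  rcases N.eq_empty_or_nonempty with rfl | ⟨a, ha⟩
  · refine ⟨0, 0, by simp, ?_, by simp, by simp⟩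
    intro h _
    simp [htN h (by simp)]
  -- the points that can be joined to `a`
  set 𝒢 : H → Prop := fun k => ∃ W y : H → ZMod 2, (∀ h, W (τ h) = W h) ∧
    (∀ h ∈ U, y h = 0 ∧ W h = pointMass a h + pointMass k h) ∧
    ∀ h, h ∉ U → W h = pointMass a h + pointMass k h + y (r h) + y h with h𝒢
  have hτ𝒢 : ∀ k, 𝒢 k → 𝒢 (τ k) := by
    rintro k ⟨W, y, h1, h2, h3⟩
    refine ⟨fun h => W h + pointMass k h + pointMass (τ k) h, y, fun h => ?_, fun h hh => ?_,
      fun h hh => ?_⟩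
    · have e1 : pointMass (τ k) (τ h) = pointMass k h := pointMass_perm τ k h
      have e2 : pointMass k (τ h) = pointMass (τ k) h := by
        rw [← pointMass_perm τ k (τ h), hτ]
      simp only [h1, e1, e2]
      ring
    · refine ⟨(h2 h hh).1, ?_⟩
      simp only [(h2 h hh).2]
      grind
    · simp only [h3 h hh]
      grind
  have hr𝒢 : ∀ k, k ∉ U → (𝒢 k ↔ 𝒢 (r k)) := by
    intro k hk
    have hz : ∀ h ∈ U, pointMass k h = 0 ∧ pointMass (r k) h = 0 := fun h hh =>
      ⟨pointMass_of_ne fun e => hk (e ▸ hh), pointMass_of_ne fun e => hrU k hk (e ▸ hh)⟩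
    constructor
    · rintro ⟨W, y, h1, h2, h3⟩
      refine ⟨W, fun h => y h + pointMass (r k) h, h1, fun h hh => ?_, fun h hh => ?_⟩
      · have := hz h hh
        have := h2 h hh
        grind
      · have := h3 h hh
        have := pointMass_perm r k h
        grind
    · rintro ⟨W, y, h1, h2, h3⟩
      refine ⟨W, fun h => y h + pointMass (r k) h, h1, fun h hh => ?_, fun h hh => ?_⟩
      · have := hz h hh
        have := h2 h hh
        grind
      · have := h3 h hh
        have := pointMass_perm r k h
        grind
  have hall : ∀ k ∈ N, 𝒢 k := by
    intro k hk
    have ha𝒢 : 𝒢 a := ⟨0, 0, by simp, by simp; grind, by simp; grind⟩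
    have := hconn (fun h => if 𝒢 h then 1 else 0) (fun h => ?_) (fun h hh => ?_) a ha k hk
    · by_contra hk'
      simp [ha𝒢, hk'] at this
    · have : 𝒢 (τ h) ↔ 𝒢 h := ⟨fun h' => by simpa [hτ] using hτ𝒢 _ h', hτ𝒢 h⟩
      simp [this]
    · simp [hr𝒢 h hh]
  have hall' : ∀ k, ∃ W y : H → ZMod 2, k ∈ N → (∀ h, W (τ h) = W h) ∧
      (∀ h ∈ U, y h = 0 ∧ W h = pointMass a h + pointMass k h) ∧
      ∀ h, h ∉ U → W h = pointMass a h + pointMass k h + y (r h) + y h := by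
    intro k
    by_cases hk : k ∈ N
    · obtain ⟨W, y, h⟩ := hall k hk
      exact ⟨W, y, fun _ => h⟩
    · exact ⟨0, 0, fun h => absurd h hk⟩
  choose W y hWy using hall'
  have hsum : ∀ h, ∑ k, t k * (pointMass a h + pointMass k h) = t h := by
    intro h
    simp only [mul_add, Finset.sum_add_distrib, ← Finset.sum_mul, ht, zero_mul, zero_add]
    rw [Finset.sum_eq_single h]
    · simp
    · intro k _ hk
      rw [pointMass_of_ne hk.symm, mul_zero]
    · simp
  have hterm : ∀ (F G : H → ZMod 2), (∀ k ∈ N, F k = G k) →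
      ∑ k, t k * F k = ∑ k, t k * G k := by
    intro F G hFG
    refine Finset.sum_congr rfl fun k _ => ?_
    by_cases hk : k ∈ N
    · rw [hFG k hk]
    · rw [htN k hk, zero_mul, zero_mul]
  -- sum up, and keep the part inside `X`
  set iX : H → ZMod 2 := fun h => if h ∈ X then 1 else 0 with hiX
  have hiXτ : ∀ h, iX (τ h) = iX h := fun h => by simp [hiX, hXτ]
  have hiXr : ∀ h, h ∉ U → iX (r h) = iX h := fun h hh => by simp [hiX, hXr h hh]
  refine ⟨fun h => iX h * ∑ k, t k * W k h, fun h => iX h * ∑ k, t k * y k h, fun h => ?_,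
    fun h hh => ⟨?_, ?_⟩, fun h hh => ?_, fun h hh => ?_⟩
  · simp only [hiXτ]
    rw [hterm (fun k => W k (τ h)) (fun k => W k h) fun k hk => (hWy k hk).1 h]
  · beta_reduce
    rw [hterm (fun k => y k h) (fun _ => 0) fun k hk => ((hWy k hk).2.1 h hh).1]
    simp
  · beta_reduce
    rw [hterm (fun k => W k h) _ fun k hk => ((hWy k hk).2.1 h hh).2, hsum]
    by_cases hX : h ∈ X
    · simp [hiX, hX]
    · rw [htN h fun h' => hX (hNX h')]
      simp
  · beta_reduce
    rw [hterm (fun k => W k h) _ fun k hk => (hWy k hk).2.2 h hh]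
    simp only [hiXr h hh, ← mul_add, ← Finset.sum_add_distrib]
    congr 1
    have h0 : t h = 0 := htN h fun h' => hh (hNU h')
    rw [← add_zero (∑ i, _), ← h0, ← hsum h, ← Finset.sum_add_distrib]
    refine Finset.sum_congr rfl fun k _ => ?_
    grind
  · simp [hiX, hh]

/-- Two permutations that preserve a set can be glued along it. -/
theorem Equiv.Perm.exists_piecewise (p q : Perm H) (U : Set H) (hp : ∀ h, p h ∈ U ↔ h ∈ U)
    (hq : ∀ h, q h ∈ U ↔ h ∈ U) :
    ∃ s : Perm H, (∀ h ∈ U, s h = p h) ∧ ∀ h, h ∉ U → s h = q h := by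
  classical
  have hp' : ∀ h, p.symm h ∈ U ↔ h ∈ U := fun h => by rw [← hp]; simp
  have hq' : ∀ h, q.symm h ∈ U ↔ h ∈ U := fun h => by rw [← hq]; simp
  refine ⟨⟨fun h => if h ∈ U then p h else q h, fun h => if h ∈ U then p.symm h else q.symm h,
    fun h => ?_, fun h => ?_⟩, fun h hh => if_pos hh, fun h hh => if_neg hh⟩
  · by_cases hh : h ∈ U <;> simp [hh, hp, hq]
  · by_cases hh : h ∈ U <;> simp [hh, hp', hq']

/-- An edge set that is even off `N ∪ N'` and takes equal values on points exchanged by `r` is even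
everywhere. -/
theorem exists_primitive_of_exchange {N' : Set H} (hNN' : ∀ h ∈ N, h ∉ N')
    (hrN : ∀ h ∈ N, r h ∈ N') (hrN' : ∀ h ∈ N', r h ∈ N) (hrU : ∀ h, r h ∈ N ∪ N' ↔ h ∈ N ∪ N')
    {Z y₀ : H → ZMod 2} (hoff : ∀ h, h ∉ N ∪ N' → Z h = y₀ (r h) + y₀ h)
    (hon : ∀ h ∈ N ∪ N', Z (r h) = Z h) : ∃ y : H → ZMod 2, ∀ h, y (r h) = y h + Z h := by
  classical
  refine ⟨fun h => if h ∈ N' then Z h else if h ∈ N then 0 else y₀ h, fun h => ?_⟩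
  by_cases hh : h ∈ N ∪ N'
  · have h2 := hon h hh
    rcases hh with hh | hh
    · simp [hrN h hh, hNN' h hh, hh, h2]
    · simp only [hrN' h hh, hNN' _ (hrN' h hh), hh, if_true, if_false]
      grind
  · have h1 : r h ∉ N ∪ N' := fun h' => hh ((hrU h).1 h')
    rw [Set.mem_union, not_or] at h1
    have h2 := hoff h hh
    rw [Set.mem_union, not_or] at hh
    simp only [h1, hh, if_false]
    grind

/-- The rotators at the two ends of a split edge: `π` lists the points of `N` (and of `N'`) in the
order in which the faces of the map connect them. -/
theorem exists_splitRotator [Finite H] (hXτ : ∀ h, τ h ∈ X ↔ h ∈ X)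
    (hrU : ∀ h, r h ∈ U ↔ h ∈ U) (hXr : ∀ h, h ∉ U → (r h ∈ X ↔ h ∈ X)) :
    ∃ π : Perm H, (∀ h, π h ∈ U ↔ h ∈ U) ∧ (∀ h ∈ U, (π h ∈ X ↔ h ∈ X)) ∧
      ∀ Z c : H → ZMod 2, (∀ h, Z (τ h) = Z h) →
        (∀ h, c (τ h) = c h + Z h ∧ c (r h) = c h + Z h) → ∀ h ∈ U, c (π h) = c h + Z h := by
  classical
  obtain ⟨r₁, hr₁, hr₁'⟩ := Perm.exists_piecewise 1 r U (by simp) hrU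
  obtain ⟨α, hα, hα'⟩ := (r₁ * τ).exists_induced U
  have hαU : ∀ h, α h ∈ U ↔ h ∈ U := by
    intro h
    by_cases hh : h ∈ U
    · simp only [hh, iff_true]
      by_contra h'
      rw [α.injective (hα _ h')] at h'
      exact h' hh
    · simp [hα h hh]
  have hαU' : ∀ h, α⁻¹ h ∈ U ↔ h ∈ U := fun h => by rw [← hαU]; simp
  have hαX : ∀ h ∈ U, (α h ∈ X ↔ h ∈ X) := by
    intro h hh
    have := hα' (fun h => if h ∈ X then 1 else 0) 0 (by simp) (fun h => ?_) h hh
    · by_cases h1 : α h ∈ X <;> by_cases h2 : h ∈ X <;> simp_all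
    · have : r₁ (τ h) ∈ X ↔ h ∈ X := by
        by_cases h1 : τ h ∈ U
        · rw [hr₁ _ h1]
          exact hXτ h
        · rw [hr₁' _ h1, hXr _ h1, hXτ]
      simp [this]
  refine ⟨α⁻¹, hαU', fun h hh => ?_, fun Z c hZ hc h hh => ?_⟩
  · rw [← hαX _ ((hαU' h).2 hh)]
    simp
  · have := hα' c (fun h => if h ∈ U then Z h else 0) (fun h hh => if_neg hh) (fun h => ?_)
      (α⁻¹ h) ((hαU' h).2 hh)
    · rw [show α (α⁻¹ h) = h by simp] at this
      simp only [hh, if_true] at this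
      grind
    · rw [Perm.mul_apply]
      by_cases h1 : τ h ∈ U
      · rw [hr₁ _ h1]
        simp [h1, (hc h).1, hZ]
      · have h2 : r (τ h) ∉ U := fun h' => h1 ((hrU _).1 h')
        have h3 := hc h
        have h4 := (hc (τ h)).2
        have h5 := hZ h
        rw [hr₁' _ h1, if_neg h2]
        grind

theorem sum_pointMass_add [Fintype H] (a b : H) : ∑ h, (pointMass a h + pointMass b h) = 0 := by
  have h1 : ∀ a : H, ∑ h, pointMass a h = 1 := by
    intro a
    rw [Finset.sum_eq_single a (fun h _ hne => pointMass_of_ne hne) (by simp)]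
    simp
  rw [Finset.sum_add_distrib, h1, h1]
  rfl

/-- **Splitting a contracted edge.** Let `r` be a rotation with the Jordan property which on
`N ∪ N'` just exchanges the points of `N` with those of `N'` (this is how a family of parallel
edges between two parts of a map looks like when these edges are subdivided). If each of the two
parts `X` and `Xᶜ` is connected, then the points of `N` can be merged to one vertex,
and likewise those of `N'`, with rotators that are reverse to each other. -/
theorem JordanProperty.split [Finite H] {N' : Set H} (hτ : ∀ h, τ (τ h) = h)
    (hJ : JordanProperty τ r) (hNX : N ⊆ X) (hN'X : N' ⊆ Xᶜ) (hrN : ∀ h ∈ N, r h ∈ N')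
    (hrN' : ∀ h ∈ N', r h ∈ N) (hrr : ∀ h ∈ N ∪ N', r (r h) = h) (hXτ : ∀ h, τ h ∈ X ↔ h ∈ X)
    (hXr : ∀ h, h ∉ N ∪ N' → (r h ∈ X ↔ h ∈ X))
    (hconn : ∀ g : H → ZMod 2, (∀ h, g (τ h) = g h) → (∀ h, h ∉ N ∪ N' → g (r h) = g h) →
      ∀ a ∈ N, ∀ b ∈ N, g a = g b)
    (hconn' : ∀ g : H → ZMod 2, (∀ h, g (τ h) = g h) → (∀ h, h ∉ N ∪ N' → g (r h) = g h) →
      ∀ a ∈ N', ∀ b ∈ N', g a = g b) :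
    ∃ r' : Perm H, (∀ h, h ∉ N ∪ N' → r' h = r h) ∧ r'.IsCycleOn N ∧
      (∀ h ∈ N ∪ N', r' (r h) = r (r'⁻¹ h)) ∧ JordanProperty τ r' := by
  classical
  have := Fintype.ofFinite H
  set U : Set H := N ∪ N' with hU
  have hNU : N ⊆ U := Set.subset_union_left
  have hN'U : N' ⊆ U := Set.subset_union_right
  have hNN' : ∀ h ∈ N, h ∉ N' := fun h h1 h2 => hN'X h2 (hNX h1)
  have hrU1 : ∀ h ∈ U, r h ∈ U := by
    rintro h (hh | hh)
    · exact hN'U (hrN h hh)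
    · exact hNU (hrN' h hh)
  have hrU : ∀ h, r h ∈ U ↔ h ∈ U := by
    refine fun h => ⟨fun hh => ?_, hrU1 h⟩
    have := r.injective (hrr _ hh)
    rw [← this]
    exact hrU1 _ hh
  obtain ⟨π, hπU, hπX, hcol⟩ := exists_splitRotator (U := U) hXτ hrU hXr
  have hπN : ∀ h, π h ∈ N ↔ h ∈ N := by
    intro h
    have h1 : ∀ k, k ∈ N ↔ k ∈ U ∧ k ∈ X := by
      refine fun k => ⟨fun hk => ⟨hNU hk, hNX hk⟩, ?_⟩
      rintro ⟨hk | hk, hk'⟩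
      · exact hk
      · exact absurd hk' (hN'X hk)
    rw [h1, h1, hπU]
    exact and_congr_right fun hh => hπX h hh
  -- edge sets with prescribed traces
  have hjoin : ∀ t : H → ZMod 2, (∀ h, h ∉ N → t h = 0) → ∑ᶠ h, t h = 0 →
      ∃ W y : H → ZMod 2, (∀ h, W (τ h) = W h) ∧ (∀ h ∈ U, y h = 0 ∧ W h = t h) ∧
        (∀ h, h ∉ U → W h = y (r h) + y h) ∧ ∀ h, h ∉ X → W h = 0 :=
    fun t h1 h2 => exists_join hτ (fun h hh h' => hh ((hrU h).1 h')) hNU hXτ hXr hNX hconn h1 h2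
  have hjoin' : ∀ t : H → ZMod 2, (∀ h, h ∉ N → t h = 0) → ∑ᶠ h, t h = 0 →
      ∃ W y : H → ZMod 2, (∀ h, W (τ h) = W h) ∧ (∀ h ∈ U, y h = 0 ∧ W h = t (r h)) ∧
        (∀ h, h ∉ U → W h = y (r h) + y h) ∧ ∀ h, h ∉ Xᶜ → W h = 0 := by
    intro t h1 h2
    refine exists_join hτ (fun h hh h' => hh ((hrU h).1 h')) hN'U (X := Xᶜ)
      (fun h => not_congr (hXτ h)) (fun h hh => not_congr (hXr h hh)) hN'X hconn' ?_ ?_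
    · intro h hh
      refine h1 _ fun h' => hh ?_
      have := hrN _ h'
      rwa [hrr] at this
      rw [← hrU]
      exact hNU h'
    · rw [finsum_eq_sum_of_fintype] at h2 ⊢
      rw [← h2]
      exact Equiv.sum_comp r t
  -- the colourings separate the points of `N`
  have hsep : ∀ a ∈ N, ∀ b ∈ N, a ≠ b → ∃ Z c : H → ZMod 2, (∀ h, Z (τ h) = Z h) ∧
      (∀ h, c (τ h) = c h + Z h ∧ c (r h) = c h + Z h) ∧
      (∀ h ∈ N, Z h = pointMass a h + pointMass b h) ∧ ∀ h ∈ N, Z (r h) = Z h := by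
    intro a ha b hb hab
    have ht0 : ∑ᶠ h, (pointMass a h + pointMass b h) = 0 := by
      rw [finsum_eq_sum_of_fintype, sum_pointMass_add]
    have ht : ∀ h, h ∉ N → pointMass a h + pointMass b h = 0 := by
      intro h hh
      rw [pointMass_of_ne (a := a) fun e => hh (by rw [e]; exact ha),
        pointMass_of_ne (a := b) fun e => hh (by rw [e]; exact hb), add_zero]
    obtain ⟨W, y, h1, h2, h3, h4⟩ := hjoin _ ht ht0
    obtain ⟨W', y', h1', h2', h3', h4'⟩ := hjoin' _ ht ht0
    have hZr : ∀ h ∈ U, W (r h) + W' (r h) = W h + W' h := by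
      intro h hh
      rw [(h2 h hh).2, (h2' h hh).2, (h2 _ (hrU1 h hh)).2, (h2' _ (hrU1 h hh)).2, hrr h hh]
      ring
    obtain ⟨y₁, hy₁⟩ := exists_primitive_of_exchange (Z := fun h => W h + W' h)
      (y₀ := fun h => y h + y' h) hNN' hrN hrN' hrU
      (fun h hh => by rw [h3 h hh, h3' h hh]; ring) hZr
    obtain ⟨c, hc⟩ := hJ (fun h => W h + W' h) y₁ (fun h => by rw [h1, h1']) hy₁
    refine ⟨_, c, fun h => by rw [h1, h1'], hc, fun h hh => ?_, fun h hh => hZr h (hNU hh)⟩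
    have h5 : r h ∉ N := fun h' => hNN' _ h' (hrN h hh)
    rw [(h2 h (hNU hh)).2, (h2' h (hNU hh)).2, ht _ h5, add_zero]
  have hcyc : π.IsCycleOn N := by
    refine Perm.isCycleOn_of_potentials hπN fun a ha b hb hab => ?_
    obtain ⟨Z, c, h1, h2, h3, -⟩ := hsep a ha b hb hab
    exact ⟨c, fun h hh => by rw [hcol Z c h1 h2 h (hNU hh), h3 h hh]⟩
  have hπr : ∀ h ∈ N, π (r (π (r h))) = h := by
    intro h hh
    have hr1 : r h ∈ U := hN'U (hrN h hh)
    have hr2 : π (r h) ∈ N' := by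
      rcases (hπU _).2 hr1 with h' | h'
      · exact absurd ((hπN _).1 h') fun h'' => hNN' _ h'' (hrN h hh)
      · exact h'
    have hr3 := hrN' _ hr2
    have hr4 : π (r (π (r h))) ∈ N := (hπN _).2 hr3
    by_contra hne
    obtain ⟨Z, c, h1, h2, h3, h4⟩ := hsep h hh _ hr4 (Ne.symm hne)
    have h5 := (hcyc.2 hh hr4).potential_eq_add_one (Ne.symm hne) (fun k hk => (hπN k).2 hk) hh
      (c := c) fun k hk => by rw [hcol Z c h1 h2 k (hNU hk), h3 k hk]
    have e1 := hcol Z c h1 h2 _ hr1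
    have e2 := hcol Z c h1 h2 _ (hNU hr3)
    have e3 := (h2 h).2
    have e4 := h4 h hh
    have e5 := (h2 (r (π (r h)))).2
    rw [hrr _ (hN'U hr2)] at e5
    grind
  obtain ⟨r', hr', hr''⟩ := Perm.exists_piecewise π r U hπU hrU
  have hr'U : ∀ h, r' h ∈ U ↔ h ∈ U := by
    intro h
    by_cases hh : h ∈ U
    · rw [hr' h hh, hπU]
    · rw [hr'' h hh, hrU]
  have hr'X : ∀ h, r' h ∈ X ↔ h ∈ X := by
    intro h
    by_cases hh : h ∈ U
    · rw [hr' h hh, hπX h hh]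
    · rw [hr'' h hh, hXr h hh]
  have hrev : ∀ h ∈ U, r' (r (r' h)) = r h := by
    intro h hh
    rw [hr' h hh]
    rcases hh with hh | hh
    · have h1 : π h ∈ N := (hπN h).2 hh
      have h2 := hN'U (hrN _ h1)
      rw [hr' _ h2]
      have h3 := hπr _ h1
      have h4 := π.injective h3
      have h5 := congrArg r h4
      rwa [hrr _ ((hπU _).2 h2)] at h5
    · have h1 := hπr _ (hrN' h hh)
      rw [hrr h (hN'U hh)] at h1
      rw [hr' _ (hrU1 _ ((hπU h).2 (hN'U hh)))]
      exact h1
  have hrev' : ∀ h ∈ U, r' (r h) = r (r'⁻¹ h) := by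
    intro h hh
    have h1 := hrev (r'⁻¹ h) (by rw [← hr'U]; simpa using hh)
    rwa [show r' (r'⁻¹ h) = h by simp] at h1
  have hr'N : ∀ h, r' h ∈ N ↔ h ∈ N := by
    intro h
    by_cases hh : h ∈ U
    · rw [hr' h hh, hπN]
    · exact iff_of_false (fun h' => hh ((hr'U h).1 (hNU h'))) fun h' => hh (hNU h')
  refine ⟨r', hr'', hcyc.congr_of_eq fun h hh => hr' h (hNU hh), hrev', ?_⟩
  · intro Z y hZ hy
    -- the amount by which `Z` fails to be an even set of the unsplit map
    set t : H → ZMod 2 := fun h => if h ∈ N then Z h + Z (r h) else 0 with ht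
    have htN : ∀ h, h ∉ N → t h = 0 := fun h hh => if_neg hh
    have ht0 : ∑ᶠ h, t h = 0 := by
      have e1 : ∑ h with h ∈ N, y (r' h) = ∑ h with h ∈ N, y h :=
        r'.sum_comp_of_mem_iff _ (fun h => by simp [hr'N]) y
      have e2 : ∑ h with h ∈ N, y (r (r'⁻¹ h)) = ∑ h with h ∈ N, y (r h) :=
        r'⁻¹.sum_comp_of_mem_iff _ (fun h => by
          rw [Finset.mem_filter_univ, Finset.mem_filter_univ, ← hr'N (r'⁻¹ h)]
          simp) fun h => y (r h)
      have e3 : ∑ h with h ∈ N, t h = ∑ h with h ∈ N,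
          ((y (r' h) + y h) + (y (r (r'⁻¹ h)) + y (r h))) := by
        refine Finset.sum_congr rfl fun h hh => ?_
        have hh' : h ∈ N := by simpa using hh
        have e4 := hy h
        have e5 := hy (r h)
        rw [hrev' h (hNU hh')] at e5
        rw [ht]
        simp only [hh', if_true]
        grind
      rw [finsum_eq_sum_of_fintype, ← Finset.sum_filter_add_sum_filter_not _ (· ∈ N), e3]
      simp only [Finset.sum_add_distrib, e1, e2]
      rw [Finset.sum_eq_zero (s := {x | x ∉ N}) fun h hh => htN h (by simpa using hh)]
      simp [CharTwo.add_self_eq_zero]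
    obtain ⟨W, w, h1, h2, h3, h4⟩ := hjoin t htN ht0
    obtain ⟨W', w', h1', h2', h3', h4'⟩ := hjoin' t htN ht0
    have hyr : ∀ h, h ∉ U → Z h = y (r h) + y h := by
      intro h hh
      have := hy h
      rw [hr'' h hh] at this
      grind
    have main : ∀ W w : H → ZMod 2, (∀ h, W (τ h) = W h) → (∀ h, h ∉ U → W h = w (r h) + w h) →
        (∀ h ∈ U, W h + W (r h) = Z h + Z (r h)) → ∃ c : H → ZMod 2,
          ∀ h, c (τ h) = c h + (Z h + W h) ∧ c (r' h) = c h + (Z h + W h) := by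
      intro W w h1 h2 h3
      have hZW : ∀ h, Z (τ h) + W (τ h) = Z h + W h := fun h => by rw [hZ, h1]
      obtain ⟨y₁, hy₁⟩ := exists_primitive_of_exchange (Z := fun h => Z h + W h)
        (y₀ := fun h => y h + w h) hNN' hrN hrN' hrU
        (fun h hh => by rw [hyr h hh, h2 h hh]; ring) fun h hh => by
          have := h3 h hh
          grind
      obtain ⟨c, hc⟩ := hJ _ y₁ hZW hy₁
      refine ⟨c, fun h => ⟨(hc h).1, ?_⟩⟩
      by_cases hh : h ∈ U
      · rw [hr' h hh]
        exact hcol _ c hZW hc h hh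
      · rw [hr'' h hh]
        exact (hc h).2
    have htr : ∀ h ∈ U, t h + t (r h) = Z h + Z (r h) := by
      rintro h (hh | hh)
      · have : r h ∉ N := fun h' => hNN' _ h' (hrN h hh)
        simp [ht, hh, this]
      · have : h ∉ N := fun h' => hNN' _ h' hh
        simp [ht, hrN' h hh, this, hrr h (hN'U hh)]
        ring
    obtain ⟨c, hc⟩ := main W w h1 h3 fun h hh => by
      rw [(h2 h hh).2, (h2 _ (hrU1 h hh)).2, htr h hh]
    obtain ⟨c', hc'⟩ := main W' w' h1' h3' fun h hh => by
      rw [(h2' h hh).2, (h2' _ (hrU1 h hh)).2, hrr h hh, ← htr h hh, add_comm]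
    refine ⟨fun h => if h ∈ X then c' h else c h, fun h => ?_⟩
    by_cases hh : h ∈ X
    · have := hc' h
      rw [h4' h (by simpa using hh)] at this
      simpa [hXτ, hr'X, hh] using this
    · have := hc h
      rw [h4 h hh] at this
      simpa [hXτ, hr'X, hh] using this

end Split

/-! ### Euler's formula and the Jordan property -/

namespace MultiGraph

variable {V E : Type*} (G : MultiGraph V E)

theorem flip_apply (h : E × Bool) : flip E h = (h.1, !h.2) := rfl

@[simp] theorem flip_flip (h : E × Bool) : flip E (flip E h) = h := by
  simp [flip_apply]

variable {G}

theorem IsRotationSystem.vert_apply {ρ : Perm (E × Bool)} (hρ : G.IsRotationSystem ρ)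
    (h : E × Bool) : G.vert (ρ h) = G.vert h :=
  (hρ (G.vert h)).1.mapsTo rfl

theorem IsRotationSystem.inv {ρ : Perm (E × Bool)} (hρ : G.IsRotationSystem ρ) :
    G.IsRotationSystem ρ⁻¹ := fun v => (hρ v).inv

open Classical in
/-- For a rotation system, evenness of an edge set at the vertices can be expressed by sums. -/
theorem IsRotationSystem.exists_primitive [Fintype E] {ρ : Perm (E × Bool)}
    (hρ : G.IsRotationSystem ρ) {Z : E × Bool → ZMod 2}
    (hZ : ∀ v, ∑ h with G.vert h = v, Z h = 0) :
    ∃ y : E × Bool → ZMod 2, ∀ h, y (ρ h) = y h + Z h := by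
  have hv : ∀ v, ∃ y : E × Bool → ZMod 2, ∀ h, G.vert h = v → y (ρ h) = y h + Z h := by
    intro v
    have := hρ v
    obtain ⟨y, hy⟩ := Perm.IsCycleOn.exists_primitive (s := {h | G.vert h = v})
      (by simpa using hρ v) (hZ v)
    exact ⟨y, fun h hh => hy h (by simpa using hh)⟩
  choose y hy using hv
  exact ⟨fun h => y (G.vert h) h, fun h => by
    beta_reduce
    rw [hρ.vert_apply]
    exact hy _ h rfl⟩

open Classical in
theorem sum_vert_eq_zero_of_primitive [Fintype E] {ρ : Perm (E × Bool)}
    (hρ : G.IsRotationSystem ρ) {Z y : E × Bool → ZMod 2} (hy : ∀ h, y (ρ h) = y h + Z h) (v : V) :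
    ∑ h with G.vert h = v, Z h = 0 := by
  have h1 := ρ.sum_comp_of_mem_iff {h | G.vert h = v} (fun h => by simp [hρ.vert_apply]) y
  have h2 : ∀ h, Z h = y (ρ h) + y h := fun h => by
    have := hy h
    grind
  simp only [h2, Finset.sum_add_distrib, h1]
  exact CharTwo.add_self_eq_zero _

open Classical in
/-- The incidence matrix over the field of two elements. A loop gives a zero column. -/
noncomputable def incMatrix (G : MultiGraph V E) : Matrix V E (ZMod 2) :=
  fun v e => ∑ b, if G.ends e b = v then 1 else 0

open Classical in
theorem incMatrix_mulVec [Fintype E] (z : E → ZMod 2) (v : V) :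
    (G.incMatrix.mulVec z) v = ∑ h with G.vert h = v, z h.1 := by
  rw [Finset.sum_filter, Fintype.sum_prod_type, Matrix.mulVec, dotProduct]
  refine Finset.sum_congr rfl fun e _ => ?_
  simp only [incMatrix, Finset.sum_mul, vert]
  refine Finset.sum_congr rfl fun b _ => ?_
  by_cases h : G.ends e b = v <;> simp [h]

theorem incMatrix_transpose_mulVec [Fintype V] (f : V → ZMod 2) (e : E) :
    (G.incMatrix.transpose.mulVec f) e = f (G.ends e true) + f (G.ends e false) := by
  classical
  simp only [Matrix.mulVec, dotProduct, incMatrix, Matrix.transpose_apply, Fintype.sum_bool, add_mul,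
    ite_mul, one_mul, zero_mul, Finset.sum_add_distrib, Finset.sum_ite_eq, Finset.mem_univ, if_true]

theorem toSimpleGraph_adj_iff {u v : V} :
    G.toSimpleGraph.Adj u v ↔ u ≠ v ∧ ∃ h : E × Bool, G.vert h = u ∧ G.vert (flip E h) = v := by
  simp only [toSimpleGraph, SimpleGraph.fromRel_adj]
  refine and_congr_right fun _ => ⟨?_, ?_⟩
  · rintro (⟨e, h1, h2⟩ | ⟨e, h1, h2⟩)
    · exact ⟨(e, false), h1, h2⟩
    · exact ⟨(e, true), h2, h1⟩
  · rintro ⟨⟨e, b⟩, h1, h2⟩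
    cases b
    · exact Or.inl ⟨e, h1, h2⟩
    · exact Or.inr ⟨e, h2, h1⟩

/-- The functions on the vertices that agree at the ends of every edge are the functions on
the set of components. -/
theorem finrank_ker_incMatrix_transpose [Fintype V] :
    Module.finrank (ZMod 2) (LinearMap.ker G.incMatrix.transpose.mulVecLin) =
      Nat.card G.toSimpleGraph.ConnectedComponent := by
  classical
  have := Fintype.ofFinite G.toSimpleGraph.ConnectedComponent
  have hmem : ∀ f : V → ZMod 2, f ∈ LinearMap.ker G.incMatrix.transpose.mulVecLin ↔
      ∀ e, f (G.ends e true) = f (G.ends e false) := by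
    intro f
    rw [LinearMap.mem_ker, Matrix.mulVecLin_apply, funext_iff]
    refine forall_congr' fun e => ?_
    rw [incMatrix_transpose_mulVec, Pi.zero_apply]
    constructor <;> intro h <;> grind
  let Λ : (G.toSimpleGraph.ConnectedComponent → ZMod 2) →ₗ[ZMod 2]
      LinearMap.ker G.incMatrix.transpose.mulVecLin :=
    { toFun := fun f => ⟨fun v => f (G.toSimpleGraph.connectedComponentMk v), by
        rw [hmem]
        intro e
        by_cases h : G.ends e true = G.ends e false
        · rw [h]
        · have : G.toSimpleGraph.Adj (G.ends e true) (G.ends e false) :=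
            toSimpleGraph_adj_iff.2 ⟨h, (e, true), rfl, rfl⟩
          rw [SimpleGraph.ConnectedComponent.sound this.reachable]⟩
      map_add' := fun _ _ => rfl
      map_smul' := fun _ _ => rfl }
  have hΛ : Function.Bijective Λ := by
    constructor
    · intro f g hfg
      funext c
      induction c using SimpleGraph.ConnectedComponent.ind with
      | h v => exact congrFun (congrArg Subtype.val hfg) v
    · rintro ⟨f, hf⟩
      rw [hmem] at hf
      have hadj : ∀ u v, G.toSimpleGraph.Adj u v → f u = f v := by
        intro u v huv
        obtain ⟨-, ⟨e, b⟩, rfl, rfl⟩ := toSimpleGraph_adj_iff.1 huv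
        cases b
        · exact (hf e).symm
        · exact hf e
      have hwalk : ∀ u v (p : G.toSimpleGraph.Walk u v), f u = f v := by
        intro u v p
        induction p with
        | nil => rfl
        | cons h p ih => exact (hadj _ _ h).trans ih
      refine ⟨fun c => c.lift f fun u v p _ => hwalk u v p, ?_⟩
      apply Subtype.ext
      funext v
      rfl
  rw [← (LinearEquiv.ofBijective Λ hΛ).finrank_eq, Module.finrank_pi, Nat.card_eq_fintype_card]

/-- The boundary of a set of faces of a rotation system. -/
def faceBoundary (ρ : Perm (E × Bool)) :
    (Quotient (Perm.SameCycle.setoid (ρ * flip E)) → ZMod 2) →ₗ[ZMod 2] (E → ZMod 2) where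
  toFun c e := c (Quotient.mk _ (e, true)) + c (Quotient.mk _ (e, false))
  map_add' c d := by funext e; simp only [Pi.add_apply]; ring
  map_smul' a c := by funext e; simp [mul_add]

theorem mk_rotation (ρ : Perm (E × Bool)) (h : E × Bool) :
    (Quotient.mk (Perm.SameCycle.setoid (ρ * flip E)) (ρ h)) = Quotient.mk _ (flip E h) := by
  refine (Quotient.sound ?_).symm
  refine ⟨1, ?_⟩
  simp [Perm.mul_apply]

/-- The sets of faces with empty boundary, together with the functions on the isolated vertices,
correspond to the functions on the set of components. -/
theorem finrank_ker_faceBoundary_add [Fintype V] [Fintype E] {ρ : Perm (E × Bool)}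
    (hρ : G.IsRotationSystem ρ) :
    Module.finrank (ZMod 2) (LinearMap.ker (faceBoundary ρ)) +
      Nat.card {v : V // ∀ h, G.vert h ≠ v} = Nat.card G.toSimpleGraph.ConnectedComponent := by
  classical
  rw [← finrank_ker_incMatrix_transpose]
  have := Fintype.ofFinite {v : V // ∀ h, G.vert h ≠ v}
  have hmem : ∀ f : V → ZMod 2, f ∈ LinearMap.ker G.incMatrix.transpose.mulVecLin ↔
      ∀ h, f (G.vert (flip E h)) = f (G.vert h) := by
    intro f
    rw [LinearMap.mem_ker, Matrix.mulVecLin_apply, funext_iff]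
    simp only [incMatrix_transpose_mulVec, Pi.zero_apply]
    constructor
    · rintro h ⟨e, b⟩
      have := h e
      cases b <;> simp only [vert, flip_apply, Bool.not_true, Bool.not_false] <;> grind
    · intro h e
      have := h (e, false)
      simp only [vert, flip_apply, Bool.not_false] at this
      grind
  have hinv : ∀ f ∈ LinearMap.ker G.incMatrix.transpose.mulVecLin, ∀ a b,
      (ρ * flip E).SameCycle a b → f (G.vert a) = f (G.vert b) := by
    rintro f hf a b ⟨i, rfl⟩
    have step : ∀ h, f (G.vert ((ρ * flip E) h)) = f (G.vert h) := by
      intro h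
      rw [Perm.mul_apply, hρ.vert_apply, (hmem f).1 hf]
    induction i with
    | zero => rfl
    | succ i ih => rw [add_comm, zpow_add, zpow_one, Perm.mul_apply, step, ih]
    | pred i ih =>
      rw [ih, ← step ((((ρ * flip E) ^ (-(i : ℤ) - 1))) a), ← Perm.mul_apply, ← zpow_one_add]
      congr 3
      congr 1
      ring
  let Λ : LinearMap.ker G.incMatrix.transpose.mulVecLin →ₗ[ZMod 2]
      LinearMap.ker (faceBoundary ρ) × ({v : V // ∀ h, G.vert h ≠ v} → ZMod 2) :=
    { toFun := fun f => ⟨⟨fun q => q.lift (fun h => f.1 (G.vert h)) (hinv f.1 f.2), by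
          rw [LinearMap.mem_ker]
          funext e
          have := (hmem f.1).1 f.2 (e, false)
          simp only [faceBoundary, LinearMap.coe_mk, AddHom.coe_mk, Quotient.lift_mk,
            Pi.zero_apply]
          rw [flip_apply] at this
          simp only [Bool.not_false] at this
          rw [this, CharTwo.add_self_eq_zero]⟩, fun v => f.1 v.1⟩
      map_add' := by
        intro f g
        refine Prod.ext (Subtype.ext (funext fun q => ?_)) rfl
        induction q using Quotient.inductionOn with
        | h a => rfl
      map_smul' := by
        intro f g
        refine Prod.ext (Subtype.ext (funext fun q => ?_)) rfl
        induction q using Quotient.inductionOn with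
        | h a => rfl }
  have hΛ : Function.Bijective Λ := by
    constructor
    · intro f g hfg
      apply Subtype.ext
      funext v
      by_cases hv : ∀ h, G.vert h ≠ v
      · exact congrFun (congrArg Prod.snd hfg) ⟨v, hv⟩
      · push Not at hv
        obtain ⟨h, rfl⟩ := hv
        exact congrFun (congrArg Subtype.val (congrArg Prod.fst hfg)) (Quotient.mk _ h)
    · rintro ⟨⟨c, hc⟩, k⟩
      have hflip : ∀ h : E × Bool, c (Quotient.mk _ (flip E h)) = c (Quotient.mk _ h) := by
        rintro ⟨e, b⟩
        have := congrFun hc e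
        simp only [faceBoundary, LinearMap.coe_mk, AddHom.coe_mk, Pi.zero_apply] at this
        cases b <;> simp only [flip_apply, Bool.not_true, Bool.not_false] <;> grind
      have hvert : ∀ a b, G.vert a = G.vert b →
          c (Quotient.mk _ a) = c (Quotient.mk _ b) := by
        intro a b hab
        obtain ⟨n, rfl⟩ := ((hρ (G.vert a)).2 (rfl : a ∈ {h | G.vert h = G.vert a})
          (show b ∈ {h | G.vert h = G.vert a} from hab.symm)).exists_nat_pow_eq
        clear hab
        induction n with
        | zero => rfl
        | succ n ih => rw [pow_succ', Perm.mul_apply, mk_rotation, hflip, ih]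
      let f : V → ZMod 2 := fun v =>
        if hv : ∃ h, G.vert h = v then c (Quotient.mk _ hv.choose)
        else k ⟨v, fun h e => hv ⟨h, e⟩⟩
      have hf : ∀ h, f (G.vert h) = c (Quotient.mk _ h) := by
        intro h
        have hv : ∃ h', G.vert h' = G.vert h := ⟨h, rfl⟩
        simp only [f, dif_pos hv]
        exact hvert _ _ hv.choose_spec
      refine ⟨⟨f, (hmem f).2 fun h => by rw [hf, hf, hflip]⟩, ?_⟩
      refine Prod.ext (Subtype.ext (funext fun q => ?_)) (funext fun v => ?_)
      · induction q using Quotient.inductionOn with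
        | h a => exact hf a
      · have hv : ¬ ∃ h, G.vert h = v.1 := fun ⟨h, e⟩ => v.2 h e
        exact dif_neg hv
  rw [(LinearEquiv.ofBijective Λ hΛ).finrank_eq, Module.finrank_prod, Module.finrank_pi,
    Nat.card_eq_fintype_card]

/-- Every face boundary is a cycle modulo two. -/
theorem range_faceBoundary_le [Fintype E] {ρ : Perm (E × Bool)} (hρ : G.IsRotationSystem ρ) :
    LinearMap.range (faceBoundary ρ) ≤ LinearMap.ker G.incMatrix.mulVecLin := by
  rintro _ ⟨c, rfl⟩
  rw [LinearMap.mem_ker, Matrix.mulVecLin_apply]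
  funext v
  rw [incMatrix_mulVec]
  refine sum_vert_eq_zero_of_primitive hρ (y := fun h => c (Quotient.mk _ h)) (fun h => ?_) v
  rw [mk_rotation]
  obtain ⟨e, b⟩ := h
  cases b <;> simp only [faceBoundary, LinearMap.coe_mk, AddHom.coe_mk, flip_apply,
    Bool.not_true, Bool.not_false] <;> grind

/-- The Jordan property says that every cycle modulo two is a sum of face boundaries. -/
theorem jordanProperty_iff_ker_le_range [Fintype E] {ρ : Perm (E × Bool)}
    (hρ : G.IsRotationSystem ρ) : JordanProperty (flip E) ρ ↔
      LinearMap.ker G.incMatrix.mulVecLin ≤ LinearMap.range (faceBoundary ρ) := by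
  constructor
  · intro hJ z hz
    rw [LinearMap.mem_ker, Matrix.mulVecLin_apply] at hz
    obtain ⟨y, hy⟩ := hρ.exists_primitive (Z := fun h => z h.1) fun v => by
      rw [← incMatrix_mulVec, hz]
      rfl
    obtain ⟨c, hc⟩ := hJ (fun h => z h.1) y (fun _ => rfl) hy
    have step : ∀ h, c ((ρ * flip E) h) = c h := by
      intro h
      have h1 := (hc (flip E h)).2
      have h2 := (hc h).1
      rw [Perm.mul_apply, h1, h2, flip_apply]
      grind
    refine ⟨fun q => q.lift c ?_, funext fun e => ?_⟩
    · rintro a b ⟨i, rfl⟩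
      induction i with
      | zero => rfl
      | succ i ih => rw [add_comm, zpow_add, zpow_one, Perm.mul_apply, step, ih]
      | pred i ih =>
        rw [ih, ← step ((((ρ * flip E) ^ (-(i : ℤ) - 1))) a), ← Perm.mul_apply, ← zpow_one_add]
        congr 2
        congr 1
        ring
    · have := (hc (e, false)).1
      simp only [flip_apply, Bool.not_false] at this
      simp only [faceBoundary, LinearMap.coe_mk, AddHom.coe_mk, Quotient.lift_mk]
      grind
  · intro hle Z y hZ hy
    have hZ' : ∀ h, Z h = Z (h.1, false) := by
      rintro ⟨e, b⟩
      cases b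
      · rfl
      · exact hZ (e, false)
    obtain ⟨c, hc⟩ := hle (x := fun e => Z (e, false)) (by
      rw [LinearMap.mem_ker, Matrix.mulVecLin_apply]
      funext v
      rw [incMatrix_mulVec]
      simp only [← hZ']
      exact sum_vert_eq_zero_of_primitive hρ hy v)
    have hflip : ∀ h : E × Bool, c (Quotient.mk _ (flip E h)) = c (Quotient.mk _ h) + Z h := by
      rintro ⟨e, b⟩
      have h1 := congrFun hc e
      have h2 := hZ (e, false)
      simp only [faceBoundary, LinearMap.coe_mk, AddHom.coe_mk] at h1
      simp only [flip_apply, Bool.not_false] at h2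
      cases b <;> simp only [flip_apply, Bool.not_true, Bool.not_false] <;> grind
    refine ⟨fun h => c (Quotient.mk _ h), fun h => ⟨hflip h, ?_⟩⟩
    beta_reduce
    rw [mk_rotation, hflip]

/-- **Euler's formula characterizes the Jordan property.** The defect in Euler's formula is the
codimension of the space of face boundaries in the cycle space over the field of two elements. -/
theorem isPlanarRotationSystem_iff [Finite V] [Finite E] {ρ : Perm (E × Bool)} :
    G.IsPlanarRotationSystem ρ ↔ G.IsRotationSystem ρ ∧ JordanProperty (flip E) ρ := by
  classical
  have := Fintype.ofFinite V
  have := Fintype.ofFinite E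
  refine and_congr_right fun hρ => ?_
  rw [jordanProperty_iff_ker_le_range hρ]
  have := Fintype.ofFinite (Quotient (Perm.SameCycle.setoid (ρ * flip E)))
  have e1 := LinearMap.finrank_range_add_finrank_ker (G.incMatrix.mulVecLin)
  have e2 := LinearMap.finrank_range_add_finrank_ker (G.incMatrix.transpose.mulVecLin)
  have e3 := LinearMap.finrank_range_add_finrank_ker (faceBoundary ρ)
  have e4 := finrank_ker_faceBoundary_add hρ
  have e5 : Module.finrank (ZMod 2) (LinearMap.range G.incMatrix.transpose.mulVecLin) =
      Module.finrank (ZMod 2) (LinearMap.range G.incMatrix.mulVecLin) :=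
    G.incMatrix.rank_transpose
  rw [finrank_ker_incMatrix_transpose] at e2
  rw [Module.finrank_pi] at e1 e2 e3
  have e6 : numFaces G ρ = Fintype.card (Quotient (Perm.SameCycle.setoid (ρ * flip E))) +
      Nat.card {v : V // ∀ h, G.vert h ≠ v} := by
    rw [numFaces, Nat.card_eq_fintype_card]
  have hle := range_faceBoundary_le hρ
  rw [Nat.card_eq_fintype_card, Nat.card_eq_fintype_card]
  constructor
  · intro h
    refine (Submodule.eq_of_le_of_finrank_eq hle ?_).ge
    omega
  · intro h
    have := congrArg (fun S : Submodule (ZMod 2) (E → ZMod 2) => Module.finrank (ZMod 2) S)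
      (le_antisymm hle h)
    omega

end MultiGraph

/-! ### Two disjoint paths -/

namespace SimpleGraph

variable {V : Type*} {G : SimpleGraph V}

/-- A walk in `G` either avoids the edge `xy`, or splits at the first and last time when this edge
is used. -/
theorem Walk.exists_deleteEdge_walks (x y : V) {a b : V} (p : G.Walk a b) :
    (∃ q : (G.deleteEdges {s(x, y)}).Walk a b, q.support ⊆ p.support) ∨
    (∃ (q : (G.deleteEdges {s(x, y)}).Walk a x) (q' : (G.deleteEdges {s(x, y)}).Walk y b),
      q.support ⊆ p.support ∧ q'.support ⊆ p.support) ∨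
    (∃ (q : (G.deleteEdges {s(x, y)}).Walk a y) (q' : (G.deleteEdges {s(x, y)}).Walk x b),
      q.support ⊆ p.support ∧ q'.support ⊆ p.support) := by
  induction p with
  | nil => exact Or.inl ⟨.nil, by simp⟩
  | @cons a c b h p ih =>
    by_cases hxy : s(a, c) = s(x, y)
    · rw [Sym2.eq_iff] at hxy
      rcases hxy with ⟨rfl, rfl⟩ | ⟨rfl, rfl⟩
      · rcases ih with ⟨q, hq⟩ | ⟨-, q', -, hq'⟩ | ⟨-, q', -, hq'⟩
        · exact Or.inr (Or.inl ⟨.nil, q, by simp, List.Subset.trans hq (by simp)⟩)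
        · exact Or.inr (Or.inl ⟨.nil, q', by simp, List.Subset.trans hq' (by simp)⟩)
        · exact Or.inl ⟨q', List.Subset.trans hq' (by simp)⟩
      · rcases ih with ⟨q, hq⟩ | ⟨-, q', -, hq'⟩ | ⟨-, q', -, hq'⟩
        · exact Or.inr (Or.inr ⟨.nil, q, by simp, List.Subset.trans hq (by simp)⟩)
        · exact Or.inl ⟨q', List.Subset.trans hq' (by simp)⟩
        · exact Or.inr (Or.inr ⟨.nil, q', by simp, List.Subset.trans hq' (by simp)⟩)
    · have h' : (G.deleteEdges {s(x, y)}).Adj a c := by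
        rw [deleteEdges_adj]
        exact ⟨h, hxy⟩
      have hsub : ∀ {l : List V}, l ⊆ p.support → a :: l ⊆ (Walk.cons h p).support := by
        intro l hl
        rw [Walk.support_cons]
        exact List.cons_subset_cons _ hl
      have hsub' : ∀ {l : List V}, l ⊆ p.support → l ⊆ (Walk.cons h p).support :=
        fun hl => List.Subset.trans hl (by simp)
      rcases ih with ⟨q, hq⟩ | ⟨q, q', hq, hq'⟩ | ⟨q, q', hq, hq'⟩
      · exact Or.inl ⟨.cons h' q, by rw [Walk.support_cons]; exact hsub hq⟩
      · exact Or.inr (Or.inl ⟨.cons h' q, q', by rw [Walk.support_cons]; exact hsub hq, hsub' hq'⟩)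
      · exact Or.inr (Or.inr ⟨.cons h' q, q', by rw [Walk.support_cons]; exact hsub hq, hsub' hq'⟩)

/-- The step of Göring's proof of Menger's theorem: the vertex `z` separates `A` from `B` when the
edge `xy` is deleted, and two disjoint paths exist on each side of `{z, xy}`. -/
theorem exists_disjoint_paths_step {G' : SimpleGraph V} (hle : G' ≤ G) {A B : Set V} {x y z : V}
    (hxy : G.Adj x y)
    (hsep : ∀ a ∈ A, ∀ b ∈ B, ∀ p : G'.Walk a b, z ∈ p.support)
    {a₁ a₂ b₁ b₂ : V} (ha₁ : a₁ ∈ A) (ha₂ : a₂ ∈ A) (hb₁ : b₁ ∈ B) (hb₂ : b₂ ∈ B)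
    (P : G'.Walk a₁ x) (P' : G'.Walk a₂ z) (Q : G'.Walk y b₁) (Q' : G'.Walk z b₂)
    (hP' : P'.IsPath) (hQ' : Q'.IsPath) (hPP' : P.support.Disjoint P'.support)
    (hQQ' : Q.support.Disjoint Q'.support) :
    ∃ (p : G.Walk a₁ b₁) (q : G.Walk a₂ b₂), p.IsPath ∧ q.IsPath ∧
      p.support.Disjoint q.support := by
  classical
  have hzP : z ∉ P.support := fun h => hPP' h (Walk.end_mem_support P')
  have hzQ : z ∉ Q.support := fun h => hQQ' h (Walk.start_mem_support Q')
  -- two walks of `G'` that meet would give a walk that avoids `z`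
  have hmeet : ∀ {u v t : V}, u ∈ A → v ∈ B → ∀ (p : G'.Walk u t) (q : G'.Walk t v),
      z ∉ p.support → z ∉ q.support → False := by
    intro u v t hu hv p q hp hq
    have := hsep u hu v hv (p.append q)
    rw [Walk.mem_support_append_iff] at this
    tauto
  have hPQ' : P.support.Disjoint Q'.support := by
    intro t ht ht'
    have htz : t ≠ z := fun e => hzP (e ▸ ht)
    refine hmeet ha₁ hb₂ (P.takeUntil t ht) (Q'.reverse.takeUntil t (by simpa using ht')).reverse
      (fun h => hzP (Walk.support_takeUntil_subset_support _ _ h)) ?_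
    rw [Walk.support_reverse, List.mem_reverse]
    exact Walk.endpoint_notMem_support_takeUntil hQ'.reverse _ htz.symm
  have hP'Q : P'.support.Disjoint Q.support := by
    intro t ht ht'
    have htz : t ≠ z := fun e => hzQ (e ▸ ht')
    exact hmeet ha₂ hb₁ (P'.takeUntil t ht) (Q.dropUntil t ht')
      (Walk.endpoint_notMem_support_takeUntil hP' _ htz.symm)
      fun h => hzQ (Walk.support_dropUntil_subset_support _ _ h)
  refine ⟨((P.mapLe hle).append (.cons hxy (Q.mapLe hle))).bypass,
    ((P'.mapLe hle).append (Q'.mapLe hle)).bypass, Walk.bypass_isPath _, Walk.bypass_isPath _, ?_⟩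
  intro t ht ht'
  have ht := Walk.support_bypass_subset_support _ ht
  have ht' := Walk.support_bypass_subset_support _ ht'
  rw [Walk.mem_support_append_iff, Walk.support_cons, List.mem_cons] at ht
  rw [Walk.mem_support_append_iff] at ht'
  simp only [Walk.support_mapLe_eq_support] at ht ht'
  have hx : x ∈ P.support := Walk.end_mem_support P
  rcases ht with ht | rfl | ht <;> rcases ht' with ht' | ht'
  · exact hPP' ht ht'
  · exact hPQ' ht ht'
  · exact hPP' hx ht'
  · exact hPQ' hx ht'
  · exact hP'Q ht' ht
  · exact hQQ' ht ht'

/-- **Menger's theorem** for two paths: if no vertex meets all walks from `A` to `B`, then there are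
two disjoint paths from `A` to `B`. -/
theorem exists_disjoint_paths [Finite V] [Nonempty V] (G : SimpleGraph V) (A B : Set V)
    (h : ∀ z, ∃ a ∈ A, ∃ b ∈ B, ∃ p : G.Walk a b, z ∉ p.support) :
    ∃ a ∈ A, ∃ b ∈ B, ∃ a' ∈ A, ∃ b' ∈ B, ∃ (p : G.Walk a b) (q : G.Walk a' b'),
      p.IsPath ∧ q.IsPath ∧ p.support.Disjoint q.support := by
  classical
  induction hn : G.edgeSet.ncard using Nat.strong_induction_on generalizing G A B with
  | _ n ih =>
  by_cases hbot : ∃ x y, G.Adj x y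
  swap
  · have hnil : ∀ {a b : V} (p : G.Walk a b), a = b := by
      intro a b p
      cases p with
      | nil => rfl
      | cons h _ => exact absurd ⟨_, _, h⟩ hbot
    obtain ⟨a, ha, b, hb, p, -⟩ := h (Classical.arbitrary V)
    obtain ⟨a', ha', b', hb', p', hz⟩ := h a
    obtain rfl := hnil p
    obtain rfl := hnil p'
    refine ⟨a, ha, a, hb, a', ha', a', hb', .nil, .nil, .nil, .nil, ?_⟩
    have : a ≠ a' := fun e => hz (e ▸ Walk.start_mem_support p')
    simpa using this.symm
  obtain ⟨x, y, hxy⟩ := hbot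
  set G' := G.deleteEdges {s(x, y)} with hG'
  have hle : G' ≤ G := deleteEdges_le _
  have hlt : G'.edgeSet.ncard < n := by
    rw [← hn]
    refine Set.ncard_lt_ncard ⟨edgeSet_mono hle, fun hsub => ?_⟩ (Set.toFinite _)
    have := hsub (show s(x, y) ∈ G.edgeSet from hxy)
    rw [hG', edgeSet_deleteEdges] at this
    exact this.2 rfl
  by_cases hG'h : ∀ z, ∃ a ∈ A, ∃ b ∈ B, ∃ p : G'.Walk a b, z ∉ p.support
  · obtain ⟨a, ha, b, hb, a', ha', b', hb', p, q, hp, hq, hpq⟩ := ih _ hlt G' A B hG'h rfl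
    exact ⟨a, ha, b, hb, a', ha', b', hb', p.mapLe hle, q.mapLe hle, hp.mapLe hle, hq.mapLe hle,
      by simpa using hpq⟩
  push Not at hG'h
  obtain ⟨z, hsep⟩ := hG'h
  have main : ∀ x y, G.Adj x y → G' = G.deleteEdges {s(x, y)} →
      (∃ a ∈ A, ∃ b ∈ B, ∃ (q : G'.Walk a x) (q' : G'.Walk y b), z ∉ q.support ∧ z ∉ q'.support) →
      ∃ a ∈ A, ∃ b ∈ B, ∃ a' ∈ A, ∃ b' ∈ B, ∃ (p : G.Walk a b) (q : G.Walk a' b'),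
        p.IsPath ∧ q.IsPath ∧ p.support.Disjoint q.support := by
    intro x y hxy hG' ⟨a₀, ha₀, b₀, hb₀, q₀, q₀', hq₀, hq₀'⟩
    have hlt : G'.edgeSet.ncard < n := by
      rw [← hn]
      refine Set.ncard_lt_ncard ⟨edgeSet_mono hle, fun hsub => ?_⟩ (Set.toFinite _)
      have := hsub (show s(x, y) ∈ G.edgeSet from hxy)
      rw [hG', edgeSet_deleteEdges] at this
      exact this.2 rfl
    have hA : ∀ w, ∃ a ∈ A, ∃ b ∈ ({x, z} : Set V), ∃ p : G'.Walk a b, w ∉ p.support := by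
      intro w
      obtain ⟨a, ha, b, hb, p, hp⟩ := h w
      have hz : ∀ {v : V} (q : G'.Walk a v), q.support ⊆ p.support → z ∈ q.support →
          ∃ a ∈ A, ∃ b ∈ ({x, z} : Set V), ∃ p : G'.Walk a b, w ∉ p.support :=
        fun q hq hz => ⟨a, ha, z, by simp, q.takeUntil z hz,
          fun hw => hp (hq (Walk.support_takeUntil_subset_support _ _ hw))⟩
      have hcases := p.exists_deleteEdge_walks x y
      rw [← hG'] at hcases
      rcases hcases with ⟨q, hq⟩ | ⟨q, q', hq, hq'⟩ | ⟨q, q', hq, hq'⟩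
      · exact hz q hq (hsep a ha b hb q)
      · exact ⟨a, ha, x, by simp, q, fun hw => hp (hq hw)⟩
      · refine hz q hq ?_
        have := hsep a ha b₀ hb₀ (q.append q₀')
        rw [Walk.mem_support_append_iff] at this
        tauto
    have hB : ∀ w, ∃ a ∈ ({y, z} : Set V), ∃ b ∈ B, ∃ p : G'.Walk a b, w ∉ p.support := by
      intro w
      obtain ⟨a, ha, b, hb, p, hp⟩ := h w
      have hz : ∀ {v : V} (q : G'.Walk v b), q.support ⊆ p.support → z ∈ q.support →
          ∃ a ∈ ({y, z} : Set V), ∃ b ∈ B, ∃ p : G'.Walk a b, w ∉ p.support :=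
        fun q hq hz => ⟨z, by simp, b, hb, q.dropUntil z hz,
          fun hw => hp (hq (Walk.support_dropUntil_subset_support _ _ hw))⟩
      have hcases := p.exists_deleteEdge_walks x y
      rw [← hG'] at hcases
      rcases hcases with ⟨q, hq⟩ | ⟨q, q', hq, hq'⟩ | ⟨q, q', hq, hq'⟩
      · exact hz q hq (hsep a ha b hb q)
      · exact ⟨y, by simp, b, hb, q', fun hw => hp (hq' hw)⟩
      · refine hz q' hq' ?_
        have := hsep a₀ ha₀ b hb (q₀.append q')
        rw [Walk.mem_support_append_iff] at this
        tauto
    have hA' : ∃ a ∈ A, ∃ a' ∈ A, ∃ (p : G'.Walk a x) (q : G'.Walk a' z), q.IsPath ∧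
        p.support.Disjoint q.support := by
      obtain ⟨a, ha, b, hb, a', ha', b', hb', p, q, hp, hq, hpq⟩ := ih _ hlt G' _ _ hA rfl
      have hne : b ≠ b' := fun e => hpq (Walk.end_mem_support p) (e ▸ Walk.end_mem_support q)
      rcases hb with rfl | rfl <;> rcases hb' with rfl | rfl
      · exact absurd rfl hne
      · exact ⟨a, ha, a', ha', p, q, hq, hpq⟩
      · exact ⟨a', ha', a, ha, q, p, hp, hpq.symm⟩
      · exact absurd rfl hne
    have hB' : ∃ b ∈ B, ∃ b' ∈ B, ∃ (p : G'.Walk y b) (q : G'.Walk z b'), q.IsPath ∧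
        p.support.Disjoint q.support := by
      obtain ⟨a, ha, b, hb, a', ha', b', hb', p, q, hp, hq, hpq⟩ := ih _ hlt G' _ _ hB rfl
      have hne : a ≠ a' := fun e => hpq (Walk.start_mem_support p) (e ▸ Walk.start_mem_support q)
      rcases ha with rfl | rfl <;> rcases ha' with rfl | rfl
      · exact absurd rfl hne
      · exact ⟨b, hb, b', hb', p, q, hq, hpq⟩
      · exact ⟨b', hb', b, hb, q, p, hp, hpq.symm⟩
      · exact absurd rfl hne
    obtain ⟨a, ha, a', ha', P, P', hP', hPP'⟩ := hA'
    obtain ⟨b, hb, b', hb', Q, Q', hQ', hQQ'⟩ := hB'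
    obtain ⟨p, q, hp, hq, hpq⟩ := exists_disjoint_paths_step hle hxy
      (fun a ha b hb p => hsep a ha b hb p) ha ha' hb hb' P P' Q Q' hP' hQ' hPP' hQQ'
    exact ⟨a, ha, b, hb, a', ha', b', hb', p, q, hp, hq, hpq⟩
  obtain ⟨a, ha, b, hb, p, hp⟩ := h z
  rcases p.exists_deleteEdge_walks x y with ⟨q, hq⟩ | ⟨q, q', hq, hq'⟩ | ⟨q, q', hq, hq'⟩
  · exact absurd (hq (hsep a ha b hb q)) hp
  · exact main x y hxy rfl ⟨a, ha, b, hb, q, q', fun h => hp (hq h), fun h => hp (hq' h)⟩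
  · refine main y x hxy.symm (by rw [hG', Sym2.eq_swap]) ⟨a, ha, b, hb, q, q', fun h => hp (hq h),
      fun h => hp (hq' h)⟩

/-- Two disjoint paths that avoid a set `S`. -/
theorem exists_disjoint_paths_avoiding [Finite V] [Nonempty V] (G : SimpleGraph V) (A B S : Set V)
    (h : ∀ z, ∃ a ∈ A, ∃ b ∈ B, ∃ p : G.Walk a b, z ∉ p.support ∧ ∀ s ∈ S, s ∉ p.support) :
    ∃ a ∈ A, ∃ b ∈ B, ∃ a' ∈ A, ∃ b' ∈ B, ∃ (p : G.Walk a b) (q : G.Walk a' b'),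
      (∀ s ∈ S, s ∉ p.support) ∧ (∀ s ∈ S, s ∉ q.support) ∧ p.support.Disjoint q.support := by
  set G' : SimpleGraph V :=
    { Adj := fun u v => G.Adj u v ∧ u ∉ S ∧ v ∉ S
      symm := ⟨fun u v h => ⟨h.1.symm, h.2.2, h.2.1⟩⟩
      loopless := ⟨fun u h => G.loopless.irrefl u h.1⟩ } with hG'
  have hle : G' ≤ G := fun u v h => h.1
  have hto : ∀ {a b : V} (p : G.Walk a b), (∀ s ∈ S, s ∉ p.support) →
      ∃ q : G'.Walk a b, q.support = p.support := by
    intro a b p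
    induction p with
    | nil => exact fun _ => ⟨.nil, rfl⟩
    | @cons a c b hac p ih =>
      intro hS
      simp only [Walk.support_cons, List.mem_cons, not_or] at hS
      obtain ⟨q, hq⟩ := ih fun s hs => (hS s hs).2
      exact ⟨.cons (show G'.Adj a c from ⟨hac, fun ha => (hS a ha).1 rfl,
        fun hc => (hS c hc).2 (Walk.start_mem_support p)⟩) q, by simp [hq]⟩
  have hfrom : ∀ {a b : V} (p : G'.Walk a b), a ∉ S → ∀ s ∈ S, s ∉ p.support := by
    intro a b p
    induction p with
    | nil => intro ha s hs; simp; rintro rfl; exact ha hs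
    | cons hac p ih =>
      intro ha s hs
      simp only [Walk.support_cons, List.mem_cons, not_or]
      exact ⟨fun e => ha (e ▸ hs), ih hac.2.2 s hs⟩
  obtain ⟨a, ha, b, hb, a', ha', b', hb', p, q, -, -, hpq⟩ :=
    exists_disjoint_paths G' (A \ S) (B \ S) fun z => by
      obtain ⟨a, ha, b, hb, p, hz, hS⟩ := h z
      obtain ⟨q, hq⟩ := hto p hS
      exact ⟨a, ⟨ha, fun h => hS a h (Walk.start_mem_support p)⟩, b,
        ⟨hb, fun h => hS b h (Walk.end_mem_support p)⟩, q, by rwa [hq]⟩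
  exact ⟨a, ha.1, b, hb.1, a', ha'.1, b', hb'.1, p.mapLe hle, q.mapLe hle,
    by simpa using hfrom p ha.2, by simpa using hfrom q ha'.2, by simpa using hpq⟩

end SimpleGraph

/-! ### Cycles and colourings in a planar rotation system -/

namespace MultiGraph

variable {V E : Type*} {G : MultiGraph V E}

/-- A function that is invariant under the rotator at `v` is constant on the half-edges at `v`. -/
theorem IsRotationSystem.eq_of_invariant {ρ : Perm (E × Bool)} (hρ : G.IsRotationSystem ρ)
    {α : Type*} {g : E × Bool → α} {v : V} (hg : ∀ h, G.vert h = v → g (ρ h) = g h)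
    {h h' : E × Bool} (hh : G.vert h = v) (hh' : G.vert h' = v) : g h = g h' := by
  obtain ⟨n, hn⟩ := (hρ v).2 hh hh'
  have key : ∀ n : ℕ, g ((ρ ^ n) h) = g h ∧ G.vert ((ρ ^ n) h) = v := by
    intro n
    induction n with
    | zero => exact ⟨rfl, hh⟩
    | succ n ih =>
      rw [pow_succ', Perm.mul_apply, hg _ ih.2, hρ.vert_apply]
      exact ih
  have key' : ∀ n : ℕ, g ((ρ ^ (-(n : ℤ))) h) = g h ∧ G.vert ((ρ ^ (-(n : ℤ))) h) = v := by
    intro n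
    induction n with
    | zero => exact ⟨rfl, hh⟩
    | succ n ih =>
      have e : (ρ ^ (-(n : ℤ))) h = ρ ((ρ ^ (-((n + 1 : ℕ) : ℤ))) h) := by
        rw [← Perm.mul_apply, ← zpow_one_add]
        congr 2
        push_cast
        ring
      rw [e] at ih
      have h2 : G.vert ((ρ ^ (-((n + 1 : ℕ) : ℤ))) h) = v := by
        rw [← ih.2, hρ.vert_apply]
      exact ⟨by rw [← ih.1, hg _ h2], h2⟩
  obtain ⟨m, rfl | rfl⟩ := n.eq_nat_or_neg
  · rw [← hn]
    exact_mod_cast (key m).1.symm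
  · rw [← hn]
    exact (key' m).1.symm

/-- A vertex whose rotator fixes a half-edge has no other half-edge. -/
theorem IsRotationSystem.eq_of_apply_eq {ρ : Perm (E × Bool)} (hρ : G.IsRotationSystem ρ)
    {h h' : E × Bool} (hh : G.vert h' = G.vert h) (e : ρ h = h) : h' = h := by
  classical
  have := hρ.eq_of_invariant (g := fun k => decide (k = h)) (v := G.vert h) (fun k _ => by
    rw [decide_eq_decide]
    constructor
    · exact fun e' => ρ.injective (e'.trans e.symm)
    · rintro rfl
      exact e) hh rfl
  simpa using this

/-- A vertex whose rotator exchanges two half-edges has no other half-edges. -/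
theorem IsRotationSystem.eq_or_eq_of_apply_apply_eq {ρ : Perm (E × Bool)}
    (hρ : G.IsRotationSystem ρ) {h h' : E × Bool} (hh : G.vert h' = G.vert h) (e : ρ (ρ h) = h) :
    h' = h ∨ h' = ρ h := by
  classical
  have := hρ.eq_of_invariant (g := fun k => decide (k = h ∨ k = ρ h)) (v := G.vert h) (fun k _ => by
    rw [decide_eq_decide]
    constructor
    · rintro (e' | e')
      · exact Or.inr (ρ.injective (e'.trans e.symm))
      · exact Or.inl (ρ.injective e')
    · rintro (rfl | rfl)
      · exact Or.inr rfl
      · exact Or.inl e) hh rfl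
  simpa using this

open Classical in
/-- For a planar rotation system, every set of edges that is even at every vertex bounds a set of
faces. -/
theorem exists_colouring [Fintype E] {ρ : Perm (E × Bool)} (hρ : G.IsRotationSystem ρ)
    (hJ : JordanProperty (flip E) ρ) {Z : E × Bool → ZMod 2} (hZ : ∀ h, Z (flip E h) = Z h)
    (hZ0 : ∀ v, ∑ h with G.vert h = v, Z h = 0) :
    ∃ c : E × Bool → ZMod 2, ∀ h, c (flip E h) = c h + Z h ∧ c (ρ h) = c h + Z h := by
  obtain ⟨y, hy⟩ := hρ.exists_primitive (Z := Z) hZ0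
  exact hJ Z y hZ hy

open Classical in
theorem sum_vert_pointMass [Fintype E] (h₀ : E × Bool) (w : V) :
    ∑ h with G.vert h = w, pointMass h₀ h = pointMass (G.vert h₀) w := by
  classical
  by_cases hw : w = G.vert h₀
  · subst hw
    rw [pointMass_self, Finset.sum_eq_single_of_mem h₀ (by simp) fun b _ hb => pointMass_of_ne hb,
      pointMass_self]
  · rw [pointMass_of_ne hw]
    refine Finset.sum_eq_zero fun b hb => pointMass_of_ne ?_
    rintro rfl
    simp at hb
    exact hw hb.symm

theorem pointMass_flip (h₀ h : E × Bool) :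
    pointMass h₀ (flip E h) = pointMass (flip E h₀) h := by
  rw [← pointMass_perm (flip E) (flip E h₀) h, flip_flip]

open Classical in
/-- The edges of a walk, modulo two. -/
theorem exists_walk_flow [Fintype E] {u v : V} (p : G.toSimpleGraph.Walk u v) :
    ∃ W : E × Bool → ZMod 2, (∀ h, W (flip E h) = W h) ∧
      (∀ h, G.vert h ∉ p.support → W h = 0) ∧
      ∀ w, ∑ h with G.vert h = w, W h = pointMass u w + pointMass v w := by
  induction p with
  | nil => exact ⟨0, by simp, by simp, fun w => by simp [CharTwo.add_self_eq_zero]⟩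
  | @cons u c v hadj p ih =>
    obtain ⟨W, hW, hW0, hWs⟩ := ih
    obtain ⟨-, h₀, h1, h2⟩ := toSimpleGraph_adj_iff.1 hadj
    refine ⟨fun h => W h + (pointMass h₀ h + pointMass (flip E h₀) h), fun h => ?_, fun h hh => ?_,
      fun w => ?_⟩
    · beta_reduce
      rw [hW, pointMass_flip, pointMass_flip, flip_flip]
      ring
    · simp only [SimpleGraph.Walk.support_cons, List.mem_cons, not_or] at hh
      beta_reduce
      rw [hW0 _ hh.2, pointMass_of_ne, pointMass_of_ne]
      · ring
      · rintro rfl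
        exact hh.2 (h2 ▸ p.start_mem_support)
      · rintro rfl
        exact hh.1 h1
    · rw [Finset.sum_add_distrib, hWs, Finset.sum_add_distrib, sum_vert_pointMass,
        sum_vert_pointMass, h1, h2]
      grind

/-- A colouring is constant along a walk that avoids the boundary. -/
theorem colouring_eq_of_walk {ρ : Perm (E × Bool)} (hρ : G.IsRotationSystem ρ)
    {Z c : E × Bool → ZMod 2} (hc : ∀ h, c (flip E h) = c h + Z h ∧ c (ρ h) = c h + Z h)
    {u v : V} (p : G.toSimpleGraph.Walk u v) (hp : ∀ h, G.vert h ∈ p.support → Z h = 0)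
    {h h' : E × Bool} (hh : G.vert h = u) (hh' : G.vert h' = v) : c h = c h' := by
  induction p generalizing h with
  | nil =>
    refine hρ.eq_of_invariant (fun a ha => ?_) hh hh'
    rw [(hc a).2, hp a (by simp [ha]), add_zero]
  | @cons u w v hadj p ih =>
    obtain ⟨-, h₀, h1, h2⟩ := toSimpleGraph_adj_iff.1 hadj
    rw [← ih (h := flip E h₀) (fun a ha => hp a (by simp [ha])) h2 hh', (hc h₀).1,
      hp h₀ (by simp [h1]), add_zero]
    refine hρ.eq_of_invariant (fun a ha => ?_) hh h1
    rw [(hc a).2, hp a (by simp [ha]), add_zero]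

/-- The colouring that belongs to the cycle formed by the half-edges `a` and `c` at `x` and a path
that joins their other ends. Half-edges at `x` that are joined by a path disjoint from this cycle
have the same colour. -/
theorem exists_colouring_of_disjoint_walks [Finite E] {ρ : Perm (E × Bool)}
    (hρ : G.IsRotationSystem ρ) (hJ : JordanProperty (flip E) ρ) {x : V} {a b c d : E × Bool}
    (ha : G.vert a = x) (hb : G.vert b = x) (hc : G.vert c = x) (hd : G.vert d = x)
    (hba : b ≠ a) (hbc : b ≠ c) (hda : d ≠ a) (hdc : d ≠ c)
    (p : G.toSimpleGraph.Walk (G.vert (flip E a)) (G.vert (flip E c)))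
    (q : G.toSimpleGraph.Walk (G.vert (flip E b)) (G.vert (flip E d)))
    (hxp : x ∉ p.support) (hxq : x ∉ q.support) (hpq : p.support.Disjoint q.support) :
    ∃ col : E × Bool → ZMod 2,
      (∀ h, G.vert h = x → col (ρ h) = col h + (pointMass a h + pointMass c h)) ∧ col b = col d := by
  classical
  have := Fintype.ofFinite E
  obtain ⟨W, hW, hW0, hWs⟩ := exists_walk_flow p
  set Z : E × Bool → ZMod 2 := fun h => W h + (pointMass a h + pointMass (flip E a) h) +
    (pointMass c h + pointMass (flip E c) h) with hZdef
  have hap := p.start_mem_support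
  have hcp := p.end_mem_support
  obtain ⟨col, hcol⟩ := exists_colouring hρ hJ (Z := Z) (fun h => by
      simp only [hZdef, hW, pointMass_flip, flip_flip]; ring) (fun v => by
      simp only [hZdef, Finset.sum_add_distrib, hWs]
      rw [sum_vert_pointMass, sum_vert_pointMass, sum_vert_pointMass, sum_vert_pointMass, ha, hc]
      grind)
  have hZx : ∀ h, G.vert h = x → Z h = pointMass a h + pointMass c h := by
    intro h hh
    simp only [hZdef]
    rw [hW0 h (by rw [hh]; exact hxp), pointMass_of_ne (a := flip E a), pointMass_of_ne (a := flip E c)]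
    · ring
    · rintro rfl
      exact hxp (hh ▸ hcp)
    · rintro rfl
      exact hxp (hh ▸ hap)
  have hZq : ∀ h, G.vert h ∈ q.support → Z h = 0 := by
    intro h hh
    simp only [hZdef]
    rw [hW0 h (fun h' => hpq h' hh), pointMass_of_ne, pointMass_of_ne, pointMass_of_ne,
      pointMass_of_ne]
    · ring
    · rintro rfl; exact hpq hcp hh
    · rintro rfl; exact hxq (hc ▸ hh)
    · rintro rfl; exact hpq hap hh
    · rintro rfl; exact hxq (ha ▸ hh)
  refine ⟨col, fun h hh => by rw [(hcol h).2, hZx h hh], ?_⟩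
  have h1 := colouring_eq_of_walk hρ hcol q hZq rfl rfl
  rw [(hcol b).1, (hcol d).1, hZx b hb, hZx d hd, pointMass_of_ne hba, pointMass_of_ne hbc,
    pointMass_of_ne hda, pointMass_of_ne hdc] at h1
  simpa using h1

/-! ### Uniqueness of planar rotation systems of 3-connected graphs -/

theorem IsThreeConnected.exists_walk (hG : G.IsThreeConnected) (S : Finset V) (hS : S.card ≤ 2)
    {u v : V} (hu : u ∉ S) (hv : v ∉ S) :
    ∃ p : G.toSimpleGraph.Walk u v, ∀ s ∈ S, s ∉ p.support := by
  obtain ⟨p⟩ := (hG.2.2 S hS).preconnected ⟨u, hu⟩ ⟨v, hv⟩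
  refine ⟨p.map (SimpleGraph.Embedding.induce _).toHom, fun s hs h => ?_⟩
  erw [SimpleGraph.Walk.support_map, List.mem_map] at h
  obtain ⟨⟨t, ht⟩, -, rfl⟩ := h
  exact ht hs

theorem IsSimple.vert_flip_ne (hG : G.IsSimple) (h : E × Bool) : G.vert (flip E h) ≠ G.vert h := by
  obtain ⟨e, b⟩ := h
  cases b
  · exact (hG.1 e).symm
  · exact hG.1 e

theorem IsSimple.eq_of_vert_eq (hG : G.IsSimple) {h h' : E × Bool} (h1 : G.vert h = G.vert h')
    (h2 : G.vert (flip E h) = G.vert (flip E h')) : h = h' := by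
  obtain ⟨e, b⟩ := h
  obtain ⟨e', b'⟩ := h'
  have hne := hG.1 e
  have : e = e' := hG.2 (by
    simp only [Sym2.eq_iff]
    cases b <;> cases b' <;> simp_all [vert, flip_apply])
  subst this
  cases b <;> cases b' <;> simp_all [vert, flip_apply]

theorem IsSimple.adj (hG : G.IsSimple) (h : E × Bool) :
    G.toSimpleGraph.Adj (G.vert h) (G.vert (flip E h)) :=
  toSimpleGraph_adj_iff.2 ⟨(hG.vert_flip_ne h).symm, h, rfl, rfl⟩

theorem IsThreeConnected.exists_half_ne [Finite E] (hG : G.IsThreeConnected) (x : V)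
    (s : Finset (E × Bool)) (hs : s.card ≤ 2) : ∃ h ∉ s, G.vert h = x := by
  classical
  by_contra! hcon
  have : Finite V := Nat.finite_of_card_ne_zero (by have := hG.2.1; omega)
  have := Fintype.ofFinite V
  set S : Finset V := (s.image fun h => G.vert (flip E h)).erase x with hS
  have hSc : S.card ≤ 2 := (Finset.card_le_card (Finset.erase_subset _ _)).trans
    (Finset.card_image_le.trans hs)
  obtain ⟨w, hw⟩ : ∃ w, w ∉ insert x S := by
    by_contra! hall
    have h1 : Fintype.card V ≤ (insert x S).card := by
      rw [← Finset.card_univ]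
      exact Finset.card_le_card fun w _ => hall w
    have h2 := Finset.card_insert_le x S
    have h3 := hG.2.1
    rw [Nat.card_eq_fintype_card] at h3
    omega
  simp only [Finset.mem_insert, not_or] at hw
  obtain ⟨p, hp⟩ := hG.exists_walk S hSc (u := x) (v := w) (by simp [hS]) hw.2
  cases p with
  | nil => exact hw.1 rfl
  | @cons _ c _ hadj p =>
    obtain ⟨hne, h, h1, h2⟩ := toSimpleGraph_adj_iff.1 hadj
    have hmem : h ∈ s := by
      by_contra hh
      exact hcon h hh h1
    refine hp c ?_ (by simp)
    rw [hS, Finset.mem_erase]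
    exact ⟨hne.symm, Finset.mem_image.2 ⟨h, hmem, h2⟩⟩

/-- Two disjoint paths that avoid `x` and join the neighbours of `x` along `a₁` and `a₂` to those
along `b₁` and `b₂`. -/
theorem IsThreeConnected.exists_linkage [Finite E] (hG : G.IsThreeConnected) {x : V}
    {a₁ a₂ b₁ b₂ : E × Bool} (ha₁ : G.vert a₁ = x) (ha₂ : G.vert a₂ = x) (hb₁ : G.vert b₁ = x)
    (hb₂ : G.vert b₂ = x) (ha : a₁ ≠ a₂) (hb : b₁ ≠ b₂) :
    (∃ (p : G.toSimpleGraph.Walk (G.vert (flip E a₁)) (G.vert (flip E b₁)))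
      (q : G.toSimpleGraph.Walk (G.vert (flip E a₂)) (G.vert (flip E b₂))),
      x ∉ p.support ∧ x ∉ q.support ∧ p.support.Disjoint q.support) ∨
    (∃ (p : G.toSimpleGraph.Walk (G.vert (flip E a₁)) (G.vert (flip E b₂)))
      (q : G.toSimpleGraph.Walk (G.vert (flip E a₂)) (G.vert (flip E b₁))),
      x ∉ p.support ∧ x ∉ q.support ∧ p.support.Disjoint q.support) := by
  classical
  have : Finite V := Nat.finite_of_card_ne_zero (by have := hG.2.1; omega)
  have : Nonempty V := ⟨x⟩
  have hne : ∀ {h}, G.vert h = x → G.vert (flip E h) ≠ x := fun {h} hh => hh ▸ hG.1.vert_flip_ne h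
  have hav : ∀ {h h' : E × Bool}, G.vert h = x → G.vert h' = x → h ≠ h' →
      ∀ z, ∃ k, (k = h ∨ k = h') ∧ G.vert k = x ∧ G.vert (flip E k) ≠ z := by
    intro h h' hh hh' hne z
    by_cases hz : G.vert (flip E h) = z
    · exact ⟨h', Or.inr rfl, hh', fun e => hne (hG.1.eq_of_vert_eq (hh.trans hh'.symm)
        (hz.trans e.symm))⟩
    · exact ⟨h, Or.inl rfl, hh, hz⟩
  obtain ⟨a, haA, b, hbB, a', haA', b', hbB', p, q, hp, hq, hpq⟩ :=
    G.toSimpleGraph.exists_disjoint_paths_avoiding {G.vert (flip E a₁), G.vert (flip E a₂)}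
      {G.vert (flip E b₁), G.vert (flip E b₂)} {x} fun z => by
        obtain ⟨k, hk, hkx, hkz⟩ := hav ha₁ ha₂ ha z
        obtain ⟨l, hl, hlx, hlz⟩ := hav hb₁ hb₂ hb z
        obtain ⟨p, hp⟩ := hG.exists_walk {x, z} Finset.card_le_two (u := G.vert (flip E k))
          (v := G.vert (flip E l)) (by simp [hne hkx, hkz]) (by simp [hne hlx, hlz])
        refine ⟨_, ?_, _, ?_, p, hp z (by simp), fun s hs => hp s (by simp_all)⟩
        · rcases hk with rfl | rfl <;> simp
        · rcases hl with rfl | rfl <;> simp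
  have hp := hp x rfl
  have hq := hq x rfl
  have h1 : a ≠ a' := fun e => hpq p.start_mem_support (e ▸ q.start_mem_support)
  have h2 : b ≠ b' := fun e => hpq p.end_mem_support (e ▸ q.end_mem_support)
  simp only [Set.mem_insert_iff, Set.mem_singleton_iff] at haA haA' hbB hbB'
  rcases haA with rfl | rfl <;> rcases haA' with rfl | rfl <;>
    first
    | exact absurd rfl h1
    | (rcases hbB with rfl | rfl <;> rcases hbB' with rfl | rfl <;>
        first
        | exact absurd rfl h2
        | exact Or.inl ⟨p, q, hp, hq, hpq⟩
        | exact Or.inr ⟨p, q, hp, hq, hpq⟩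
        | exact Or.inl ⟨q, p, hq, hp, hpq.symm⟩
        | exact Or.inr ⟨q, p, hq, hp, hpq.symm⟩)

/-- The neighbours of a half-edge in the cyclic order at a vertex do not depend on the planar
rotation system. -/
theorem IsThreeConnected.rotation_apply_or [Finite E] (hG : G.IsThreeConnected)
    {ρ ρ' : Perm (E × Bool)} (hρ : G.IsRotationSystem ρ) (hJ : JordanProperty (flip E) ρ)
    (hρ' : G.IsRotationSystem ρ') (hJ' : JordanProperty (flip E) ρ') (a : E × Bool) :
    ρ' a = ρ a ∨ ρ' a = ρ⁻¹ a := by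
  classical
  by_contra! hcon
  set x := G.vert a with hx
  set b := ρ' a with hb
  set c := ρ a with hc
  set d := ρ⁻¹ a with hd
  have hbx : G.vert b = x := hρ'.vert_apply a
  have hcx : G.vert c = x := hρ.vert_apply a
  have hdx : G.vert d = x := hρ.inv.vert_apply a
  have hρd : ρ d = a := by simp [hd]
  -- a permutation that is cyclic at `x` moves `a` since there is a second half-edge
  have hmove : ∀ {π : Perm (E × Bool)}, G.IsRotationSystem π → π a ≠ a := by
    intro π hπ e
    obtain ⟨h, hh, hhx⟩ := hG.exists_half_ne x {a} (by simp)
    exact hh (by simp [hπ.eq_of_apply_eq hhx e])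
  have hba : b ≠ a := hmove hρ'
  have hca : c ≠ a := hmove hρ
  have hda : d ≠ a := hmove hρ.inv
  have hcd : c ≠ d := by
    intro e
    obtain ⟨h, hh, hhx⟩ := hG.exists_half_ne x {a, c} Finset.card_le_two
    have hρc : ρ (ρ a) = a := by rw [← hc, e, hρd]
    rcases hρ.eq_or_eq_of_apply_apply_eq hhx hρc with rfl | rfl
    · exact hh (by simp)
    · exact hh (by simp [hc])
  have hno : ∀ (p : G.toSimpleGraph.Walk (G.vert (flip E a)) (G.vert (flip E b)))
      (q : G.toSimpleGraph.Walk (G.vert (flip E c)) (G.vert (flip E d))),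
      x ∉ p.support → x ∉ q.support → ¬ p.support.Disjoint q.support := by
    intro p q hp hq hpq
    obtain ⟨col, h1, h2⟩ := exists_colouring_of_disjoint_walks hρ hJ hx.symm hcx hbx hdx hca
      hcon.1.symm hda hcon.2.symm p q hp hq hpq
    have e1 := h1 a hx.symm
    have e2 := h1 d hdx
    rw [pointMass_self, pointMass_of_ne hba.symm] at e1
    rw [hρd, pointMass_of_ne hda, pointMass_of_ne hcon.2.symm] at e2
    rw [← hc, h2, e2] at e1
    simp at e1
  have hN : ∀ h ∈ {h | G.vert h = x}, ρ' h ∈ {h | G.vert h = x} := fun h hh =>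
    (hρ'.vert_apply h).trans hh
  -- `col₁` changes at `a` and `c`, and `col₂` at `a` and `d`
  obtain ⟨col₁, h11, h12⟩ : ∃ col : E × Bool → ZMod 2,
      (∀ h, G.vert h = x → col (ρ' h) = col h + (pointMass a h + pointMass c h)) ∧
        col b = col d := by
    rcases hG.exists_linkage hx.symm hdx hbx hcx hda.symm hcon.1 with
      ⟨p, q, hp, hq, hpq⟩ | ⟨p, q, hp, hq, hpq⟩
    · exact absurd (by simpa using hpq) (hno p q.reverse hp (by simpa using hq))
    · exact exists_colouring_of_disjoint_walks hρ' hJ' hx.symm hbx hcx hdx hba hcon.1 hda hcd.symm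
        p q.reverse hp (by simpa using hq) (by simpa using hpq)
  obtain ⟨col₂, h21, h22⟩ : ∃ col : E × Bool → ZMod 2,
      (∀ h, G.vert h = x → col (ρ' h) = col h + (pointMass a h + pointMass d h)) ∧
        col b = col c := by
    rcases hG.exists_linkage hx.symm hcx hbx hdx hca.symm hcon.2 with
      ⟨p, q, hp, hq, hpq⟩ | ⟨p, q, hp, hq, hpq⟩
    · exact absurd hpq (hno p q hp hq)
    · exact exists_colouring_of_disjoint_walks hρ' hJ' hx.symm hbx hdx hcx hba hcon.2 hca hcd
        p q.reverse hp (by simpa using hq) (by simpa using hpq)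
  have e1 := h11 a hx.symm
  have e2 := h21 a hx.symm
  rw [← hb, pointMass_self, pointMass_of_ne hca.symm] at e1
  rw [← hb, pointMass_self, pointMass_of_ne hda.symm] at e2
  have e3 := ((hρ' x).2 hx.symm hcx).potential_eq_add_one hca.symm hN hx.symm h11
  have e4 := ((hρ' x).2 hx.symm hdx).potential_eq_add_one hda.symm hN hx.symm h21
  have e5 := ((hρ' x).2 hcx hdx).potential_eq_add_one hcd hN hcx
    (c := fun h => col₁ h + col₂ h) (fun h hh => by
      rw [h11 h hh, h21 h hh]
      grind)
  beta_reduce at e5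
  rw [← h12, e1, e4, e3, ← h22, e2] at e5
  grind

end MultiGraph

/-- A walk can be shortened so that it stops just before its last vertex `y` is reached for the
first time. -/
theorem SimpleGraph.Walk.exists_walk_adj_notMem {V : Type*} {G : SimpleGraph V} {a y : V}
    (p : G.Walk a y) (hne : a ≠ y) :
    ∃ b, ∃ q : G.Walk a b, G.Adj b y ∧ q.support ⊆ p.support ∧ y ∉ q.support := by
  classical
  have hsub := p.support_bypass_subset_support
  have hp := p.bypass_isPath
  generalize p.bypass = p' at hsub hp
  obtain ⟨r, hr⟩ : ∃ r, r = p'.reverse := ⟨_, rfl⟩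
  have hr1 : r.IsPath := hr ▸ hp.reverse
  have hr2 : r.support ⊆ p.support := by
    intro t ht
    rw [hr, SimpleGraph.Walk.support_reverse, List.mem_reverse] at ht
    exact hsub ht
  clear hr
  cases r with
  | nil => exact absurd rfl hne
  | cons h q =>
    rw [SimpleGraph.Walk.cons_isPath_iff] at hr1
    refine ⟨_, q.reverse, h.symm, fun t ht => hr2 ?_, by simpa using hr1.2⟩
    rw [SimpleGraph.Walk.support_reverse, List.mem_reverse] at ht
    simp [ht]

namespace MultiGraph

variable {V E : Type*} {G : MultiGraph V E}

/-- If two rotators at a vertex with at least three half-edges differ at every half-edge only in the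
direction, then they are equal or reverse to each other. -/
theorem IsRotationSystem.rotation_at_of_apply_or [Finite E] {ρ ρ' : Perm (E × Bool)}
    (hρ : G.IsRotationSystem ρ) (hρ' : G.IsRotationSystem ρ') {x : V}
    (hdeg : ∀ s : Finset (E × Bool), s.card ≤ 2 → ∃ h ∉ s, G.vert h = x)
    (hor : ∀ h, G.vert h = x → ρ' h = ρ h ∨ ρ' h = ρ⁻¹ h) :
    (∀ h, G.vert h = x → ρ' h = ρ h) ∨ ∀ h, G.vert h = x → ρ' h = ρ⁻¹ h := by
  classical
  by_cases hex : ∃ a, G.vert a = x ∧ ρ' a = ρ a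
  swap
  · exact Or.inr fun h hh => (hor h hh).resolve_left fun e => hex ⟨h, hh, e⟩
  left
  obtain ⟨a, hax, ha⟩ := hex
  -- if `ρ' h = ρ h` but `ρ' (ρ h) = h`, then `ρ'` has a cycle of length two at `x`
  have hstep : ∀ h, G.vert h = x → ρ' h = ρ h → ρ' (ρ h) = ρ (ρ h) := by
    intro h hh e
    rcases hor (ρ h) ((hρ.vert_apply h).trans hh) with e' | e'
    · exact e'
    exfalso
    rw [show ρ⁻¹ (ρ h) = h by simp] at e'
    obtain ⟨k, hk, hkx⟩ := hdeg {h, ρ h} Finset.card_le_two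
    rcases hρ'.eq_or_eq_of_apply_apply_eq (hkx.trans hh.symm) (by rw [e, e']) with rfl | rfl
    · exact hk (by simp)
    · exact hk (by simp [e])
  intro h hh
  obtain ⟨n, rfl⟩ := ((hρ x).2 hax hh).exists_nat_pow_eq
  clear hh
  have key : ∀ n : ℕ, G.vert ((ρ ^ n) a) = x ∧ ρ' ((ρ ^ n) a) = ρ ((ρ ^ n) a) := by
    intro n
    induction n with
    | zero => exact ⟨hax, ha⟩
    | succ n ih =>
      rw [pow_succ', Perm.mul_apply, hρ.vert_apply]
      exact ⟨ih.1, hstep _ ih.1 ih.2⟩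
  exact (key n).2

/-- At a single vertex, the rotators of two planar rotation systems of a 3-connected graph agree up
to reversal. -/
theorem IsThreeConnected.rotation_at [Finite E] (hG : G.IsThreeConnected)
    {ρ ρ' : Perm (E × Bool)} (hρ : G.IsRotationSystem ρ) (hJ : JordanProperty (flip E) ρ)
    (hρ' : G.IsRotationSystem ρ') (hJ' : JordanProperty (flip E) ρ') (x : V) :
    (∀ h, G.vert h = x → ρ' h = ρ h) ∨ ∀ h, G.vert h = x → ρ' h = ρ⁻¹ h :=
  hρ.rotation_at_of_apply_or hρ' (hG.exists_half_ne x) fun h _ =>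
    hG.rotation_apply_or hρ hJ hρ' hJ' h

theorem IsThreeConnected.exists_half_flip_ne [Finite E] (hG : G.IsThreeConnected) (x y z : V) :
    ∃ h, G.vert h = x ∧ G.vert (flip E h) ≠ y ∧ G.vert (flip E h) ≠ z := by
  classical
  by_contra! hcon
  obtain ⟨h₁, -, e₁⟩ := hG.exists_half_ne x ∅ (by simp)
  obtain ⟨h₂, n₂, e₂⟩ := hG.exists_half_ne x {h₁} (by simp)
  obtain ⟨h₃, n₃, e₃⟩ := hG.exists_half_ne x {h₁, h₂} Finset.card_le_two
  have hinj : ∀ {h h'}, h ≠ h' → G.vert h = x → G.vert h' = x →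
      G.vert (flip E h) ≠ G.vert (flip E h') :=
    fun hne e e' he => hne (hG.1.eq_of_vert_eq (e.trans e'.symm) he)
  simp only [Finset.mem_insert, Finset.mem_singleton, not_or] at n₂ n₃
  have f1 := hinj n₂ e₂ e₁
  have f2 := hinj n₃.1 e₃ e₁
  have f3 := hinj n₃.2 e₃ e₂
  have g1 := hcon h₁ e₁
  have g2 := hcon h₂ e₂
  have g3 := hcon h₃ e₃
  by_cases i1 : G.vert (flip E h₁) = y
  · exact f3 ((g3 fun i => f2 (i.trans i1.symm)).trans (g2 fun i => f1 (i.trans i1.symm)).symm)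
  by_cases i2 : G.vert (flip E h₂) = y
  · exact f2 ((g3 fun i => f3 (i.trans i2.symm)).trans (g1 i1).symm)
  · exact f1 ((g2 i2).trans (g1 i1).symm)

/-- Two disjoint paths between the neighbourhoods of the ends of an edge that avoid both ends. -/
theorem IsThreeConnected.exists_disjoint_walks_of_edge [Finite E] (hG : G.IsThreeConnected)
    (e : E × Bool) :
    ∃ α₁ α₂ β₁ β₂ : E × Bool, G.vert α₁ = G.vert e ∧ G.vert α₂ = G.vert e ∧
      G.vert β₁ = G.vert (flip E e) ∧ G.vert β₂ = G.vert (flip E e) ∧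
      ∃ (p : G.toSimpleGraph.Walk (G.vert (flip E α₁)) (G.vert (flip E β₁)))
        (q : G.toSimpleGraph.Walk (G.vert (flip E α₂)) (G.vert (flip E β₂))),
        p.support.Disjoint q.support ∧ G.vert e ∉ p.support ∧ G.vert e ∉ q.support ∧
          G.vert (flip E e) ∉ p.support ∧ G.vert (flip E e) ∉ q.support := by
  classical
  have : Finite V := Nat.finite_of_card_ne_zero (by have := hG.2.1; omega)
  set x := G.vert e with hx
  set y := G.vert (flip E e) with hy
  have hyx : y ≠ x := hG.1.vert_flip_ne e
  have : Nonempty V := ⟨x⟩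
  obtain ⟨a, ⟨α₁, hα₁, rfl⟩, b, ⟨β₁, hβ₁, rfl⟩, a', ⟨α₂, hα₂, rfl⟩, b', ⟨β₂, hβ₂, rfl⟩,
    p, q, hp, hq, hpq⟩ :=
    G.toSimpleGraph.exists_disjoint_paths_avoiding {w | ∃ α, G.vert α = x ∧ G.vert (flip E α) = w}
      {w | ∃ β, G.vert β = y ∧ G.vert (flip E β) = w} {x, y} fun z => by
        obtain ⟨z', hz'y, hz'⟩ : ∃ z', z' ≠ y ∧ (z = y ∨ z = z') := by
          by_cases hz : z = y
          · exact ⟨x, hyx.symm, Or.inl hz⟩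
          · exact ⟨z, hz, Or.inr rfl⟩
        obtain ⟨α, hα, hαy, hαz⟩ := hG.exists_half_flip_ne x y z'
        have hαx : G.vert (flip E α) ≠ x := hα ▸ hG.1.vert_flip_ne α
        obtain ⟨p, hp⟩ := hG.exists_walk {x, z'} Finset.card_le_two (u := G.vert (flip E α))
          (v := y) (by simp [hαx, hαz]) (by simp [hyx, hz'y.symm])
        obtain ⟨b, q, hadj, hqp, hqy⟩ := p.exists_walk_adj_notMem hαy
        obtain ⟨-, β, hβ1, hβ2⟩ := toSimpleGraph_adj_iff.1 hadj.symm
        refine ⟨_, ⟨α, hα, rfl⟩, b, ⟨β, hβ1, hβ2⟩, q, ?_, ?_⟩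
        · rcases hz' with rfl | rfl
          · exact hqy
          · exact fun h => hp z (by simp) (hqp h)
        · rintro s (rfl | rfl)
          · exact fun h => hp _ (by simp) (hqp h)
          · exact hqy
  exact ⟨α₁, α₂, β₁, β₂, hα₁, hα₂, hβ₁, hβ₂, p, q, hpq, hp x (by simp), hq x (by simp),
    hp y (by simp), hq y (by simp)⟩

/-- The two halves of an edge cancel modulo two. -/
theorem sum_eq_zero_of_flip [Fintype E] {Y : E × Bool → ZMod 2} (hY : ∀ h, Y (flip E h) = Y h) :
    ∑ h, Y h = 0 := by
  rw [Fintype.sum_prod_type]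
  refine Finset.sum_eq_zero fun e _ => ?_
  have := hY (e, false)
  simp only [flip_apply, Bool.not_false] at this
  rw [Fintype.sum_bool, this]
  exact CharTwo.add_self_eq_zero _

/-- Two planar rotation systems do not agree at one end of an edge and disagree at the other. The
cycle `Z` runs through `x`, the path `p`, and `y`. The two colourings `c` and `c'` with boundary `Z`
are compared along `p`: the restriction of `Z` to the edges where `c + c'` takes a given value is
even at all vertices of `p`, but contains only one of the edges by which `Z` leaves `p`. -/
theorem IsThreeConnected.rotation_propagate [Finite E] (hG : G.IsThreeConnected)
    {ρ ρ' : Perm (E × Bool)} (hρ : G.IsRotationSystem ρ) (hJ : JordanProperty (flip E) ρ)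
    (hρ' : G.IsRotationSystem ρ') (hJ' : JordanProperty (flip E) ρ') (e : E × Bool)
    (hx : ∀ h, G.vert h = G.vert e → ρ' h = ρ h)
    (hy : ∀ h, G.vert h = G.vert (flip E e) → ρ' h = ρ⁻¹ h) : False := by
  classical
  have := Fintype.ofFinite E
  obtain ⟨α₁, α₂, β₁, β₂, hα₁, hα₂, hβ₁, hβ₂, p, q, hpq, hxp, hxq, hyp, hyq⟩ :=
    hG.exists_disjoint_walks_of_edge e
  have hyx : G.vert (flip E e) ≠ G.vert e := hG.1.vert_flip_ne e
  set x := G.vert e with hxe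
  set y := G.vert (flip E e) with hye
  obtain ⟨W, hW, hW0, hWs⟩ := exists_walk_flow p
  obtain ⟨U, hU, hU0, hUs⟩ := exists_walk_flow q
  set A₁ : E × Bool → ZMod 2 := fun h => pointMass α₁ h + pointMass (flip E α₁) h with hA₁
  set A₂ : E × Bool → ZMod 2 := fun h => pointMass α₂ h + pointMass (flip E α₂) h with hA₂
  set B₁ : E × Bool → ZMod 2 := fun h => pointMass β₁ h + pointMass (flip E β₁) h with hB₁
  set B₂ : E × Bool → ZMod 2 := fun h => pointMass β₂ h + pointMass (flip E β₂) h with hB₂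
  set Z : E × Bool → ZMod 2 := fun h => W h + U h + (A₁ h + A₂ h) + (B₁ h + B₂ h) with hZ
  have hpair : ∀ (k h : E × Bool), pointMass k (flip E h) + pointMass (flip E k) (flip E h) =
      pointMass k h + pointMass (flip E k) h := fun k h => by
    rw [pointMass_flip, pointMass_flip, flip_flip, add_comm]
  have hZτ : ∀ h, Z (flip E h) = Z h := fun h => by
    simp only [hZ, hA₁, hA₂, hB₁, hB₂, hW, hU, hpair]
  have hZs : ∀ v, ∑ h with G.vert h = v, Z h = 0 := fun v => by
    simp only [hZ, hA₁, hA₂, hB₁, hB₂, Finset.sum_add_distrib, hWs, hUs]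
    simp only [sum_vert_pointMass, hα₁, hα₂, hβ₁, hβ₂]
    grind
  obtain ⟨c, hc⟩ := exists_colouring hρ hJ hZτ hZs
  obtain ⟨c', hc'⟩ := exists_colouring hρ' hJ' hZτ hZs
  set D : E × Bool → ZMod 2 := fun h => c h + c' h with hD
  have hDτ : ∀ h, D (flip E h) = D h := fun h => by
    simp only [hD, (hc h).1, (hc' h).1]
    grind
  have hsame : ∀ v, (∀ h, G.vert h = v → ρ' h = ρ h) → ∀ h h', G.vert h = v → G.vert h' = v →
      D h = D h' := by
    intro v hv h h' hh hh'
    refine hρ.eq_of_invariant (fun k hk => ?_) hh hh'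
    have := (hc' k).2
    rw [hv k hk] at this
    simp only [hD, (hc k).2, this]
    grind
  have hopp : ∀ v, (∀ h, G.vert h = v → ρ' h = ρ⁻¹ h) → ∀ h h', G.vert h = v → G.vert h' = v →
      D h + Z h = D h' + Z h' := by
    intro v hv h h' hh hh'
    refine hρ.eq_of_invariant (g := fun h => D h + Z h) (fun k hk => ?_) hh hh'
    have := (hc' (ρ k)).2
    rw [hv (ρ k) (by rw [hρ.vert_apply, hk]), show ρ⁻¹ (ρ k) = k by simp] at this
    simp only [hD, (hc k).2, this]
    grind
  -- on the edges of `Z` at a vertex, `D` is constant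
  have hconst : ∀ v, ∃ k, ∀ h, G.vert h = v → Z h * D h = Z h * k := by
    intro v
    by_cases hex : ∃ h, G.vert h = v
    swap
    · exact ⟨0, fun h hh => absurd ⟨h, hh⟩ hex⟩
    obtain ⟨h₀, hh₀⟩ := hex
    rcases hG.rotation_at hρ hJ hρ' hJ' v with hv | hv
    · exact ⟨D h₀, fun h hh => by rw [hsame v hv h h₀ hh hh₀]⟩
    · refine ⟨D h₀ + Z h₀ + 1, fun h hh => ?_⟩
      have := hopp v hv h h₀ hh hh₀
      rw [← this]
      generalize Z h = s
      generalize D h = t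
      revert s t
      decide
  have hnx : ∀ {h k : E × Bool}, G.vert h ∈ p.support → G.vert k = x → pointMass k h = 0 := by
    intro h k hh hk
    refine pointMass_of_ne ?_
    rintro rfl
    exact hxp (hk ▸ hh)
  have hny : ∀ {h k : E × Bool}, G.vert h ∈ p.support → G.vert k = y → pointMass k h = 0 := by
    intro h k hh hk
    refine pointMass_of_ne ?_
    rintro rfl
    exact hyp (hk ▸ hh)
  have hnq : ∀ {h k : E × Bool}, G.vert h ∈ p.support → G.vert k ∈ q.support →
      pointMass k h = 0 := by
    intro h k hh hk
    refine pointMass_of_ne ?_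
    rintro rfl
    exact hpq hh hk
  have hZp : ∀ h, G.vert h ∈ p.support →
      Z h = W h + (pointMass (flip E α₁) h + pointMass (flip E β₁) h) := by
    intro h hh
    simp only [hZ, hA₁, hA₂, hB₁, hB₂]
    rw [hU0 h (fun h' => hpq hh h'), hnx hh hα₁, hnx hh hα₂, hny hh hβ₁, hny hh hβ₂,
      hnq hh q.start_mem_support, hnq hh q.end_mem_support]
    ring
  have hαβ : α₁ ≠ β₁ := by
    rintro rfl
    exact hyx (hβ₁.symm.trans hα₁)
  have hZβ : Z β₁ = 1 := by
    rw [← hZτ, hZp _ p.end_mem_support, hW, hW0 β₁ (by rw [hβ₁]; exact hyp), pointMass_self,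
      pointMass_of_ne ((flip E).injective.ne hαβ.symm)]
    ring
  have hZe : Z e = 0 := by
    have h1 : e ≠ α₁ := by rintro rfl; exact hyp p.start_mem_support
    have h2 : e ≠ α₂ := by rintro rfl; exact hyq q.start_mem_support
    have h3 : e ≠ flip E β₁ := by rintro rfl; exact hxp p.end_mem_support
    have h4 : e ≠ flip E β₂ := by rintro rfl; exact hxq q.end_mem_support
    have hn : ∀ k, G.vert k ≠ x → pointMass k e = 0 := fun k hk => pointMass_of_ne (by
      rintro rfl
      exact hk rfl)
    simp only [hZ, hA₁, hA₂, hB₁, hB₂]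
    rw [hW0 e hxp, hU0 e hxq, pointMass_of_ne h1, pointMass_of_ne h2, pointMass_of_ne h3,
      pointMass_of_ne h4, hn (flip E α₁) fun i => hxp (i ▸ p.start_mem_support),
      hn (flip E α₂) fun i => hxq (i ▸ q.start_mem_support), hn β₁ (by rw [hβ₁]; exact hyx),
      hn β₂ (by rw [hβ₂]; exact hyx)]
    ring
  have hDα : D (flip E α₁) = D e := by
    rw [hDτ]
    exact hsame x hx _ _ hα₁ rfl
  have hDβ : D (flip E β₁) = D e + 1 := by
    have := hopp y hy β₁ (flip E e) hβ₁ rfl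
    rw [hZτ, hZe, hDτ, hZβ] at this
    rw [hDτ]
    grind
  set T := p.support.toFinset with hT
  have hzero : ∑ h with G.vert h ∈ T, Z h * (D h + (D e + 1)) = 0 := by
    rw [← Finset.sum_fiberwise_of_maps_to (t := T) (g := G.vert) (fun h hh => by simpa using hh)]
    refine Finset.sum_eq_zero fun v hv => ?_
    have hfil : ({h ∈ ({h | G.vert h ∈ T} : Finset (E × Bool)) | G.vert h = v} : Finset _) =
        ({h | G.vert h = v} : Finset (E × Bool)) := by
      ext h
      simp only [Finset.mem_filter, Finset.mem_univ, true_and, and_iff_right_iff_imp]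
      rintro rfl
      exact hv
    obtain ⟨k, hk⟩ := hconst v
    rw [hfil, Finset.sum_congr rfl (g := fun h => Z h * (k + (D e + 1))) fun h hh => by
      rw [mul_add (Z h) (D h), hk h (by simpa using hh), ← mul_add], ← Finset.sum_mul, hZs, zero_mul]
  have hone : ∑ h with G.vert h ∈ T, Z h * (D h + (D e + 1)) = 1 := by
    rw [Finset.sum_filter, Finset.sum_congr rfl
      (g := fun h => W h * (D h + (D e + 1)) + pointMass (flip E α₁) h) ?_]
    · rw [Finset.sum_add_distrib, sum_eq_zero_of_flip fun h => by rw [hW, hDτ],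
        Finset.sum_eq_single_of_mem (flip E α₁) (Finset.mem_univ _) fun b _ hb =>
        pointMass_of_ne hb, pointMass_self, zero_add]
    · intro h _
      split_ifs with hh
      · have hh' : G.vert h ∈ p.support := by simpa [hT] using hh
        rw [hZp h hh']
        by_cases i1 : h = flip E α₁
        · rw [i1, pointMass_self, pointMass_of_ne ((flip E).injective.ne hαβ), hDα]
          grind
        · rw [pointMass_of_ne i1]
          by_cases i2 : h = flip E β₁
          · rw [i2, pointMass_self, hDβ]
            grind
          · rw [pointMass_of_ne i2]
            ring
      · have hh' : G.vert h ∉ p.support := by simpa [hT] using hh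
        rw [hW0 h hh', pointMass_of_ne]
        · ring
        · rintro rfl
          exact hh' p.start_mem_support
  exact zero_ne_one (hzero.symm.trans hone)

/-- **Whitney's theorem**: a 3-connected graph has at most one planar rotation system, up to
reversal. -/
theorem IsThreeConnected.eq_or_eq_inv [Finite E] (hG : G.IsThreeConnected)
    {ρ ρ' : Perm (E × Bool)} (hρ : G.IsRotationSystem ρ) (hJ : JordanProperty (flip E) ρ)
    (hρ' : G.IsRotationSystem ρ') (hJ' : JordanProperty (flip E) ρ') : ρ' = ρ ∨ ρ' = ρ⁻¹ := by
  classical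
  set A : V → Prop := fun x => ∀ h, G.vert h = x → ρ' h = ρ h with hA
  have hor := hG.rotation_at hρ hJ hρ' hJ'
  have hstep : ∀ u v, G.toSimpleGraph.Adj u v → A u → A v := by
    intro u v huv hu
    obtain ⟨-, e, rfl, rfl⟩ := toSimpleGraph_adj_iff.1 huv
    exact (hor _).resolve_right fun hv => hG.rotation_propagate hρ hJ hρ' hJ' e hu hv
  have hall : ∀ u v, A u → A v := by
    intro u v hu
    obtain ⟨p, -⟩ := hG.exists_walk ∅ (by simp) (u := u) (v := v) (by simp) (by simp)
    induction p with
    | nil => exact hu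
    | cons h p ih => exact ih (hstep _ _ h hu)
  by_cases hex : ∃ u, A u
  · obtain ⟨u, hu⟩ := hex
    exact Or.inl (Equiv.ext fun h => hall u _ hu h rfl)
  · exact Or.inr (Equiv.ext fun h => (hor (G.vert h)).resolve_left (fun h' => hex ⟨_, h'⟩) h rfl)

end MultiGraph

/-! ### Subdivisions in terms of half-edges -/

theorem SimpleGraph.Walk.mem_edges_iff_getVert {V : Type*} {G : SimpleGraph V} {u v : V}
    (p : G.Walk u v) {a : Sym2 V} :
    a ∈ p.edges ↔ ∃ i < p.length, a = s(p.getVert i, p.getVert (i + 1)) := by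
  induction p with
  | nil => simp
  | @cons u w v h p ih =>
    rw [SimpleGraph.Walk.edges_cons, List.mem_cons, ih]
    constructor
    · rintro (rfl | ⟨i, hi, rfl⟩)
      · exact ⟨0, by simp, by simp⟩
      · exact ⟨i + 1, by simpa using hi, by simp⟩
    · rintro ⟨i, hi, rfl⟩
      rcases i with _ | i
      · left; simp
      · right
        exact ⟨i, by simpa using hi, by simp⟩

namespace MultiGraph

/-- A subdivision `L` of a multigraph `H` in terms of half-edges: `φ` maps the vertices of `H` to
the branch vertices; `q` maps every half-edge of `L` to the half-edge of `H` on whose subdivision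
path it lies and which points in the same direction; `m` maps a half-edge of `H` to the first
half-edge of its subdivision path. The last condition says that the subdivision paths are connected.
-/
structure SubdivisionMap {V E W F : Type*} (L : MultiGraph V E) (H : MultiGraph W F) where
  φ : W → V
  q : E × Bool → F × Bool
  m : F × Bool → E × Bool
  φ_inj : Function.Injective φ
  q_flip : ∀ h, q (flip E h) = flip F (q h)
  vert_m : ∀ k, L.vert (m k) = φ (H.vert k)
  q_m : ∀ k, q (m k) = k
  m_q : ∀ h, L.vert h ∈ Set.range φ → m (q h) = h
  inner : ∀ v ∉ Set.range φ, ∃ h h', h ≠ h' ∧ q h' = flip F (q h) ∧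
    ∀ a, L.vert a = v ↔ a = h ∨ a = h'
  conn : ∀ g : E × Bool → ZMod 2, (∀ h, g (flip E h) = g h) →
    (∀ h h', L.vert h ∉ Set.range φ → L.vert h = L.vert h' → g h = g h') → ∀ h, g (m (q h)) = g h

variable {V E W F : Type*} {L : MultiGraph V E} {H : MultiGraph W F}

set_option maxHeartbeats 800000 in
/-- A subdivision that is given by subdivision paths has a description by half-edges. The simplicity
of `L` makes its half-edges correspond to ordered pairs of adjacent vertices. -/
theorem nonempty_subdivisionMap (hL : L.IsSimple) (hH : ∀ f, H.ends f false ≠ H.ends f true)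
    (h : L.toSimpleGraph.IsSubdivisionOf H) : Nonempty (SubdivisionMap L H) := by
  classical
  obtain ⟨φ, P, hP, hinner, hshare, hcover, hedge⟩ := h
  have hlen : ∀ f, 0 < (P f).length := by
    intro f
    refine Nat.pos_of_ne_zero fun h0 => hH f (φ.injective ?_)
    exact SimpleGraph.Walk.eq_of_length_eq_zero h0
  have hinj : ∀ f i j, i ≤ (P f).length → j ≤ (P f).length → (P f).getVert i = (P f).getVert j →
      i = j := fun f i j hi hj e => (hP f).getVert_injOn hi hj e
  have hhalf : ∀ f i, i < (P f).length → ∃ h : E × Bool, L.vert h = (P f).getVert i ∧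
      L.vert (flip E h) = (P f).getVert (i + 1) := fun f i hi =>
    (toSimpleGraph_adj_iff.1 ((P f).adj_getVert_succ hi)).2
  have hhalf' : ∀ f i, ∃ h : E × Bool, i < (P f).length → L.vert h = (P f).getVert i ∧
      L.vert (flip E h) = (P f).getVert (i + 1) := by
    intro f i
    by_cases hi : i < (P f).length
    · obtain ⟨h, hh⟩ := hhalf f i hi
      exact ⟨h, fun _ => hh⟩
    · obtain ⟨h, -⟩ := hhalf f 0 (hlen f)
      exact ⟨h, fun h' => absurd h' hi⟩
  choose half hhalf using hhalf'
  -- the half-edge at the position `i` of a subdivision path, in the direction `b`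
  set hf : F → ℕ → Bool → E × Bool := fun f i b => if b then flip E (half f i) else half f i with hhf
  have hflip : ∀ f i b, flip E (hf f i b) = hf f i (!b) := by
    intro f i b
    cases b <;> simp [hhf]
  have hvert : ∀ f i b, i < (P f).length →
      L.vert (hf f i b) = (P f).getVert (if b then i + 1 else i) := by
    intro f i b hi
    cases b
    · simpa [hhf] using (hhalf f i hi).1
    · simpa [hhf] using (hhalf f i hi).2
  have hsym : ∀ f i b, i < (P f).length → s(L.vert (hf f i b), L.vert (flip E (hf f i b))) =
      s((P f).getVert i, (P f).getVert (i + 1)) := by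
    intro f i b hi
    rw [hflip, hvert f i b hi, hvert f i _ hi]
    cases b
    · simp
    · simp [Sym2.eq_swap]
  have hex : ∀ h : E × Bool, ∃ x : F × ℕ × Bool, x.2.1 < (P x.1).length ∧ hf x.1 x.2.1 x.2.2 = h := by
    intro h
    obtain ⟨f, hf', -⟩ := hedge s(L.vert h, L.vert (flip E h)) (hL.adj h)
    obtain ⟨i, hi, e⟩ := (P f).mem_edges_iff_getVert.1 hf'
    rcases Sym2.eq_iff.1 e with ⟨e1, e2⟩ | ⟨e1, e2⟩
    · refine ⟨(f, i, false), hi, hL.eq_of_vert_eq ?_ ?_⟩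
      · rw [hvert _ _ _ hi, e1]; simp
      · rw [hflip, hvert _ _ _ hi, e2]; simp
    · refine ⟨(f, i, true), hi, hL.eq_of_vert_eq ?_ ?_⟩
      · rw [hvert _ _ _ hi, e1]; simp
      · rw [hflip, hvert _ _ _ hi, e2]; simp
  have huniq : ∀ f i b f' i' b', i < (P f).length → i' < (P f').length →
      hf f i b = hf f' i' b' → f = f' ∧ i = i' ∧ b = b' := by
    intro f i b f' i' b' hi hi' e
    have es := hsym f i b hi
    rw [e, hsym f' i' b' hi'] at es
    obtain rfl : f = f' := by
      refine (hedge s((P f).getVert i, (P f).getVert (i + 1)) ((P f).adj_getVert_succ hi)).unique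
        ((P f).mem_edges_iff_getVert.2 ⟨i, hi, rfl⟩) ?_
      rw [← es]
      exact (P f').mem_edges_iff_getVert.2 ⟨i', hi', rfl⟩
    obtain rfl : i = i' := by
      rcases Sym2.eq_iff.1 es with ⟨e1, -⟩ | ⟨e1, e2⟩
      · exact hinj f _ _ hi.le hi'.le e1.symm
      · have h1 := hinj f _ _ hi'.le hi e1
        have h2 := hinj f _ _ hi' hi.le e2
        omega
    refine ⟨rfl, rfl, ?_⟩
    have ev := congrArg L.vert e
    rw [hvert f i b hi, hvert f i b' hi] at ev
    have := hinj f _ _ (by split_ifs <;> omega) (by split_ifs <;> omega) ev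
    clear e ev es
    cases b <;> cases b' <;> first | rfl | (simp at this)
  choose x hx hxe using hex
  have hxu : ∀ f i b, i < (P f).length → x (hf f i b) = (f, i, b) := by
    intro f i b hi
    obtain ⟨h1, h2, h3⟩ := huniq _ _ _ _ _ _ (hx (hf f i b)) hi (hxe (hf f i b))
    exact Prod.ext h1 (Prod.ext h2 h3)
  -- the positions of a branch vertex on a path
  have hbranch : ∀ f i w, i ≤ (P f).length → (P f).getVert i = φ w →
      (i = 0 ∧ w = H.ends f false) ∨ (i = (P f).length ∧ w = H.ends f true) := by
    intro f i w hi e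
    rcases hinner f w (by rw [← e]; exact (P f).getVert_mem_support i) with rfl | rfl
    · exact Or.inl ⟨hinj f i 0 hi (by omega) (by rw [e, SimpleGraph.Walk.getVert_zero]), rfl⟩
    · exact Or.inr ⟨hinj f i _ hi le_rfl (by rw [e, SimpleGraph.Walk.getVert_length]), rfl⟩
  set m : F × Bool → E × Bool := fun k => hf k.1 (if k.2 then (P k.1).length - 1 else 0) k.2 with hm
  have hmi : ∀ k : F × Bool, (if k.2 then (P k.1).length - 1 else 0) < (P k.1).length := by
    intro k
    have := hlen k.1
    split_ifs <;> omega
  refine ⟨⟨φ, fun h => ((x h).1, (x h).2.2), m, φ.injective, fun h => ?_, fun k => ?_, fun k => ?_,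
    fun h hh => ?_, fun v hv => ?_, fun g hg1 hg2 h => ?_⟩⟩
  · have : flip E h = hf (x h).1 (x h).2.1 (!(x h).2.2) := by rw [← hflip, hxe]
    rw [this, hxu _ _ _ (hx h)]
    rfl
  · have h1 := hlen k.1
    obtain ⟨f, b⟩ := k
    rw [hm]
    beta_reduce
    rw [hvert _ _ _ (hmi (f, b))]
    cases b
    · simp [vert]
    · simp only [if_true]
      rw [Nat.sub_add_cancel h1, SimpleGraph.Walk.getVert_length]
      rfl
  · rw [hm]
    beta_reduce
    rw [hxu _ _ _ (hmi k)]
  · obtain ⟨w, hw⟩ := hh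
    have e := hxe h
    have hi := hx h
    rw [← e, hvert _ _ _ hi] at hw
    generalize x h = t at e hi hw
    obtain ⟨f, i, b⟩ := t
    simp only at e hi hw ⊢
    rw [← e, hm]
    have := hbranch f _ w (by split_ifs <;> omega) hw.symm
    cases b
    · simp only [Bool.false_eq_true, if_false] at this ⊢
      rw [show i = 0 by omega]
    · simp only [if_true] at this ⊢
      rw [show i = (P f).length - 1 by omega]
  · obtain ⟨f, hvf⟩ := (hcover v).resolve_left hv
    obtain ⟨i, rfl, hi⟩ := SimpleGraph.Walk.mem_support_iff_exists_getVert.1 hvf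
    have hi0 : i ≠ 0 := by
      rintro rfl
      exact hv ⟨_, (SimpleGraph.Walk.getVert_zero _).symm⟩
    have hil : i ≠ (P f).length := by
      rintro rfl
      exact hv ⟨_, (SimpleGraph.Walk.getVert_length _).symm⟩
    have hi1 : i < (P f).length := by omega
    have hi2 : i - 1 < (P f).length := by omega
    refine ⟨hf f i false, hf f (i - 1) true, fun e => ?_, ?_, fun a => ⟨fun ha => ?_, ?_⟩⟩
    · exact absurd (huniq _ _ _ _ _ _ hi1 hi2 e).2.2 (by simp)
    · rw [hxu _ _ _ hi1, hxu _ _ _ hi2]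
      rfl
    · have e := hxe a
      have hj := hx a
      rw [← e, hvert _ _ _ hj] at ha
      generalize x a = t at e hj ha
      obtain ⟨f', j, b⟩ := t
      simp only at e hj ha
      obtain rfl : f' = f := by
        by_contra hne
        exact hv (hshare f' f _ hne (ha ▸ (P f').getVert_mem_support _) hvf)
      have := hinj f' _ _ (by split_ifs <;> omega) hi ha
      cases b
      · left
        rw [← e, ← this]; simp
      · right
        rw [← e, ← this]; simp
    · rintro (rfl | rfl)
      · rw [hvert _ _ _ hi1]; simp
      · rw [hvert _ _ _ hi2]
        simp only [if_true]
        rw [Nat.sub_add_cancel (by omega)]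
  · have key : ∀ f i, i < (P f).length → g (hf f i false) = g (hf f 0 false) := by
      intro f i
      induction i with
      | zero => exact fun _ => rfl
      | succ i ih =>
        intro hi
        have hi' : i < (P f).length := by omega
        rw [← ih hi', ← hg1 (hf f i false), hflip]
        refine hg2 _ _ ?_ ?_
        · rintro ⟨w, hw⟩
          rw [hvert _ _ _ hi] at hw
          have := hbranch f _ w (by simp; omega) hw.symm
          simp at this
          omega
        · rw [hvert _ _ _ hi, hvert _ _ _ hi']
          simp
    have key' : ∀ f i b, i < (P f).length → g (hf f i b) = g (hf f 0 false) := by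
      intro f i b hi
      cases b
      · exact key f i hi
      · rw [← hg1, hflip]
        exact key f i hi
    rw [hm]
    beta_reduce
    have e := hxe h
    have hi := hx h
    generalize x h = t at e hi
    obtain ⟨f, i, b⟩ := t
    simp only at e hi ⊢
    rw [← e, key' f i b hi, key' f _ b (hmi (f, b))]

end MultiGraph

namespace MultiGraph

variable {V E W F : Type*} {L : MultiGraph V E} {H : MultiGraph W F}

/-- At a vertex with two half-edges the rotator exchanges them. -/
theorem IsRotationSystem.apply_eq_of_pair {ρ : Perm (E × Bool)} (hρ : L.IsRotationSystem ρ) {v : V}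
    {h h' : E × Bool} (hne : h ≠ h') (hv : ∀ a, L.vert a = v ↔ a = h ∨ a = h') : ρ h = h' := by
  classical
  have hh : L.vert h = v := (hv h).2 (Or.inl rfl)
  refine ((hv (ρ h)).1 ((hρ.vert_apply h).trans hh)).resolve_left fun e => hne ?_
  exact (hρ.eq_of_apply_eq (((hv h').2 (Or.inr rfl)).trans hh.symm) e).symm

/-- A permutation that embeds into a cyclic one is cyclic. -/
theorem isCycleOn_of_semiconj {α β : Type*} [Finite α] [Finite β] {π : Perm α} {π' : Perm β}
    {T : Set α} {T' : Set β} (hπ : π.IsCycleOn T) (m : β → α) (hinj : Set.InjOn m T')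
    (hmap : ∀ k ∈ T', m k ∈ T) (hT' : ∀ k ∈ T', π' k ∈ T') (hm : ∀ k ∈ T', m (π' k) = π (m k)) :
    π'.IsCycleOn T' := by
  refine ⟨⟨hT', π'.injective.injOn, fun k hk => ?_⟩, fun k hk k' hk' => ?_⟩
  · exact ⟨π'.symm k, Equiv.Perm.perm_symm_mapsTo_of_mapsTo π' hT' hk, π'.apply_symm_apply k⟩
  · obtain ⟨n, hn⟩ := (hπ.2 (hmap k hk) (hmap k' hk')).exists_nat_pow_eq
    have key : ∀ n : ℕ, (π' ^ n) k ∈ T' ∧ m ((π' ^ n) k) = (π ^ n) (m k) := by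
      intro n
      induction n with
      | zero => exact ⟨hk, rfl⟩
      | succ n ih =>
        rw [pow_succ', pow_succ', Perm.mul_apply, Perm.mul_apply, hm _ ih.1, ih.2]
        exact ⟨hT' _ ih.1, rfl⟩
    exact ⟨n, by rw [zpow_natCast]; exact hinj (key n).1 hk' ((key n).2.trans hn)⟩

namespace SubdivisionMap

variable (S : SubdivisionMap L H)

theorem φ_vert_q {h : E × Bool} (hh : L.vert h ∈ Set.range S.φ) :
    S.φ (H.vert (S.q h)) = L.vert h := by
  rw [← S.vert_m, S.m_q h hh]

theorem m_injective : Function.Injective S.m := fun k k' e => by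
  rw [← S.q_m k, e, S.q_m]

theorem vert_m_mem (k : F × Bool) : L.vert (S.m k) ∈ Set.range S.φ := ⟨_, (S.vert_m k).symm⟩

/-- A rotation system of a subdivision gives a rotation system of the subdivided graph. -/
def push {ρ : Perm (E × Bool)} (hρ : L.IsRotationSystem ρ) : Perm (F × Bool) where
  toFun k := S.q (ρ (S.m k))
  invFun k := S.q (ρ⁻¹ (S.m k))
  left_inv k := by
    beta_reduce
    rw [S.m_q _ (by rw [hρ.vert_apply]; exact S.vert_m_mem k)]
    simp [S.q_m]
  right_inv k := by
    beta_reduce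
    rw [S.m_q _ (by rw [hρ.inv.vert_apply]; exact S.vert_m_mem k)]
    simp [S.q_m]

variable {ρ ρ' : Perm (E × Bool)} (hρ : L.IsRotationSystem ρ) (hρ' : L.IsRotationSystem ρ')

theorem push_apply (k : F × Bool) : S.push hρ k = S.q (ρ (S.m k)) := rfl

theorem m_push (k : F × Bool) : S.m (S.push hρ k) = ρ (S.m k) :=
  S.m_q _ (by rw [hρ.vert_apply]; exact S.vert_m_mem k)

theorem push_inv : S.push hρ.inv = (S.push hρ)⁻¹ := rfl

theorem push_isRotationSystem [Finite E] [Finite F] : H.IsRotationSystem (S.push hρ) := by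
  intro w
  refine isCycleOn_of_semiconj (hρ (S.φ w)) S.m S.m_injective.injOn ?_ ?_
    fun k _ => S.m_push hρ k
  · rintro k rfl
    exact S.vert_m k
  · rintro k rfl
    refine S.φ_inj ?_
    rw [← S.vert_m, m_push, hρ.vert_apply, S.vert_m]

/-- A function that is invariant along the subdivision paths takes equal values on the two ends of
such a path. -/
theorem apply_m_flip {g : E × Bool → ZMod 2} (hg1 : ∀ h, g (flip E h) = g h)
    (hg2 : ∀ h h', L.vert h ∉ Set.range S.φ → L.vert h = L.vert h' → g h = g h') (k : F × Bool) :
    g (S.m (flip F k)) = g (S.m k) := by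
  have := S.conn g hg1 hg2 (flip E (S.m (flip F k)))
  rw [S.q_flip, S.q_m, flip_flip, hg1] at this
  exact this.symm

/-- At an inner vertex of a subdivision path it suffices to compare its two half-edges in one order.
-/
theorem eq_of_inner {g : E × Bool → ZMod 2}
    (hg : ∀ h h', h ≠ h' → S.q h' = flip F (S.q h) → (∀ a, L.vert a = L.vert h ↔ a = h ∨ a = h') →
      g h = g h') {h h' : E × Bool} (hv : L.vert h ∉ Set.range S.φ) (he : L.vert h = L.vert h') :
    g h = g h' := by
  obtain ⟨a, b, hab, hq, hall⟩ := S.inner _ hv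
  have ha : L.vert a = L.vert h := (hall a).2 (Or.inl rfl)
  have := hg a b hab hq (by rw [ha]; exact hall)
  rcases (hall h).1 rfl with rfl | rfl <;> rcases (hall h').1 he.symm with rfl | rfl <;>
    first | rfl | exact this | exact this.symm

/-- A planar rotation system of a subdivision induces a planar one of the subdivided graph: a cycle
of `H` is pulled back along `q`, and the resulting set of faces is restricted along `m`. -/
theorem push_jordanProperty [Finite E] [Finite F] (hJ : JordanProperty (flip E) ρ) :
    JordanProperty (flip F) (S.push hρ) := by
  classical
  have := Fintype.ofFinite E
  have := Fintype.ofFinite F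
  intro Z y hZ hy
  have hs := sum_vert_eq_zero_of_primitive (S.push_isRotationSystem hρ) hy
  obtain ⟨c, hc⟩ := exists_colouring hρ hJ (Z := fun h => Z (S.q h))
    (fun h => by rw [S.q_flip, hZ]) fun v => by
      by_cases hv : v ∈ Set.range S.φ
      · obtain ⟨w, rfl⟩ := hv
        rw [← hs w]
        refine Finset.sum_bij' (fun h _ => S.q h) (fun k _ => S.m k) ?_ ?_ ?_ ?_ ?_
        · intro h hh
          simp only [Finset.mem_filter, Finset.mem_univ, true_and] at hh ⊢
          exact S.φ_inj (by rw [S.φ_vert_q ⟨w, hh.symm⟩, hh])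
        · intro k hk
          simp only [Finset.mem_filter, Finset.mem_univ, true_and] at hk ⊢
          rw [S.vert_m, hk]
        · intro h hh
          simp only [Finset.mem_filter, Finset.mem_univ, true_and] at hh
          exact S.m_q h ⟨w, hh.symm⟩
        · intro k _
          exact S.q_m k
        · exact fun _ _ => rfl
      · obtain ⟨a, b, hab, hq, hall⟩ := S.inner _ hv
        have : ({h | L.vert h = v} : Finset (E × Bool)) = {a, b} := by
          ext h
          simp [hall]
        rw [this, Finset.sum_pair hab, hq, hZ]
        exact CharTwo.add_self_eq_zero _
  -- `c`, corrected on the half-edges that point backwards, is invariant along subdivision paths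
  have key := S.apply_m_flip (g := fun h => c h + if (S.q h).2 then Z (S.q h) else 0) (fun h => by
      rw [(hc h).1, S.q_flip, hZ]
      obtain ⟨f, b⟩ := S.q h
      cases b <;> simp [flip_apply]
      rw [add_assoc, CharTwo.add_self_eq_zero, add_zero])
    (fun h h' hv he => S.eq_of_inner (g := fun h => c h + if (S.q h).2 then Z (S.q h) else 0)
      (fun a b hab hq hall => by
        have e := (hc a).2
        rw [hρ.apply_eq_of_pair hab hall] at e
        rw [e, hq, hZ]
        obtain ⟨f, b⟩ := S.q a
        cases b <;> simp [flip_apply]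
        rw [add_assoc, CharTwo.add_self_eq_zero, add_zero]) hv he)
  refine ⟨fun k => c (S.m k), fun k => ⟨?_, ?_⟩⟩
  · have := key k
    beta_reduce at this
    rw [S.q_m, S.q_m, hZ] at this
    beta_reduce
    obtain ⟨f, b⟩ := k
    cases b <;> simp [flip_apply] at this ⊢
    · grind
    · exact this
  · beta_reduce
    rw [m_push, (hc _).2, S.q_m]

/-- At the inner vertices of the subdivision paths there is only one rotator, so a rotation system
is determined by its rotators at the branch vertices. -/
theorem eq_of_push_eq (h : S.push hρ = S.push hρ') : ρ = ρ' := by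
  refine Equiv.ext fun a => ?_
  by_cases ha : L.vert a ∈ Set.range S.φ
  · rw [← S.m_q a ha, ← S.m_push hρ, ← S.m_push hρ', h]
  · obtain ⟨h, h', hne, -, hall⟩ := S.inner _ ha
    have hall' : ∀ b, L.vert b = L.vert a ↔ b = h' ∨ b = h := fun b => by rw [hall, or_comm]
    rcases (hall a).1 rfl with rfl | rfl
    · rw [hρ.apply_eq_of_pair hne hall, hρ'.apply_eq_of_pair hne hall]
    · rw [hρ.apply_eq_of_pair hne.symm hall', hρ'.apply_eq_of_pair hne.symm hall']

theorem ncard_inner {v : V} (hv : v ∉ Set.range S.φ) : {h | L.vert h = v}.ncard = 2 := by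
  obtain ⟨a, b, hab, -, hall⟩ := S.inner v hv
  have : {h | L.vert h = v} = {a, b} := by
    ext h
    simp [hall]
  rw [this, Set.ncard_pair hab]

theorem ncard_branch (w : W) : {h | L.vert h = S.φ w}.ncard = {k | H.vert k = w}.ncard := by
  have : {h | L.vert h = S.φ w} = S.m '' {k | H.vert k = w} := by
    ext h
    constructor
    · intro hh
      exact ⟨S.q h, S.φ_inj (by rw [S.φ_vert_q ⟨w, hh.symm⟩]; exact hh), S.m_q h ⟨w, hh.symm⟩⟩
    · rintro ⟨k, hk, rfl⟩
      rw [← (show H.vert k = w from hk)]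
      exact S.vert_m k
  rw [this, Set.ncard_image_of_injective _ S.m_injective]

/-- A planar rotation system of a graph is transferred to a subdivision of it. -/
theorem exists_lift [Finite E] [Finite F] {σ : Perm (F × Bool)} (hσ : H.IsRotationSystem σ)
    (hJ : JordanProperty (flip F) σ) :
    ∃ ρ : Perm (E × Bool), L.IsRotationSystem ρ ∧ JordanProperty (flip E) ρ ∧
      ∀ k, ρ (S.m k) = S.m (σ k) := by
  classical
  have hother : ∀ h : E × Bool, ∃ h', L.vert h ∉ Set.range S.φ → h ≠ h' ∧ S.q h' = flip F (S.q h) ∧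
      ∀ a, L.vert a = L.vert h ↔ a = h ∨ a = h' := by
    intro h
    by_cases hv : L.vert h ∈ Set.range S.φ
    · exact ⟨h, fun h' => absurd hv h'⟩
    obtain ⟨a, b, hab, hq, hall⟩ := S.inner _ hv
    rcases (hall h).1 rfl with rfl | rfl
    · exact ⟨b, fun _ => ⟨hab, hq, hall⟩⟩
    · exact ⟨a, fun _ => ⟨hab.symm, by rw [hq, flip_flip], fun c => by rw [hall, or_comm]⟩⟩
  choose o ho using hother
  have hvo : ∀ h, L.vert h ∉ Set.range S.φ → L.vert (o h) = L.vert h := fun h hv =>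
    ((ho h hv).2.2 _).2 (Or.inr rfl)
  have hoo : ∀ h, L.vert h ∉ Set.range S.φ → o (o h) = h := fun h hv => by
    have hv' : L.vert (o h) ∉ Set.range S.φ := by rwa [hvo h hv]
    have h1 := (ho (o h) hv').2.2 h
    rw [hvo h hv] at h1
    exact ((h1.1 rfl).resolve_left (ho h hv).1).symm
  have hms : ∀ (σ : Perm (F × Bool)), H.IsRotationSystem σ → ∀ h, L.vert h ∈ Set.range S.φ →
      L.vert (S.m (σ (S.q h))) = L.vert h := fun σ hσ h hv => by
    rw [S.vert_m, hσ.vert_apply, S.φ_vert_q hv]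
  let f : Perm (F × Bool) → E × Bool → E × Bool := fun σ h =>
    if L.vert h ∈ Set.range S.φ then S.m (σ (S.q h)) else o h
  have hf : ∀ (σ : Perm (F × Bool)), H.IsRotationSystem σ → ∀ h, f σ⁻¹ (f σ h) = h := by
    intro σ hσ h
    by_cases hv : L.vert h ∈ Set.range S.φ
    · have hv' : L.vert (S.m (σ (S.q h))) ∈ Set.range S.φ := S.vert_m_mem _
      simp only [f, if_pos hv, if_pos hv', S.q_m]
      simpa using S.m_q h hv
    · have hv' : L.vert (o h) ∉ Set.range S.φ := by rwa [hvo h hv]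
      simp only [f, if_neg hv, if_neg hv', hoo h hv]
  let ρ : Perm (E × Bool) := ⟨f σ, f σ⁻¹, hf σ hσ, fun h => by simpa using hf σ⁻¹ hσ.inv h⟩
  have hb : ∀ h, L.vert h ∈ Set.range S.φ → ρ h = S.m (σ (S.q h)) := fun h hv => if_pos hv
  have hi : ∀ h, L.vert h ∉ Set.range S.φ → ρ h = o h := fun h hv => if_neg hv
  refine ⟨ρ, fun v => ?_, fun Z y hZ hy => ?_, fun k => ?_⟩
  · by_cases hv : v ∈ Set.range S.φ
    · obtain ⟨w, rfl⟩ := hv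
      refine isCycleOn_of_semiconj (hσ w) S.q ?_ ?_ ?_ ?_
      · intro h hh h' hh' e
        rw [← S.m_q h ⟨w, hh.symm⟩, e, S.m_q h' ⟨w, hh'.symm⟩]
      · intro h hh
        exact S.φ_inj (by rw [S.φ_vert_q ⟨w, hh.symm⟩]; exact hh)
      · intro h hh
        have hv : L.vert h ∈ Set.range S.φ := ⟨w, hh.symm⟩
        have := hms σ hσ h hv
        rw [← hb h hv] at this
        exact this.trans hh
      · intro h hh
        rw [hb h ⟨w, hh.symm⟩, S.q_m]
    · refine ⟨⟨fun h hh => ?_, ρ.injective.injOn, fun h hh => ?_⟩, fun h hh h' hh' => ?_⟩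
      · have hh : L.vert h = v := hh
        rw [← hh] at hv
        rw [hi h hv]
        exact (hvo h hv).trans hh
      · have hh : L.vert h = v := hh
        rw [← hh] at hv
        exact ⟨o h, (hvo h hv).trans hh, by rw [hi _ (by rwa [hvo h hv]), hoo h hv]⟩
      · have hh : L.vert h = v := hh
        have hh' : L.vert h' = v := hh'
        rw [← hh] at hv
        rcases ((ho h hv).2.2 h').1 (hh'.trans hh.symm) with rfl | rfl
        · exact Perm.SameCycle.refl _ _
        · exact ⟨1, by rw [zpow_one, hi h hv]⟩
  · have hZin : ∀ h h', L.vert h ∉ Set.range S.φ → L.vert h = L.vert h' → Z h = Z h' := by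
      intro h h' hv he
      rcases ((ho h hv).2.2 h').1 he.symm with rfl | rfl
      · rfl
      · have h1 := hy h
        have h2 := hy (o h)
        rw [hi _ (by rwa [hvo h hv]), hoo h hv] at h2
        rw [hi h hv] at h1
        rw [h1] at h2
        grind
    have hZm := S.conn Z hZ hZin
    obtain ⟨c, hc⟩ := hJ (fun k => Z (S.m k)) (fun k => y (S.m k))
      (fun k => S.apply_m_flip hZ hZin k) (fun k => by
        have := hy (S.m k)
        rw [hb _ (S.vert_m_mem k), S.q_m] at this
        exact this)
    refine ⟨fun h => c (S.q h), fun h => ⟨?_, ?_⟩⟩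
    · beta_reduce
      rw [S.q_flip, (hc _).1, hZm]
    · beta_reduce
      by_cases hv : L.vert h ∈ Set.range S.φ
      · rw [hb h hv, S.q_m, (hc _).2, hZm]
      · rw [hi h hv, (ho h hv).2.1, (hc _).1, hZm]
  · rw [hb _ (S.vert_m_mem k), S.q_m]

end SubdivisionMap

end MultiGraph

/-! ### Planar rotation systems of almost 3-connected graphs -/

namespace MultiGraph

variable {V E W F : Type*} {L : MultiGraph V E} {H : MultiGraph W F}

theorem exists_half_notMem [Finite E] {v : V} (hv : 3 ≤ {h | L.vert h = v}.ncard)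
    (s : Finset (E × Bool)) (hs : s.card ≤ 2) : ∃ h ∉ s, L.vert h = v := by
  by_contra! hcon
  have hsub : {h | L.vert h = v} ⊆ (s : Set (E × Bool)) := by
    intro h hh
    by_contra hhs
    exact hcon h hhs hh
  have := Set.ncard_le_ncard hsub
  rw [Set.ncard_coe_finset] at this
  omega

/-- At a vertex with at most two half-edges there is only one rotator. -/
theorem IsRotationSystem.apply_eq_of_ncard_le_two [Finite E] {ρ ρ' : Perm (E × Bool)}
    (hρ : L.IsRotationSystem ρ) (hρ' : L.IsRotationSystem ρ') {h : E × Bool}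
    (hv : {k | L.vert k = L.vert h}.ncard ≤ 2) : ρ' h = ρ h := by
  classical
  by_contra hne
  have hvρ := hρ.vert_apply h
  have hvρ' := hρ'.vert_apply h
  by_cases h1 : ρ h = h
  · exact hne ((hρ.eq_of_apply_eq hvρ' h1).trans h1.symm)
  by_cases h2 : ρ' h = h
  · exact hne (h2.trans (hρ'.eq_of_apply_eq hvρ h2).symm)
  have hsub : (({h, ρ h, ρ' h} : Finset (E × Bool)) : Set (E × Bool)) ⊆
      {k | L.vert k = L.vert h} := by
    intro k hk
    simp only [Finset.coe_insert, Finset.coe_singleton, Set.mem_insert_iff,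
      Set.mem_singleton_iff] at hk
    rcases hk with rfl | rfl | rfl
    · rfl
    · exact hvρ
    · exact hvρ'
  have := Set.ncard_le_ncard hsub
  rw [Set.ncard_coe_finset, Finset.card_eq_three.2
    ⟨h, ρ h, ρ' h, Ne.symm h1, Ne.symm h2, fun e => hne e.symm, rfl⟩] at this
  omega

/-- At a vertex with at most three half-edges there are at most two rotators, which are
reverse to each other. -/
theorem IsRotationSystem.rotation_at_of_ncard_le_three [Finite E] {ρ ρ' : Perm (E × Bool)}
    (hρ : L.IsRotationSystem ρ) (hρ' : L.IsRotationSystem ρ') {v : V}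
    (hv : {k | L.vert k = v}.ncard ≤ 3) :
    (∀ h, L.vert h = v → ρ' h = ρ h) ∨ ∀ h, L.vert h = v → ρ' h = ρ⁻¹ h := by
  classical
  by_cases h2 : {k | L.vert k = v}.ncard ≤ 2
  · left
    rintro h rfl
    exact hρ.apply_eq_of_ncard_le_two hρ' h2
  have hdeg := exists_half_notMem (L := L) (v := v) (by omega)
  refine hρ.rotation_at_of_apply_or hρ' hdeg fun h hh => ?_
  by_contra! hcon
  have hn1 : ∀ {σ : Perm (E × Bool)}, L.IsRotationSystem σ → σ h ≠ h := by
    intro σ hσ e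
    obtain ⟨k, hk, hkv⟩ := hdeg {h} (by simp)
    exact hk (by simp [hσ.eq_of_apply_eq (hkv.trans hh.symm) e])
  have hn2 : ρ h ≠ ρ⁻¹ h := by
    intro e
    obtain ⟨k, hk, hkv⟩ := hdeg {h, ρ h} Finset.card_le_two
    have := hρ.eq_or_eq_of_apply_apply_eq (hkv.trans hh.symm) (by rw [e]; simp)
    exact hk (by simpa using this)
  have hsub : (({h, ρ h, ρ⁻¹ h, ρ' h} : Finset (E × Bool)) : Set (E × Bool)) ⊆
      {k | L.vert k = v} := by
    intro k hk
    simp only [Finset.coe_insert, Finset.coe_singleton, Set.mem_insert_iff,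
      Set.mem_singleton_iff] at hk
    rcases hk with rfl | rfl | rfl | rfl
    · exact hh
    · exact (hρ.vert_apply h).trans hh
    · exact (hρ.inv.vert_apply h).trans hh
    · exact (hρ'.vert_apply h).trans hh
  have hcard : ({h, ρ h, ρ⁻¹ h, ρ' h} : Finset (E × Bool)).card = 4 := by
    rw [Finset.card_insert_of_notMem, Finset.card_eq_three.2
      ⟨ρ h, ρ⁻¹ h, ρ' h, hn2, hcon.1.symm, hcon.2.symm, rfl⟩]
    simp only [Finset.mem_insert, Finset.mem_singleton, not_or]
    exact ⟨(hn1 hρ).symm, (hn1 hρ.inv).symm, (hn1 hρ').symm⟩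
  have := Set.ncard_le_ncard hsub
  rw [Set.ncard_coe_finset, hcard] at this
  omega

/-- A graph with at most one vertex of degree three and all other degrees at most two has only one
rotation system up to reversal. -/
theorem IsRotationSystem.eq_or_eq_inv_of_ncard_le [Finite E] {ρ ρ' : Perm (E × Bool)}
    (hρ : L.IsRotationSystem ρ) (hρ' : L.IsRotationSystem ρ') (v : V)
    (hv : {k | L.vert k = v}.ncard ≤ 3) (hw : ∀ w, w ≠ v → {k | L.vert k = w}.ncard ≤ 2) :
    ρ' = ρ ∨ ρ' = ρ⁻¹ := by
  refine (hρ.rotation_at_of_ncard_le_three hρ' hv).imp (fun h => ?_) fun h => ?_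
  · refine Equiv.ext fun k => ?_
    by_cases hk : L.vert k = v
    · exact h k hk
    · exact hρ.apply_eq_of_ncard_le_two hρ' (hw _ hk)
  · refine Equiv.ext fun k => ?_
    by_cases hk : L.vert k = v
    · exact h k hk
    · exact hρ.inv.apply_eq_of_ncard_le_two hρ' (hw _ hk)

theorem SubdivisionMap.eq_or_eq_inv_of_ncard_le [Finite E] (S : SubdivisionMap L H)
    {ρ ρ' : Perm (E × Bool)} (hρ : L.IsRotationSystem ρ) (hρ' : L.IsRotationSystem ρ') (v : W)
    (hv : {k | H.vert k = v}.ncard ≤ 3) (hw : ∀ w, w ≠ v → {k | H.vert k = w}.ncard ≤ 2) :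
    ρ' = ρ ∨ ρ' = ρ⁻¹ := by
  refine hρ.eq_or_eq_inv_of_ncard_le hρ' (S.φ v) (by rwa [S.ncard_branch]) fun w hwv => ?_
  by_cases hwr : w ∈ Set.range S.φ
  · obtain ⟨w, rfl⟩ := hwr
    rw [S.ncard_branch]
    exact hw w fun e => hwv (e ▸ rfl)
  · rw [S.ncard_inner hwr]

theorem ncard_bond (k : ℕ) (b : Bool) : {h | (bond k).vert h = b}.ncard = k := by
  have : {h | (bond k).vert h = b} = (fun i : Fin k => (i, b)) '' Set.univ := by
    ext ⟨i, b'⟩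
    simp [vert, bond, eq_comm]
  rw [this, Set.ncard_image_of_injective _ fun i j e => (Prod.ext_iff.1 e).1, Set.ncard_univ]
  simp

theorem ncard_threeStar_le (w : Fin 4) :
    {h | threeStar.vert h = w}.ncard ≤ if w = 0 then 3 else 2 := by
  have : {h | threeStar.vert h = w} = (({h | (if h.2 then h.1.succ else 0) = w} :
      Finset (Fin 3 × Bool)) : Set (Fin 3 × Bool)) := by
    ext h
    simp [vert, threeStar]
  rw [this, Set.ncard_coe_finset]
  clear this
  revert w
  decide

theorem ncard_lollipop_le (w : Fin 3) :
    {h | lollipop.vert h = w}.ncard ≤ if w = 1 then 3 else 2 := by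
  have : {h | lollipop.vert h = w} = (({h | lollipop.ends h.1 h.2 = w} :
      Finset (Fin 3 × Bool)) : Set (Fin 3 × Bool)) := by
    ext h
    simp [vert]
  rw [this, Set.ncard_coe_finset]
  clear this
  revert w
  decide

/-- Links that are neither subdivisions of 3-connected graphs nor thick parallel graphs have, up to
reversal, only one rotation system. -/
theorem IsRotationSystem.eq_or_eq_inv_of_isAlmostThreeConnected [Finite E] (hL : L.IsSimple)
    (h : L.toSimpleGraph.IsAlmostThreeConnected)
    (h1 : ¬ L.toSimpleGraph.IsSubdivisionOfThreeConnected)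
    (h2 : ¬ L.toSimpleGraph.IsThickParallelGraph)
    {ρ ρ' : Perm (E × Bool)} (hρ : L.IsRotationSystem ρ) (hρ' : L.IsRotationSystem ρ') :
    ρ' = ρ ∨ ρ' = ρ⁻¹ := by
  have hbond : ∀ k, k ≤ 2 → L.toSimpleGraph.IsSubdivisionOf (bond k) → ρ' = ρ ∨ ρ' = ρ⁻¹ := by
    intro k hk hs
    obtain ⟨S⟩ := nonempty_subdivisionMap hL (by simp [bond]) hs
    exact S.eq_or_eq_inv_of_ncard_le hρ hρ' true (by rw [ncard_bond]; omega)
      fun w _ => by rw [ncard_bond]; exact hk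
  rcases h with h | ⟨k, hk⟩ | h | h | h
  · exact absurd h h1
  · refine hbond k ?_ hk
    by_contra hk2
    exact h2 ⟨k, by omega, hk⟩
  · obtain ⟨S⟩ := nonempty_subdivisionMap hL (by
      intro f
      simpa [threeStar] using (Fin.succ_ne_zero f).symm) h
    exact S.eq_or_eq_inv_of_ncard_le hρ hρ' 0 (ncard_threeStar_le 0)
      fun w hw => (ncard_threeStar_le w).trans (by simp [hw])
  · exact hbond 1 (by omega) h
  · obtain ⟨S⟩ := nonempty_subdivisionMap hL (by
      intro f
      fin_cases f <;> simp [lollipop]) h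
    exact S.eq_or_eq_inv_of_ncard_le hρ hρ' 1 (ncard_lollipop_le 1)
      fun w hw => (ncard_lollipop_le w).trans (by simp [hw])

/-- A subdivision of a 3-connected graph has at most one planar rotation system, up to reversal. -/
theorem IsRotationSystem.eq_or_eq_inv_of_isSubdivisionOfThreeConnected [Finite E] (hL : L.IsSimple)
    (h : L.toSimpleGraph.IsSubdivisionOfThreeConnected) {ρ ρ' : Perm (E × Bool)}
    (hρ : L.IsRotationSystem ρ) (hJ : JordanProperty (flip E) ρ)
    (hρ' : L.IsRotationSystem ρ') (hJ' : JordanProperty (flip E) ρ') : ρ' = ρ ∨ ρ' = ρ⁻¹ := by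
  obtain ⟨n, m, H, hH, hs⟩ := h
  obtain ⟨S⟩ := nonempty_subdivisionMap hL hH.1.1 hs
  refine (hH.eq_or_eq_inv (S.push_isRotationSystem hρ) (S.push_jordanProperty hρ hJ)
    (S.push_isRotationSystem hρ') (S.push_jordanProperty hρ' hJ')).imp (fun e => ?_) fun e => ?_
  · exact S.eq_of_push_eq hρ' hρ e
  · rw [← S.push_inv] at e
    exact S.eq_of_push_eq hρ' hρ.inv e

/-- In a planar rotation system of parallel edges the two rotators are reverse to each other. -/
theorem bond_apply_of_jordanProperty {k : ℕ} {σ : Perm (Fin k × Bool)}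
    (hσ : (bond k).IsRotationSystem σ) (hJ : JordanProperty (flip (Fin k)) σ) {b : Bool} {i j : Fin k}
    (hij : σ (i, b) = (j, b)) : σ (j, !b) = (i, !b) := by
  classical
  obtain ⟨l, hl⟩ : ∃ l, σ (j, !b) = (l, !b) := ⟨(σ (j, !b)).1, Prod.ext rfl (hσ.vert_apply (j, !b))⟩
  rw [hl]
  by_contra hne
  have hli : l ≠ i := fun e => hne (by rw [e])
  have hji : j ≠ i := by
    rintro rfl
    exact hli (Prod.ext_iff.1 (hσ.eq_of_apply_eq (h := (j, b)) (h' := (l, b)) rfl hij)).1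
  have hjl : j ≠ l := by
    rintro rfl
    exact hji (Prod.ext_iff.1 (hσ.eq_of_apply_eq (h := (j, !b)) (h' := (i, !b)) rfl hl)).1.symm
  obtain ⟨c, hc⟩ := exists_colouring hσ hJ
    (Z := fun h => (pointMass (i, b) h + pointMass (i, !b) h) +
      (pointMass (l, b) h + pointMass (l, !b) h))
    (fun h => by
      simp only [pointMass_flip]
      simp only [flip_apply, Bool.not_not]
      ring)
    (fun v => by
      simp only [Finset.sum_add_distrib, sum_vert_pointMass]
      exact CharTwo.add_self_eq_zero _)
  have hb : ∀ {x y : Fin k} {b'}, (x, b') ≠ (y, !b') := by simp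
  have hx : ∀ {x y : Fin k} {b' : Bool}, x ≠ y → (x, b') ≠ (y, b') := by simp
  have e1 := (hc (i, b)).2
  rw [hij, pointMass_self, pointMass_of_ne hb, pointMass_of_ne (hx hli.symm),
    pointMass_of_ne hb] at e1
  have e2 := (hc (j, b)).1
  rw [pointMass_of_ne (hx hji), pointMass_of_ne hb, pointMass_of_ne (hx hjl),
    pointMass_of_ne hb] at e2
  have hb' : ∀ {x y : Fin k} {b'}, (x, !b') ≠ (y, b') := by simp
  have e3 := (hc (j, !b)).2
  rw [hl, pointMass_of_ne (hx hji), pointMass_of_ne hb', pointMass_of_ne (hx hjl),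
    pointMass_of_ne hb'] at e3
  have e4 := (hc (l, b)).1
  rw [pointMass_self, pointMass_of_ne hb, pointMass_of_ne (hx hli),
    pointMass_of_ne hb] at e4
  have e5 := ((hσ b).2 (x := (i, b)) (y := (l, b)) rfl rfl).potential_eq_add_one (hx hli.symm)
    (N := {h | (bond k).vert h = b}) (fun h hh => (hσ.vert_apply h).trans hh) rfl (c := c)
    (fun h hh => by
      have hh : h.2 = b := hh
      rw [(hc h).2, pointMass_of_ne (a := (i, !b)), pointMass_of_ne (a := (l, !b))]
      · ring
      · rintro rfl
        simp at hh
      · rintro rfl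
        simp at hh)
  rw [flip_apply] at e2 e4
  simp only at e2 e4
  grind

/-- Parallel edges have a planar rotation system with any prescribed rotator at one end; the rotator
at the other end is its inverse. -/
theorem exists_bond_rotation {k : ℕ} (π : Perm (Fin k)) (hπ : π.IsCycleOn Set.univ) (b₀ : Bool) :
    ∃ σ : Perm (Fin k × Bool), (bond k).IsRotationSystem σ ∧ JordanProperty (flip (Fin k)) σ ∧
      ∀ i, σ (i, b₀) = (π i, b₀) := by
  let σ : Perm (Fin k × Bool) :=
    { toFun := fun h => (if h.2 = b₀ then π h.1 else π⁻¹ h.1, h.2)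
      invFun := fun h => (if h.2 = b₀ then π⁻¹ h.1 else π h.1, h.2)
      left_inv := fun h => by
        by_cases hb : h.2 = b₀ <;> simp [hb, Prod.ext_iff]
      right_inv := fun h => by
        by_cases hb : h.2 = b₀ <;> simp [hb, Prod.ext_iff] }
  have h0 : ∀ i, σ (i, b₀) = (π i, b₀) := fun i => by simp [σ]
  have h1 : ∀ i, σ (i, !b₀) = (π⁻¹ i, !b₀) := fun i => by simp [σ]
  refine ⟨σ, fun b => ?_, fun Z y hZ hy => ?_, h0⟩
  · have hb : b = b₀ ∨ b = !b₀ := by cases b <;> cases b₀ <;> simp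
    have hinj : Set.InjOn Prod.fst {h | (bond k).vert h = b} := by
      rintro ⟨i, b1⟩ hi ⟨j, b2⟩ hj e
      exact Prod.ext e (hi.trans hj.symm)
    have hmap : ∀ h ∈ {h | (bond k).vert h = b}, σ h ∈ {h | (bond k).vert h = b} := fun h hh => hh
    rcases hb with rfl | rfl
    · refine isCycleOn_of_semiconj hπ Prod.fst hinj (fun _ _ => trivial) hmap ?_
      rintro ⟨i, b'⟩ hb'
      obtain rfl : b' = b := hb'
      rw [h0]
    · refine isCycleOn_of_semiconj hπ.inv Prod.fst hinj (fun _ _ => trivial) hmap ?_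
      rintro ⟨i, b'⟩ hb'
      obtain rfl : b' = !b₀ := hb'
      rw [h1]
  · have hZ' : ∀ i, Z (i, !b₀) = Z (i, b₀) := fun i => hZ (i, b₀)
    have hπy : ∀ i, y (π i, b₀) = y (i, b₀) + Z (i, b₀) := fun i => by rw [← h0, hy]
    have hb : ∀ h : Fin k × Bool, h = (h.1, b₀) ∨ h = (h.1, !b₀) := by
      rintro ⟨i, b⟩
      cases b <;> cases b₀ <;> simp
    have hne : (!b₀) ≠ b₀ := by simp
    refine ⟨fun h => if h.2 = b₀ then y (h.1, b₀) else y (π h.1, b₀), fun h => ?_⟩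
    beta_reduce
    rcases hb h with e | e <;> rw [e]
    · rw [h0, flip_apply]
      simp [hπy]
    · rw [h1, flip_apply, hZ']
      simp only [Bool.not_not, if_true, if_neg hne, hπy]
      constructor
      · grind
      · rw [← hπy, show π (π⁻¹ h.1) = h.1 by simp]
        grind

/-- A planar rotation system of a thick parallel graph is determined by its rotator at one branch
vertex. -/
theorem IsRotationSystem.eq_of_isThickParallelGraph [Finite E] (hL : L.IsSimple)
    (h : L.toSimpleGraph.IsThickParallelGraph) {ρ ρ' : Perm (E × Bool)}
    (hρ : L.IsRotationSystem ρ) (hJ : JordanProperty (flip E) ρ)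
    (hρ' : L.IsRotationSystem ρ') (hJ' : JordanProperty (flip E) ρ') {w : V}
    (hw : {h | L.vert h = w}.ncard ≠ 2) (he : ∀ h, L.vert h = w → ρ' h = ρ h) : ρ' = ρ := by
  obtain ⟨k, hk, hs⟩ := h
  obtain ⟨S⟩ := nonempty_subdivisionMap hL (by simp [bond]) hs
  obtain ⟨b, rfl⟩ : w ∈ Set.range S.φ := by
    by_contra hr
    exact hw (S.ncard_inner hr)
  have r1 := S.push_isRotationSystem hρ
  have r2 := S.push_isRotationSystem hρ'
  have j1 := S.push_jordanProperty hρ hJ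
  have j2 := S.push_jordanProperty hρ' hJ'
  have hb : ∀ i, S.push hρ' (i, b) = S.push hρ (i, b) := fun i => by
    rw [S.push_apply, S.push_apply, he _ (S.vert_m (i, b))]
  refine S.eq_of_push_eq hρ' hρ (Equiv.ext ?_)
  rintro ⟨j, b'⟩
  by_cases hbb : b' = b
  · rw [hbb, hb]
  obtain rfl : b' = !b := by cases b <;> cases b' <;> simp_all
  obtain ⟨i, hi⟩ : ∃ i, S.push hρ (i, b) = (j, b) := by
    refine ⟨((S.push hρ)⁻¹ (j, b)).1, ?_⟩
    have : (S.push hρ)⁻¹ (j, b) = (((S.push hρ)⁻¹ (j, b)).1, b) :=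
      Prod.ext rfl (r1.inv.vert_apply (j, b))
    rw [← this]
    simp
  rw [bond_apply_of_jordanProperty r1 j1 hi,
    bond_apply_of_jordanProperty r2 j2 ((hb i).trans hi)]

/-- The rotator at one branch vertex of a thick parallel graph can be prescribed. -/
theorem exists_rotation_of_isThickParallelGraph [Finite E] (hL : L.IsSimple)
    (h : L.toSimpleGraph.IsThickParallelGraph) {w : V} (hw : {h | L.vert h = w}.ncard ≠ 2)
    {π : Perm (E × Bool)} (hπ : π.IsCycleOn {h | L.vert h = w}) :
    ∃ ρ, L.IsRotationSystem ρ ∧ JordanProperty (flip E) ρ ∧ ∀ h, L.vert h = w → ρ h = π h := by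
  obtain ⟨k, hk, hs⟩ := h
  obtain ⟨S⟩ := nonempty_subdivisionMap hL (by simp [bond]) hs
  obtain ⟨b, rfl⟩ : w ∈ Set.range S.φ := by
    by_contra hr
    exact hw (S.ncard_inner hr)
  have hq : ∀ h, L.vert h = S.φ b → ((S.q h).1, b) = S.q h := fun h hh =>
    Prod.ext rfl (S.φ_inj ((S.φ_vert_q ⟨b, hh.symm⟩).trans hh)).symm
  have hm : ∀ i, L.vert (S.m (i, b)) = S.φ b := fun i => S.vert_m (i, b)
  have hπm : ∀ (π : Perm (E × Bool)), π.IsCycleOn {h | L.vert h = S.φ b} → ∀ i,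
      S.m ((S.q (π (S.m (i, b)))).1, b) = π (S.m (i, b)) := fun π hπ i => by
    have := hπ.1.mapsTo (hm i)
    rw [hq _ this, S.m_q _ ⟨b, this.symm⟩]
  let π₀ : Perm (Fin k) :=
    { toFun := fun i => (S.q (π (S.m (i, b)))).1
      invFun := fun i => (S.q (π⁻¹ (S.m (i, b)))).1
      left_inv := fun i => by
        beta_reduce
        rw [hπm π hπ]
        simp [S.q_m]
      right_inv := fun i => by
        beta_reduce
        rw [hπm π⁻¹ hπ.inv]
        simp [S.q_m] }
  have hcyc : π₀.IsCycleOn Set.univ := isCycleOn_of_semiconj hπ (fun i => S.m (i, b))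
    (fun i _ j _ e => (Prod.ext_iff.1 (S.m_injective e)).1) (fun i _ => hm i)
    (fun _ _ => trivial) fun i _ => hπm π hπ i
  obtain ⟨σ, hσ, hJ, hσb⟩ := exists_bond_rotation π₀ hcyc b
  obtain ⟨ρ, hρ, hJρ, hρσ⟩ := S.exists_lift hσ hJ
  refine ⟨ρ, hρ, hJρ, fun h hh => ?_⟩
  have hmq := S.m_q h ⟨b, hh.symm⟩
  rw [← hq h hh] at hmq
  rw [← hmq, hρσ, hσb]
  exact hπm π hπ _

/-- In a parallel graph only the two branch vertices have degree other than two. -/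
theorem exists_branch_of_isThickParallelGraph (hL : L.IsSimple)
    (h : L.toSimpleGraph.IsThickParallelGraph) :
    ∃ x y, ∀ w, {h | L.vert h = w}.ncard ≠ 2 → w = x ∨ w = y := by
  obtain ⟨k, hk, hs⟩ := h
  obtain ⟨S⟩ := nonempty_subdivisionMap hL (by simp [bond]) hs
  refine ⟨S.φ false, S.φ true, fun w hw => ?_⟩
  obtain ⟨b, rfl⟩ : w ∈ Set.range S.φ := by
    by_contra hr
    exact hw (S.ncard_inner hr)
  cases b
  · exact Or.inl rfl
  · exact Or.inr rfl

/-- In a subdivision of a 3-connected graph, and in a parallel graph, all degrees other than two are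
at least three. -/
theorem three_le_ncard_of_ne_two (hL : L.IsSimple)
    (h : L.toSimpleGraph.IsSubdivisionOfThreeConnected ∨ L.toSimpleGraph.IsThickParallelGraph)
    {w : V} (hw : {h | L.vert h = w}.ncard ≠ 2) : 3 ≤ {h | L.vert h = w}.ncard := by
  classical
  rcases h with ⟨n, m, H, hH, hs⟩ | ⟨k, hk, hs⟩
  · obtain ⟨S⟩ := nonempty_subdivisionMap hL hH.1.1 hs
    obtain ⟨b, rfl⟩ : w ∈ Set.range S.φ := by
      by_contra hr
      exact hw (S.ncard_inner hr)
    rw [S.ncard_branch]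
    by_contra hlt
    rw [Set.ncard_eq_toFinset_card'] at hlt
    obtain ⟨h, hh, hb⟩ := hH.exists_half_ne b _ (Nat.lt_succ_iff.1 (not_le.1 hlt))
    exact hh (by simpa using hb)
  · obtain ⟨S⟩ := nonempty_subdivisionMap hL (by simp [bond]) hs
    obtain ⟨b, rfl⟩ : w ∈ Set.range S.φ := by
      by_contra hr
      exact hw (S.ncard_inner hr)
    rw [S.ncard_branch, ncard_bond]
    exact hk

/-- The part of a link off a branch vertex is connected. -/
theorem eq_of_invariant_off [Finite E] (hL : L.IsSimple)
    (h : L.toSimpleGraph.IsSubdivisionOfThreeConnected ∨ L.toSimpleGraph.IsThickParallelGraph)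
    {w : V} (hw : {h | L.vert h = w}.ncard ≠ 2) {g : E × Bool → ZMod 2}
    (hg : ∀ h, g (flip E h) = g h) (hgv : ∀ h h', L.vert h ≠ w → L.vert h = L.vert h' → g h = g h')
    {a b : E × Bool} (ha : L.vert a = w) (hb : L.vert b = w) : g a = g b := by
  -- it is enough to treat the subdivided graph
  have main : ∀ {W F : Type} {H : MultiGraph W F} (S : SubdivisionMap L H),
      (∀ (g : F × Bool → ZMod 2) (w : W), (∀ k, g (flip F k) = g k) →
        (∀ k k', H.vert k ≠ w → H.vert k = H.vert k' → g k = g k') →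
        ∀ k k', H.vert k = w → H.vert k' = w → g k = g k') → g a = g b := by
    intro W F H S hH
    obtain ⟨w, rfl⟩ : w ∈ Set.range S.φ := by
      by_contra hr
      exact hw (S.ncard_inner hr)
    have hin : ∀ h h', L.vert h ∉ Set.range S.φ → L.vert h = L.vert h' → g h = g h' :=
      fun h h' hh => hgv h h' fun e => hh ⟨w, e.symm⟩
    have := hH (fun k => g (S.m k)) w (fun k => S.apply_m_flip hg hin k)
      (fun k k' hk hkk => hgv _ _ (by rw [S.vert_m]; exact fun e => hk (S.φ_inj e))
        (by rw [S.vert_m, S.vert_m, hkk]))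
      (S.q a) (S.q b) (S.φ_inj (by rw [S.φ_vert_q ⟨w, ha.symm⟩, ha]))
      (S.φ_inj (by rw [S.φ_vert_q ⟨w, hb.symm⟩, hb]))
    rwa [S.m_q _ ⟨w, ha.symm⟩, S.m_q _ ⟨w, hb.symm⟩] at this
  rcases h with ⟨n, m, H, hH, hs⟩ | ⟨k, hk, hs⟩
  · obtain ⟨S⟩ := nonempty_subdivisionMap hL hH.1.1 hs
    refine main S fun g w hg hgv k k' hk hk' => ?_
    have hne : ∀ {k}, H.vert k = w → H.vert (flip _ k) ≠ w := fun {k} e => e ▸ hH.1.vert_flip_ne k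
    obtain ⟨p, hp⟩ := hH.exists_walk {w} (by simp) (u := H.vert (flip _ k))
      (v := H.vert (flip _ k')) (by simpa using hne hk) (by simpa using hne hk')
    have hp : w ∉ p.support := hp w (by simp)
    have key : ∀ {u v : Fin n} (p : H.toSimpleGraph.Walk u v), w ∉ p.support → ∀ a b,
        H.vert a = u → H.vert b = v → g a = g b := by
      intro u v p
      induction p with
      | nil =>
        rintro hw a b rfl hb
        exact hgv a b (fun e => hw (by simp [e])) hb.symm
      | @cons u c v hadj p ih =>
        rintro hw a b rfl hb
        obtain ⟨-, h, h1, h2⟩ := toSimpleGraph_adj_iff.1 hadj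
        simp only [SimpleGraph.Walk.support_cons, List.mem_cons, not_or] at hw
        rw [hgv a h (fun e => hw.1 e.symm) h1.symm, ← hg h]
        exact ih hw.2 _ _ h2 hb
    rw [← hg k, ← hg k']
    exact key p hp _ _ rfl rfl
  · obtain ⟨S⟩ := nonempty_subdivisionMap hL (by simp [bond]) hs
    refine main S fun g w hg hgv k k' hk hk' => ?_
    have hk : k.2 = w := hk
    have hk' : k'.2 = w := hk'
    rw [← hg k, ← hg k']
    refine hgv _ _ ?_ ?_
    · change (!k.2) ≠ w
      rw [hk]
      simp
    · change (!k.2) = (!k'.2)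
      rw [hk, hk']

end MultiGraph

theorem Equiv.Perm.IsCycleOn.image_of_semiconj {α β : Type*} {π : Perm α} {π' : Perm β} {T : Set α}
    (hπ : π.IsCycleOn T) (m : α → β) (hm : ∀ k ∈ T, π' (m k) = m (π k)) :
    π'.IsCycleOn (m '' T) := by
  have hm' : ∀ k ∈ T, π'⁻¹ (m k) = m (π⁻¹ k) := fun k hk => by
    obtain ⟨l, hl, rfl⟩ := hπ.1.surjOn hk
    rw [← hm l hl]
    simp
  refine ⟨⟨?_, π'.injective.injOn, ?_⟩, ?_⟩
  · rintro _ ⟨k, hk, rfl⟩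
    exact ⟨π k, hπ.1.mapsTo hk, (hm k hk).symm⟩
  · rintro _ ⟨k, hk, rfl⟩
    obtain ⟨l, hl, rfl⟩ := hπ.1.surjOn hk
    exact ⟨m l, ⟨l, hl, rfl⟩, hm l hl⟩
  · rintro _ ⟨k, hk, rfl⟩ _ ⟨l, hl, rfl⟩
    obtain ⟨n, rfl⟩ := hπ.2 hk hl
    refine ⟨n, ?_⟩
    have key : ∀ n : ℕ, (π' ^ n) (m k) = m ((π ^ n) k) ∧ (π ^ n) k ∈ T := by
      intro n
      induction n with
      | zero => exact ⟨rfl, hk⟩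
      | succ n ih =>
        rw [pow_succ', pow_succ', Perm.mul_apply, Perm.mul_apply, ih.1, hm _ ih.2]
        exact ⟨rfl, hπ.1.mapsTo ih.2⟩
    have key' : ∀ n : ℕ, (π'⁻¹ ^ n) (m k) = m ((π⁻¹ ^ n) k) ∧ (π⁻¹ ^ n) k ∈ T := by
      intro n
      induction n with
      | zero => exact ⟨rfl, hk⟩
      | succ n ih =>
        rw [pow_succ', pow_succ', Perm.mul_apply, Perm.mul_apply, ih.1, hm' _ ih.2]
        exact ⟨rfl, hπ.inv.1.mapsTo ih.2⟩
    obtain ⟨j, rfl | rfl⟩ := n.eq_nat_or_neg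
    · rw [zpow_natCast, zpow_natCast, (key j).1]
    · rw [zpow_neg, zpow_neg, ← inv_zpow, ← inv_zpow, zpow_natCast, zpow_natCast, (key' j).1]

/-! ### The links of a 2-complex as one multigraph -/

namespace TwoComplex

open MultiGraph

variable (C : TwoComplex.{u})

/-- The corners of the faces; the corner given by a dart `d` of the boundary of a face lies at the
end of `d`. -/
abbrev Corner : Type u := (f : C.F) × {d : C.D // d ∈ C.bd f}

open Classical in
/-- The dart that follows the dart of a corner. -/
noncomputable def nextCorner (c : C.Corner) : C.Corner :=
  ⟨c.1, (C.bd c.1).next (C.bd_nodup c.1) c.2.1 c.2.2, Cycle.next_mem _ _ _ _⟩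

open Classical in
/-- The dart that precedes the dart of a corner. -/
noncomputable def prevCorner (c : C.Corner) : C.Corner :=
  ⟨c.1, (C.bd c.1).prev (C.bd_nodup c.1) c.2.1 c.2.2, Cycle.prev_mem _ _ _ _⟩

@[simp] theorem prevCorner_nextCorner (c : C.Corner) : C.prevCorner (C.nextCorner c) = c := by
  obtain ⟨f, d, hd⟩ := c
  simp only [prevCorner, nextCorner, Cycle.prev_next]

@[simp] theorem nextCorner_prevCorner (c : C.Corner) : C.nextCorner (C.prevCorner c) = c := by
  obtain ⟨f, d, hd⟩ := c
  simp only [prevCorner, nextCorner, Cycle.next_prev]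

/-- The disjoint union of all link graphs. Its vertices are the darts, where the dart `d`
belongs to the link graph at its starting vertex. -/
noncomputable def totalLink : MultiGraph C.D C.Corner where
  ends c b := match b with
    | false => C.rev c.2.1
    | true => (C.nextCorner c).2.1

variable {C}

/-- The face to which a half-edge of the links belongs. -/
def cornerFace (h : C.Corner × Bool) : C.F := h.1.1

theorem vert_false (c : C.Corner) : C.totalLink.vert (c, false) = C.rev c.2.1 := rfl

theorem vert_true (c : C.Corner) : C.totalLink.vert (c, true) = (C.nextCorner c).2.1 := rfl

theorem src_vert (h : C.Corner × Bool) : C.src (C.totalLink.vert h) = C.tgt h.1.2.1 := by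
  obtain ⟨c, b⟩ := h
  cases b
  · rfl
  · exact ((C.bd_closed c.1).rel_next (C.bd_nodup c.1) c.2.2).symm

theorem src_vert_flip (h : C.Corner × Bool) :
    C.src (C.totalLink.vert (flip _ h)) = C.src (C.totalLink.vert h) := by
  rw [src_vert, src_vert]
  rfl

theorem incident_vert (h : C.Corner × Bool) : C.Incident (cornerFace h) (C.totalLink.vert h) := by
  obtain ⟨c, b⟩ := h
  cases b
  · right
    rw [vert_false, C.rev_rev]
    exact c.2.2
  · left
    exact (C.nextCorner c).2.2

/-- A half-edge of the links is determined by its face and its dart, since a face traverses no edge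
twice. -/
theorem corner_ext {h h' : C.Corner × Bool} (hf : cornerFace h = cornerFace h')
    (hv : C.totalLink.vert h = C.totalLink.vert h') : h = h' := by
  obtain ⟨⟨f, d, hd⟩, b⟩ := h
  obtain ⟨⟨f', d', hd'⟩, b'⟩ := h'
  obtain rfl : f = f' := hf
  have hrev : Function.Injective C.rev := fun a b e => by rw [← C.rev_rev a, e, C.rev_rev]
  cases b <;> cases b'
  · obtain rfl : d = d' := hrev hv
    rfl
  · exfalso
    have hv : C.rev d = (C.nextCorner ⟨f, d', hd'⟩).2.1 := hv
    exact C.bd_trail f d hd (hv ▸ (C.nextCorner ⟨f, d', hd'⟩).2.2)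
  · exfalso
    have hv : (C.nextCorner ⟨f, d, hd⟩).2.1 = C.rev d' := hv
    exact C.bd_trail f d' hd' (hv ▸ (C.nextCorner ⟨f, d, hd⟩).2.2)
  · have hv : (C.nextCorner ⟨f, d, hd⟩).2.1 = (C.nextCorner ⟨f, d', hd'⟩).2.1 := hv
    have : C.nextCorner ⟨f, d, hd⟩ = C.nextCorner ⟨f, d', hd'⟩ :=
      Sigma.ext rfl (heq_of_eq (Subtype.ext hv))
    rw [← C.prevCorner_nextCorner ⟨f, d, hd⟩, this, C.prevCorner_nextCorner]

theorem exists_corner {f : C.F} {d : C.D} (h : C.Incident f d) :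
    ∃ k, cornerFace k = f ∧ C.totalLink.vert k = d := by
  rcases h with h | h
  · refine ⟨(C.prevCorner ⟨f, d, h⟩, true), rfl, ?_⟩
    rw [vert_true, nextCorner_prevCorner]
  · exact ⟨(⟨f, C.rev d, h⟩, false), rfl, C.rev_rev d⟩

variable (C) in
/-- The involution that moves a half-edge of the links to the other end of its dart, within the same
face. -/
noncomputable def swap : Perm (C.Corner × Bool) where
  toFun h := if h.2 then (C.nextCorner h.1, false) else (C.prevCorner h.1, true)
  invFun h := if h.2 then (C.nextCorner h.1, false) else (C.prevCorner h.1, true)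
  left_inv h := by
    obtain ⟨c, b⟩ := h
    cases b <;> simp
  right_inv h := by
    obtain ⟨c, b⟩ := h
    cases b <;> simp

@[simp] theorem swap_swap (h : C.Corner × Bool) : C.swap (C.swap h) = h := C.swap.left_inv h

theorem swap_true (c : C.Corner) : C.swap (c, true) = (C.nextCorner c, false) := rfl

theorem swap_false (c : C.Corner) : C.swap (c, false) = (C.prevCorner c, true) := rfl

theorem cornerFace_swap (h : C.Corner × Bool) : cornerFace (C.swap h) = cornerFace h := by
  obtain ⟨c, b⟩ := h
  cases b <;> rfl

theorem vert_swap (h : C.Corner × Bool) :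
    C.totalLink.vert (C.swap h) = C.rev (C.totalLink.vert h) := by
  obtain ⟨c, b⟩ := h
  cases b
  · rw [swap_false, vert_true, nextCorner_prevCorner, vert_false, C.rev_rev]
  · rw [swap_true, vert_true, vert_false]

theorem eq_swap {h h' : C.Corner × Bool} (hf : cornerFace h' = cornerFace h)
    (hv : C.totalLink.vert h' = C.rev (C.totalLink.vert h)) : h' = C.swap h :=
  corner_ext (hf.trans (cornerFace_swap h).symm) (hv.trans (vert_swap h).symm)

/-- The inclusion of the half-edges of a link graph in those of all links. -/
def ofLink {v : C.V} (h : C.LinkEdge v × Bool) : C.Corner × Bool := (h.1.1, h.2)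

theorem ofLink_injective {v : C.V} : Function.Injective (ofLink (C := C) (v := v)) := by
  rintro ⟨⟨c, hc⟩, b⟩ ⟨⟨c', hc'⟩, b'⟩ e
  obtain ⟨rfl, rfl⟩ := Prod.ext_iff.1 e
  rfl

theorem ofLink_flip {v : C.V} (h : C.LinkEdge v × Bool) :
    ofLink (MultiGraph.flip _ h) = MultiGraph.flip _ (ofLink h) := rfl

theorem cornerFace_ofLink {v : C.V} (h : C.LinkEdge v × Bool) :
    cornerFace (ofLink h) = face h := rfl

theorem vert_ofLink {v : C.V} (h : C.LinkEdge v × Bool) :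
    C.totalLink.vert (ofLink h) = ((C.link v).vert h).1 := by
  obtain ⟨c, b⟩ := h
  cases b <;> rfl

theorem src_ofLink {v : C.V} (h : C.LinkEdge v × Bool) :
    C.src (C.totalLink.vert (ofLink h)) = v := by
  rw [vert_ofLink]
  exact ((C.link v).vert h).2

theorem exists_ofLink {v : C.V} {k : C.Corner × Bool} (hk : C.src (C.totalLink.vert k) = v) :
    ∃ h : C.LinkEdge v × Bool, ofLink h = k :=
  ⟨(⟨k.1, by rw [← src_vert, hk]⟩, k.2), rfl⟩

/-! ### Rotators at the darts -/

/-- The rotation `r` of the half-edges of all links is planar at the vertex `v`: it has the Jordan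
property there. -/
def PlanarAt (r : Perm (C.Corner × Bool)) (v : C.V) : Prop :=
  ∀ Z y : C.Corner × Bool → ZMod 2, (∀ h, Z (flip _ h) = Z h) → (∀ h, y (r h) = y h + Z h) →
    ∃ c : C.Corner × Bool → ZMod 2, ∀ h, C.src (C.totalLink.vert h) = v →
      c (flip _ h) = c h + Z h ∧ c (r h) = c h + Z h

/-- The Jordan property of the total link can be checked at one vertex of the complex at a time. -/
theorem jordanProperty_iff_planarAt {r : Perm (C.Corner × Bool)}
    (hr : ∀ h, C.src (C.totalLink.vert (r h)) = C.src (C.totalLink.vert h)) :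
    JordanProperty (flip _) r ↔ ∀ v, PlanarAt r v := by
  constructor
  · intro hJ v Z y hZ hy
    obtain ⟨c, hc⟩ := hJ Z y hZ hy
    exact ⟨c, fun h _ => hc h⟩
  · intro h Z y hZ hy
    choose c hc using fun v => h v Z y hZ hy
    refine ⟨fun h => c (C.src (C.totalLink.vert h)) h, fun h => ?_⟩
    beta_reduce
    rw [src_vert_flip, hr]
    exact hc _ h rfl

/-- Restriction of rotators at all darts to a link. -/
theorem exists_link_rotation [Finite C.D] [Finite C.F] {r : Perm (C.Corner × Bool)}
    (hr : C.totalLink.IsRotationSystem r) (v : C.V) :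
    ∃ ρ, (C.link v).IsRotationSystem ρ ∧ ∀ h, ofLink (ρ h) = r (ofLink h) := by
  have hex : ∀ (r : Perm (C.Corner × Bool)), C.totalLink.IsRotationSystem r →
      ∀ h : C.LinkEdge v × Bool, ∃ h' : C.LinkEdge v × Bool, ofLink h' = r (ofLink h) :=
    fun r hr h => exists_ofLink (by rw [hr.vert_apply, src_ofLink])
  choose f hf using hex r hr
  choose g hg using hex r⁻¹ hr.inv
  refine ⟨⟨f, g, fun h => ofLink_injective ?_, fun h => ofLink_injective ?_⟩, fun d => ?_, hf⟩
  · rw [hg, hf]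
    simp
  · rw [hf, hg]
    simp
  · refine isCycleOn_of_semiconj (hr d.1) ofLink ofLink_injective.injOn ?_ ?_ fun k _ => hf k
    · rintro k rfl
      exact vert_ofLink k
    · rintro k rfl
      refine Subtype.ext ?_
      rw [← vert_ofLink]
      change C.totalLink.vert (ofLink (f k)) = _
      rw [hf, hr.vert_apply, vert_ofLink]

/-- Rotation systems of all links are put together. -/
theorem exists_rotation_of_links [Finite C.D] [Finite C.F]
    (ρ : ∀ v, Perm (C.LinkEdge v × Bool)) (hρ : ∀ v, (C.link v).IsRotationSystem (ρ v)) :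
    ∃ r, C.totalLink.IsRotationSystem r ∧ ∀ v h, r (ofLink h) = ofLink (ρ v h) := by
  let f : (∀ v, Perm (C.LinkEdge v × Bool)) → C.Corner × Bool → C.Corner × Bool := fun ρ h =>
    ofLink (ρ (C.tgt h.1.2.1) (⟨h.1, rfl⟩, h.2))
  have hf : ∀ ρ v (h : C.LinkEdge v × Bool), f ρ (ofLink h) = ofLink (ρ v h) := by
    rintro ρ v ⟨⟨c, rfl⟩, b⟩
    rfl
  have hinv : ∀ ρ h, f (fun v => (ρ v)⁻¹) (f ρ h) = h := by
    intro ρ h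
    obtain ⟨k, hk⟩ := exists_ofLink (k := h) rfl
    rw [← hk, hf]
    exact (hf (fun v => (ρ v)⁻¹) _ _).trans (by simp)
  refine ⟨⟨f ρ, f fun v => (ρ v)⁻¹, hinv ρ, fun h => by simpa using hinv (fun v => (ρ v)⁻¹) h⟩,
    fun d => ?_, hf ρ⟩
  have himage : {h | C.totalLink.vert h = d} =
      ofLink '' {k | (C.link (C.src d)).vert k = ⟨d, rfl⟩} := by
    ext h
    constructor
    · intro hh
      have hh : C.totalLink.vert h = d := hh
      obtain ⟨k, rfl⟩ := exists_ofLink (k := h) (v := C.src d) (by rw [hh])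
      exact ⟨k, Subtype.ext (by rw [← vert_ofLink, hh]), rfl⟩
    · rintro ⟨k, hk, rfl⟩
      have hk : (C.link (C.src d)).vert k = ⟨d, rfl⟩ := hk
      rw [Set.mem_ofPred_eq, vert_ofLink, hk]
  rw [himage]
  exact (hρ (C.src d) ⟨d, rfl⟩).image_of_semiconj ofLink fun k _ => hf ρ _ k

/-- Planarity at `v` is the Jordan property of the rotation that is induced on the link at `v`. -/
theorem planarAt_iff [Finite C.D] [Finite C.F] {r : Perm (C.Corner × Bool)}
    (hr : ∀ h, C.src (C.totalLink.vert (r h)) = C.src (C.totalLink.vert h)) {v : C.V}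
    {ρ : Perm (C.LinkEdge v × Bool)} (hρ : ∀ h, ofLink (ρ h) = r (ofLink h)) :
    PlanarAt r v ↔ JordanProperty (flip _) ρ := by
  classical
  have hext : ∀ (g : C.LinkEdge v × Bool → ZMod 2) h, Function.extend ofLink g 0 (ofLink h) = g h :=
    fun g h => ofLink_injective.extend_apply g 0 h
  have hext' : ∀ (g : C.LinkEdge v × Bool → ZMod 2) k, C.src (C.totalLink.vert k) ≠ v →
      Function.extend ofLink g 0 k = 0 := fun g k hk => by
    rw [Function.extend_apply' _ _ _ (by rintro ⟨h, rfl⟩; exact hk (src_ofLink h))]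
    rfl
  constructor
  · intro hP Z y hZ hy
    obtain ⟨c, hc⟩ := hP (Function.extend ofLink Z 0) (Function.extend ofLink y 0) (fun h => by
        by_cases hv : C.src (C.totalLink.vert h) = v
        · obtain ⟨k, rfl⟩ := exists_ofLink hv
          rw [← ofLink_flip, hext, hext, hZ]
        · rw [hext' _ _ hv, hext' _ _ (by rwa [src_vert_flip])]) (fun h => by
        by_cases hv : C.src (C.totalLink.vert h) = v
        · obtain ⟨k, rfl⟩ := exists_ofLink hv
          rw [← hρ, hext, hext, hext, hy]
        · rw [hext' _ _ hv, hext' _ _ hv, hext' _ _ (by rwa [hr]), add_zero])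
    refine ⟨fun h => c (ofLink h), fun h => ?_⟩
    have := hc (ofLink h) (src_ofLink h)
    rw [hext, ← hρ] at this
    exact this
  · intro hJ Z y hZ hy
    obtain ⟨c, hc⟩ := hJ (fun h => Z (ofLink h)) (fun h => y (ofLink h)) (fun h => hZ (ofLink h))
      fun h => by rw [hρ, hy]
    refine ⟨Function.extend ofLink c 0, fun h hv => ?_⟩
    obtain ⟨k, rfl⟩ := exists_ofLink hv
    rw [← ofLink_flip, ← hρ, hext, hext, hext]
    exact hc k

/-- The rotators at a dart and its reverse are reverse to each other. -/
def Opposite (r : Perm (C.Corner × Bool)) (d : C.D) : Prop :=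
  ∀ h, C.totalLink.vert h = d → r (C.swap h) = C.swap (r⁻¹ h)

theorem Opposite.rev {r : Perm (C.Corner × Bool)} (hr : C.totalLink.IsRotationSystem r) {d : C.D}
    (h : Opposite r d) : Opposite r (C.rev d) := by
  intro k hk
  obtain ⟨k, rfl⟩ : ∃ k', k = C.swap k' := ⟨C.swap k, by simp⟩
  rw [vert_swap] at hk
  have hk : C.totalLink.vert k = d := by rw [← C.rev_rev d, ← hk, C.rev_rev]
  have := h (r k) (by rw [hr.vert_apply, hk])
  rw [show r⁻¹ (r k) = k by simp] at this
  rw [swap_swap, ← this]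
  simp

end TwoComplex

/-! ### Contraction and links -/

open Classical in
/-- If entries of a cyclic sequence are deleted, then every entry can be mapped to the first
remaining entry that follows it (or to itself). -/
theorem Cycle.exists_filterMap_retraction {α β : Type*} {g : α → Option β} {s : Cycle α}
    (hs : s.Nodup) (hs' : (s.filterMap g).Nodup) (hg : ∀ a a' b, g a = some b → g a' = some b → a = a')
    (hne : ∃ a ∈ s, ∃ b, g a = some b) :
    ∃ q : α → β, (∀ a ∈ s, ∀ b, g a = some b → q a = b) ∧
      (∀ a (h : a ∈ s), g a = none → q (s.next hs a h) = q a) ∧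
      (∀ a (h : a ∈ s) b (hb : b ∈ s.filterMap g), g a = some b →
        q (s.next hs a h) = (s.filterMap g).next hs' b hb) ∧
      ∀ φ : α → ZMod 2, (∀ x (h : x ∈ s), g x = none → φ (s.next hs x h) = φ x) →
        ∀ a ∈ s, ∀ a' ∈ s, g a' = some (q a) → φ a = φ a' := by
  obtain ⟨a₀, ha₀, b₀, hb₀⟩ := hne
  obtain ⟨l, hl⟩ := Cycle.exists_eq_cons ha₀
  obtain ⟨L, hL⟩ : ∃ L : List α, L = a₀ :: l := ⟨_, rfl⟩
  rw [← hL] at hl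
  subst hl
  have hL0 : ∀ (h : 0 < L.length), L[0] = a₀ := fun h => by simp [hL]
  have hlen : 0 < L.length := by simp [hL]
  have hfm : ∃ M, L.filterMap g = b₀ :: M := by
    rw [hL, List.filterMap_cons_some hb₀]
    exact ⟨_, rfl⟩
  clear hL ha₀
  have hnd : L.Nodup := hs
  have hnd' : (L.filterMap g).Nodup := hs'
  let hv : List α → β := fun M => ((M.filterMap g).head?).getD b₀
  have hvnone : ∀ i (hi : i < L.length), g L[i] = none → hv (L.drop i) = hv (L.drop (i + 1)) := by
    intro i hi h
    simp only [hv]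
    rw [List.drop_eq_getElem_cons hi, List.filterMap_cons_none h]
  have hvsome : ∀ i (hi : i < L.length) b, g L[i] = some b → hv (L.drop i) = b := by
    intro i hi b h
    simp only [hv]
    rw [List.drop_eq_getElem_cons hi, List.filterMap_cons_some h]
    rfl
  have hnext : ∀ i (hi : i < L.length) (h : L[i] ∈ L),
      List.next L L[i] h = L[(i + 1) % L.length]'(Nat.mod_lt _ hlen) := fun i hi h =>
    List.next_getElem L hnd i hi
  let q : α → β := fun x => hv (L.drop (L.idxOf x))
  have hq : ∀ i (hi : i < L.length), q L[i] = hv (L.drop i) := fun i hi => by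
    simp only [q]
    rw [hnd.idxOf_getElem i hi]
  have hqnext : ∀ i (hi : i < L.length),
      q (L[(i + 1) % L.length]'(Nat.mod_lt _ hlen)) = hv (L.drop (i + 1)) := by
    intro i hi
    rw [hq]
    rcases Nat.lt_or_ge (i + 1) L.length with h | h
    · rw [Nat.mod_eq_of_lt h]
    · have e : i + 1 = L.length := by omega
      rw [e, Nat.mod_self, List.drop_length]
      rw [hvsome 0 hlen b₀ (by rw [hL0]; exact hb₀)]
      rfl
  refine ⟨q, fun a ha b hb => ?_, fun a ha hb => ?_, fun a ha b hb' hb => ?_, fun φ hφ => ?_⟩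
  · obtain ⟨i, hi, rfl⟩ := List.getElem_of_mem ha
    rw [hq, hvsome i hi b hb]
  · obtain ⟨i, hi, rfl⟩ := List.getElem_of_mem ha
    refine (congrArg q (hnext i hi ha)).trans ?_
    rw [hqnext i hi, hq, hvnone i hi hb]
  · obtain ⟨i, hi, rfl⟩ := List.getElem_of_mem ha
    refine (congrArg q (hnext i hi ha)).trans ?_
    change _ = List.next (L.filterMap g) b hb'
    rw [hqnext i hi]
    obtain ⟨M, hM⟩ := hfm
    have hsplit : L.filterMap g = (L.take i).filterMap g ++ b :: (L.drop (i + 1)).filterMap g := by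
      conv_lhs => rw [← List.take_append_drop i L, List.filterMap_append,
        List.drop_eq_getElem_cons hi, List.filterMap_cons_some hb]
    set A := (L.take i).filterMap g with hA
    have hbA : A.length < (L.filterMap g).length := by rw [hsplit]; simp
    have eb : (L.filterMap g)[A.length] = b := by
      simp only [hsplit]
      simp
    have hn := List.next_getElem (L.filterMap g) hnd' A.length hbA
    simp only [eb] at hn
    rw [hn]
    simp only [hv]
    cases hB : (L.drop (i + 1)).filterMap g with
    | nil =>
      have e : (L.filterMap g).length = A.length + 1 := by rw [hsplit, hB]; simp
      simp only [e, Nat.mod_self, List.head?_nil, Option.getD_none]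
      simp [hM]
    | cons b' B =>
      have e : A.length + 1 < (L.filterMap g).length := by rw [hsplit, hB]; simp
      simp only [Nat.mod_eq_of_lt e, List.head?_cons, Option.getD_some]
      simp [hsplit, hB]
  · have key : ∀ j i, i + j = L.length → ∀ a' ∈ L, g a' = some (hv (L.drop i)) →
        φ (L[i % L.length]'(Nat.mod_lt _ hlen)) = φ a' := by
      intro j
      induction j with
      | zero =>
        intro i hi a' ha' hga'
        obtain rfl : i = L.length := by omega
        rw [List.drop_length] at hga'
        simp only [Nat.mod_self]
        rw [hL0]
        rw [hg a₀ a' b₀ hb₀ hga']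
      | succ j ih =>
        intro i hi a' ha' hga'
        have hi' : i < L.length := by omega
        simp only [Nat.mod_eq_of_lt hi']
        cases hgi : g L[i] with
        | none =>
          rw [← ih (i + 1) (by omega) a' ha' (by rw [← hvnone i hi' hgi]; exact hga')]
          have := hφ L[i] (List.getElem_mem hi') hgi
          rw [← this]
          exact congrArg φ (hnext i hi' (List.getElem_mem hi'))
        | some b =>
          rw [hvsome i hi' b hgi] at hga'
          rw [hg _ _ b hgi hga']
    intro a ha a' ha' hga'
    obtain ⟨i, hi, rfl⟩ := List.getElem_of_mem ha
    rw [hq i hi] at hga'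
    have := key (L.length - i) i (by omega) a' ha' hga'
    simpa only [Nat.mod_eq_of_lt hi] using this

namespace TwoComplex

open MultiGraph

variable {C : TwoComplex.{u}} {S : Set C.D}

theorem mem_bd_contract {f : (C.contract S).F} {d : (C.contract S).D} :
    d ∈ (C.contract S).bd f ↔ d.1 ∈ C.bd f.1 := by
  refine Cycle.mem_filterMap.trans ⟨?_, fun h => ⟨d.1, h, dif_pos d.2⟩⟩
  rintro ⟨a, ha, h⟩
  split_ifs at h with h'
  rw [← Option.some.inj h]
  exact ha

theorem incident_contract {f : (C.contract S).F} {d : (C.contract S).D} :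
    (C.contract S).Incident f d ↔ C.Incident f.1 d.1 :=
  or_congr mem_bd_contract mem_bd_contract

/-- The half-edges of a link of a contraction, as half-edges of the links of the complex. -/
theorem exists_ofContract (v : (C.contract S).V) :
    ∃ J : (C.contract S).LinkEdge v × Bool → C.Corner × Bool,
      Function.Injective J ∧ (∀ k, cornerFace (J k) = (face k).1) ∧
        (∀ k, C.totalLink.vert (J k) = (((C.contract S).link v).vert k).1.1) ∧
        ∀ h, C.totalLink.vert h ∉ S → C.rev (C.totalLink.vert h) ∉ S →
          Quot.mk _ (C.src (C.totalLink.vert h)) = v → ∃ k, J k = h := by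
  have hex : ∀ k : (C.contract S).LinkEdge v × Bool, ∃ h : C.Corner × Bool,
      cornerFace h = (face k).1 ∧ C.totalLink.vert h = (((C.contract S).link v).vert k).1.1 := by
    intro k
    refine exists_corner (incident_contract.1 ?_)
    rw [← vert_ofLink, ← cornerFace_ofLink]
    exact incident_vert _
  choose J hJ1 hJ2 using hex
  refine ⟨J, fun k k' e => ofLink_injective (corner_ext (Subtype.ext ?_) ?_), hJ1, hJ2,
    fun h h1 h2 hv => ?_⟩
  · exact (hJ1 k).symm.trans ((congrArg cornerFace e).trans (hJ1 k'))
  · rw [vert_ofLink, vert_ofLink]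
    refine Subtype.ext ?_
    rw [← hJ2, ← hJ2, e]
  · have hinc := incident_vert h
    have hf : ∃ d ∈ C.bd (cornerFace h), d ∉ S ∧ C.rev d ∉ S := by
      rcases hinc with hi | hi
      · exact ⟨_, hi, h1, h2⟩
      · exact ⟨_, hi, h2, by rwa [C.rev_rev]⟩
    obtain ⟨k, hk1, hk2⟩ := exists_corner (C := C.contract S) (f := ⟨cornerFace h, hf⟩)
      (d := ⟨C.totalLink.vert h, h1, h2⟩) (incident_contract.2 hinc)
    obtain ⟨k, rfl⟩ := exists_ofLink (v := v) (k := k) (by rw [hk2]; exact hv)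
    refine ⟨k, corner_ext ?_ ?_⟩
    · rw [hJ1]
      exact congrArg Subtype.val hk1
    · rw [hJ2, ← vert_ofLink, hk2]

/-- A half-edge of the links given by a face and a dart of its boundary. -/
theorem exists_half (f : C.F) :
    ∃ η : C.D → C.Corner × Bool, ∀ d (hd : d ∈ C.bd f),
      η d = (C.prevCorner ⟨f, d, hd⟩, true) := by
  classical
  have hne : ∀ s : Cycle C.D, s ≠ Cycle.nil → ∃ d, d ∈ s := by
    intro s
    induction s using Quotient.inductionOn' with
    | h l =>
      intro h
      cases l with
      | nil => exact absurd rfl h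
      | cons a l => exact ⟨a, List.mem_cons_self⟩
  obtain ⟨d₀, hd₀⟩ := hne _ (C.bd_ne_nil f)
  exact ⟨fun d => if hd : d ∈ C.bd f then (C.prevCorner ⟨f, d, hd⟩, true)
    else (⟨f, d₀, hd₀⟩, true), fun d hd => dif_pos hd⟩

/-- The retraction of the boundary of a face to the boundary of the contracted face, and how
functions on half-edges behave under it. -/
theorem exists_contract_retraction (hS : ∀ d ∈ S, C.rev d ∈ S) (f : (C.contract S).F) :
    ∃ q : C.D → (C.contract S).D, (∀ d (_ : d ∈ C.bd f.1) (hd : d ∉ S ∧ C.rev d ∉ S), q d = ⟨d, hd⟩) ∧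
      (∀ d (hd : d ∈ C.bd f.1), d ∈ S → q (C.nextCorner ⟨f.1, d, hd⟩).2.1 = q d) ∧
      (∀ (d : (C.contract S).D) (hd : d ∈ (C.contract S).bd f),
        q (C.nextCorner ⟨f.1, d.1, mem_bd_contract.1 hd⟩).2.1 =
          ((C.contract S).nextCorner ⟨f, d, hd⟩).2.1) ∧
      ∀ φ : C.D → ZMod 2, (∀ d (hd : d ∈ C.bd f.1), d ∈ S →
          φ (C.nextCorner ⟨f.1, d, hd⟩).2.1 = φ d) →
        ∀ d ∈ C.bd f.1, ∀ d' ∈ C.bd f.1, d' = (q d).1 → φ d = φ d' := by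
  classical
  have hnone : ∀ d, (if h : d ∉ S ∧ C.rev d ∉ S then some ⟨d, h⟩ else none :
      Option (C.contract S).D) = none ↔ d ∈ S := by
    intro d
    split_ifs with h
    · simp [h.1]
    · simp only [true_iff]
      by_contra hd
      exact h ⟨hd, fun h' => hd (by rw [← C.rev_rev d]; exact hS _ h')⟩
  obtain ⟨q, h1, h2, h3, h4⟩ := Cycle.exists_filterMap_retraction (s := C.bd f.1)
    (g := fun d => if h : d ∉ S ∧ C.rev d ∉ S then some (⟨d, h⟩ : (C.contract S).D) else none)
    (C.bd_nodup f.1) ((C.contract S).bd_nodup f) (fun a a' b hb hb' => by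
      split_ifs at hb hb'
      rw [← Option.some.inj hb'] at hb
      exact congrArg Subtype.val (Option.some.inj hb)) (by
      obtain ⟨d, hd, hdS⟩ := f.2
      exact ⟨d, hd, ⟨d, hdS⟩, dif_pos hdS⟩)
  refine ⟨q, fun d hd hdS => h1 d hd _ (dif_pos hdS), fun d hd hdS => ?_, fun d hd => ?_,
    fun φ hφ d hd d' hd' e => ?_⟩
  · exact h2 d hd ((hnone d).2 hdS)
  · exact h3 d.1 (mem_bd_contract.1 hd) d hd (dif_pos d.2)
  · refine h4 φ (fun x hx hgx => ?_) d hd d' hd' ?_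
    · exact hφ x hx ((hnone x).1 hgx)
    · subst e
      exact dif_pos (q d).2

end TwoComplex

namespace TwoComplex

open MultiGraph

variable {C : TwoComplex.{u}} {S : Set C.D}

/-- Colourings of the contracted link extend to the links at the contracted vertices. Here `r`
exchanges the two ends of the contracted edges, and otherwise is the rotation of the contracted
link. -/
theorem exists_colouring_of_contract (hS : ∀ d ∈ S, C.rev d ∈ S) {v : (C.contract S).V}
    {J : (C.contract S).LinkEdge v × Bool → C.Corner × Bool} (hJ : Function.Injective J)
    (hJf : ∀ k, cornerFace (J k) = (face k).1)
    (hJv : ∀ k, C.totalLink.vert (J k) = (((C.contract S).link v).vert k).1.1)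
    (hJr : ∀ h, C.totalLink.vert h ∉ S → C.rev (C.totalLink.vert h) ∉ S →
      Quot.mk _ (C.src (C.totalLink.vert h)) = v → ∃ k, J k = h)
    {ρ : Perm ((C.contract S).LinkEdge v × Bool)} (hρ : JordanProperty (flip _) ρ)
    {r : Perm (C.Corner × Bool)} (hrS : ∀ h, C.totalLink.vert h ∈ S → r h = C.swap h)
    (hrJ : ∀ k, r (J k) = J (ρ k)) {Z y : C.Corner × Bool → ZMod 2} (hZ : ∀ h, Z (flip _ h) = Z h)
    (hy : ∀ h, y (r h) = y h + Z h) :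
    ∃ c : C.Corner × Bool → ZMod 2, ∀ h, Quot.mk _ (C.src (C.totalLink.vert h)) = v →
      c (flip _ h) = c h + Z h ∧ c (r h) = c h + Z h := by
  classical
  have hS' : ∀ d, C.rev d ∈ S → d ∈ S := fun d h => by rw [← C.rev_rev d]; exact hS _ h
  have hswapv : ∀ h, C.totalLink.vert h ∈ S → C.totalLink.vert (C.swap h) ∈ S := fun h hh => by
    rw [vert_swap]
    exact hS _ hh
  have hZswap : ∀ h, C.totalLink.vert h ∈ S → Z (C.swap h) = Z h := by
    intro h hh
    have h1 := hy h
    have h2 := hy (C.swap h)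
    rw [hrS _ hh] at h1
    rw [hrS _ (hswapv h hh), swap_swap, h1] at h2
    grind
  choose η hη using exists_half (C := C)
  choose q hq1 hq2 hq3 hq4 using exists_contract_retraction (C := C) hS
  -- `Z` depends only on the contracted corner
  have hZc : ∀ (c : C.Corner), Z (c, false) = Z (η c.1 (C.nextCorner c).2.1) := by
    rintro ⟨f, d, hd⟩
    rw [hη f _ (C.nextCorner ⟨f, d, hd⟩).2.2]
    rw [← hZ (⟨f, d, hd⟩, false)]
    exact congrArg Z (Prod.ext (C.prevCorner_nextCorner _).symm rfl)
  have hηv : ∀ f d (hd : d ∈ C.bd f), C.totalLink.vert (η f d) = d := fun f d hd => by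
    rw [hη f d hd, vert_true, nextCorner_prevCorner]
  have hηf : ∀ f d (hd : d ∈ C.bd f), cornerFace (η f d) = f := fun f d hd => by
    rw [hη f d hd]
    rfl
  -- the corner of the contracted face that follows the half-edge `(c, false)`
  have hJtrue : ∀ c, J (c, true) = η c.1.1.1 ((C.contract S).nextCorner c.1).2.1.1 := by
    intro c
    have hmem : ((C.contract S).nextCorner c.1).2.1.1 ∈ C.bd c.1.1.1 :=
      mem_bd_contract.1 ((C.contract S).nextCorner c.1).2.2
    refine corner_ext ?_ ?_
    · exact (hJf _).trans (hηf _ _ hmem).symm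
    · exact (hJv _).trans (hηv _ _ hmem).symm
  have hJfalse : ∀ c : (C.contract S).LinkEdge v,
      J (c, false) = (⟨c.1.1.1, c.1.2.1.1, mem_bd_contract.1 c.1.2.2⟩, false) := by
    intro c
    refine corner_ext ?_ ?_
    · exact hJf _
    · exact hJv _
  have hnextS : ∀ f d (hd : d ∈ C.bd f), d ∈ S →
      Z (η f (C.nextCorner ⟨f, d, hd⟩).2.1) = Z (η f d) := by
    intro f d hd hdS
    rw [← hZc ⟨f, d, hd⟩, ← hZswap (η f d) (by rw [hηv f d hd]; exact hdS), hη f d hd, swap_true,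
      nextCorner_prevCorner]
  have hZJ : ∀ k, Z (J (flip _ k)) = Z (J k) := by
    have key : ∀ c, Z (J (c, true)) = Z (J (c, false)) := by
      intro c
      rw [hJtrue, hJfalse, hZc, ← hq3 c.1.1 c.1.2.1 c.1.2.2]
      refine (hq4 c.1.1 (fun d => Z (η c.1.1.1 d)) (fun d hd hdS => hnextS _ d hd hdS) _
        (C.nextCorner _).2.2 _ ?_ rfl).symm
      rw [hq3 c.1.1 c.1.2.1 c.1.2.2]
      exact mem_bd_contract.1 ((C.contract S).nextCorner c.1).2.2
    rintro ⟨c, b⟩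
    cases b
    · exact key c
    · exact (key c).symm
  obtain ⟨c', hc'⟩ := hρ (fun k => Z (J k)) (fun k => y (J k)) hZJ fun k => by
    rw [← hrJ]
    exact hy (J k)
  have hext : ∀ k, Function.extend J c' 0 (J k) = c' k := fun k => hJ.extend_apply c' 0 k
  set c'' := Function.extend J c' 0 with hc''
  -- `Q c` is the colour at the first remaining dart from the dart of the corner `c` on
  obtain ⟨Q, hQ1, hQ2⟩ : ∃ Q : C.Corner → ZMod 2,
      (∀ (f : (C.contract S).F) d (hd : d ∈ C.bd f.1), Q ⟨f.1, d, hd⟩ = c'' (η f.1 (q f d).1)) ∧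
        ∀ c : C.Corner, c.2.1 ∈ S → Q (C.nextCorner c) = Q c := by
    refine ⟨fun c => if hf : ∃ d ∈ C.bd c.1, d ∉ S ∧ C.rev d ∉ S then
      c'' (η c.1 (q ⟨c.1, hf⟩ c.2.1).1) else 0, fun f d hd => dif_pos f.2, ?_⟩
    rintro ⟨f, d, hd⟩ hdS
    by_cases hf : ∃ d ∈ C.bd f, d ∉ S ∧ C.rev d ∉ S
    · refine (dif_pos hf).trans (Eq.trans ?_ (dif_pos hf).symm)
      exact congrArg (fun x : (C.contract S).D => c'' (η f x.1)) (hq2 ⟨f, hf⟩ d hd hdS)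
    · have h0 : ∀ c : C.Corner, c.1 = f → (if hf : ∃ d ∈ C.bd c.1, d ∉ S ∧ C.rev d ∉ S then
          c'' (η c.1 (q ⟨c.1, hf⟩ c.2.1).1) else 0) = 0 := by
        rintro c rfl
        exact dif_neg hf
      exact (h0 _ rfl).trans (h0 _ rfl).symm
  let c : C.Corner × Bool → ZMod 2 := fun h => Q (C.nextCorner h.1) + if h.2 then 0 else Z h
  have hct : ∀ k, c (k, true) = Q (C.nextCorner k) := fun k => add_zero _
  have hcf : ∀ k, c (k, false) = Q (C.nextCorner k) + Z (k, false) := fun k => rfl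
  have hcJ : ∀ k, c (J k) = c' k := by
    have ht : ∀ k, Q (C.nextCorner (J (k, true)).1) = c' (k, true) := by
      intro k
      have hmem : ((C.contract S).nextCorner k.1).2.1.1 ∈ C.bd k.1.1.1 :=
        mem_bd_contract.1 ((C.contract S).nextCorner k.1).2.2
      rw [← hext, hJtrue, hη _ _ hmem, nextCorner_prevCorner, hQ1 k.1.1 _ hmem,
        hq1 k.1.1 _ hmem ((C.contract S).nextCorner k.1).2.1.2, hη _ _ hmem]
    rintro ⟨k, b⟩
    cases b
    · have e := (hc' (k, true)).1
      have e2 := hZJ (k, true)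
      rw [show MultiGraph.flip _ (k, true) = (k, false) from rfl] at e e2
      rw [e, ← ht, ← e2, hJfalse, hcf]
      congr 1
      rw [hJtrue]
      have hmem : ((C.contract S).nextCorner k.1).2.1.1 ∈ C.bd k.1.1.1 :=
        mem_bd_contract.1 ((C.contract S).nextCorner k.1).2.2
      have hmem' : k.1.2.1.1 ∈ C.bd k.1.1.1 := mem_bd_contract.1 k.1.2.2
      rw [hη _ _ hmem, nextCorner_prevCorner, hQ1 k.1.1 _ hmem,
        hq1 k.1.1 _ hmem ((C.contract S).nextCorner k.1).2.1.2]
      exact (hQ1 k.1.1 _ (C.nextCorner ⟨k.1.1.1, k.1.2.1.1, hmem'⟩).2.2).trans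
        (congrArg (fun x : (C.contract S).D => c'' (η k.1.1.1 x.1)) (hq3 k.1.1 k.1.2.1 k.1.2.2))
    · rw [← ht]
      have : J (k, true) = ((J (k, true)).1, true) := by
        refine Prod.ext rfl ?_
        have hmem : ((C.contract S).nextCorner k.1).2.1.1 ∈ C.bd k.1.1.1 :=
          mem_bd_contract.1 ((C.contract S).nextCorner k.1).2.2
        have e : (J (k, true)).2 = true := by
          rw [hJtrue, hη _ _ hmem]
        exact e
      rw [this, hct]
  refine ⟨c, fun h hv => ⟨?_, ?_⟩⟩
  · obtain ⟨k, b⟩ := h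
    have e := hZ (k, false)
    rw [flip_apply] at e ⊢
    cases b
    · simp only [Bool.not_false] at e ⊢
      rw [hct, hcf]
      grind
    · simp only [Bool.not_true, Bool.not_false] at e ⊢
      rw [hct, hcf, e]
  · by_cases hh : C.totalLink.vert h ∈ S
    · rw [hrS h hh]
      have hz := hZswap h hh
      obtain ⟨k, b⟩ := h
      cases b
      · rw [swap_false, hct, hcf, nextCorner_prevCorner, hQ2 k (hS' _ hh)]
        grind
      · rw [swap_true] at hz ⊢
        rw [hct, hcf, hQ2 (C.nextCorner k) hh, hz]
    · obtain ⟨k, rfl⟩ := hJr h hh (fun h' => hh (hS' _ h')) hv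
      rw [hrJ, hcJ, hcJ, (hc' k).2]

/-- A loop planar rotation system of the link at the contracted vertex gives rotators at all darts
that are not contracted. Together with the exchange of the two ends of the contracted edges they
have the Jordan property. -/
theorem exists_rotation_of_contract [Finite C.D] [Finite C.F] (hS : ∀ d ∈ S, C.rev d ∈ S)
    {v : (C.contract S).V} (hSv : ∀ d ∈ S, Quot.mk _ (C.src d) = v)
    (hv : (C.contract S).IsLoopPlanarAt v)
    {r₀ : Perm (C.Corner × Bool)} (hr₀ : C.totalLink.IsRotationSystem r₀)
    (hr₀' : ∀ x, Quot.mk _ x ≠ v → PlanarAt r₀ x) :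
    ∃ r : Perm (C.Corner × Bool), (∀ d ∉ S, r.IsCycleOn {h | C.totalLink.vert h = d}) ∧
      (∀ h, C.totalLink.vert h ∈ S → r h = C.swap h) ∧ JordanProperty (flip _) r ∧
      ∀ d ∉ S, Quot.mk _ (C.src d) = v → Quot.mk _ (C.tgt d) = v → Opposite r d := by
  classical
  have hS' : ∀ d, C.rev d ∈ S → d ∈ S := fun d h => by rw [← C.rev_rev d]; exact hS _ h
  obtain ⟨J, hJ, hJf, hJv, hJr⟩ := exists_ofContract (C := C) (S := S) v
  have : Finite ((C.contract S).LinkEdge v) := Finite.of_injective (fun c => J (c, true))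
    fun c c' e => (Prod.ext_iff.1 (hJ e)).1
  have : Finite ((C.contract S).D) := inferInstanceAs (Finite {d : C.D // _})
  obtain ⟨ρ, hρ, hloop⟩ := hv
  rw [isPlanarRotationSystem_iff] at hρ
  obtain ⟨hρ, hρJ⟩ := hρ
  have hJv' : ∀ k, C.totalLink.vert (J k) ∉ S := fun k => by
    rw [hJv]
    exact (((C.contract S).link v).vert k).1.2.1
  have hJs : ∀ k, Quot.mk _ (C.src (C.totalLink.vert (J k))) = v := fun k => by
    rw [hJv]
    exact (((C.contract S).link v).vert k).2
  set rJ := ρ.viaEmbedding ⟨J, hJ⟩ with hrJdef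
  have hrJ : ∀ k, rJ (J k) = J (ρ k) := fun k => ρ.viaEmbedding_apply ⟨J, hJ⟩ k
  have hrange : ∀ h, h ∈ Set.range J ↔
      C.totalLink.vert h ∉ S ∧ Quot.mk _ (C.src (C.totalLink.vert h)) = v := by
    intro h
    constructor
    · rintro ⟨k, rfl⟩
      exact ⟨hJv' k, hJs k⟩
    · rintro ⟨h1, h2⟩
      exact hJr h h1 (fun h' => h1 (hS' _ h')) h2
  obtain ⟨r₁, hr₁, hr₁'⟩ := Equiv.Perm.exists_piecewise rJ r₀ (Set.range J) (fun h => by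
      by_cases hh : h ∈ Set.range J
      · obtain ⟨k, rfl⟩ := hh
        rw [hrJ]
        simp
      · rw [hrJdef, ρ.viaEmbedding_apply_of_notMem ⟨J, hJ⟩ h hh]) (fun h => by
      rw [hrange, hrange, hr₀.vert_apply])
  have hr₁v : ∀ h, C.totalLink.vert (r₁ h) ∈ S ↔ C.totalLink.vert h ∈ S := by
    intro h
    by_cases hh : h ∈ Set.range J
    · obtain ⟨k, rfl⟩ := hh
      rw [hr₁ _ ⟨k, rfl⟩, hrJ]
      exact iff_of_false (hJv' _) (hJv' _)
    · rw [hr₁' h hh, hr₀.vert_apply]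
  obtain ⟨r, hrS, hr'⟩ := Equiv.Perm.exists_piecewise C.swap r₁ {h | C.totalLink.vert h ∈ S}
    (fun h => by
      rw [Set.mem_ofPred_eq, Set.mem_ofPred_eq, vert_swap]
      exact ⟨hS' _, hS _⟩) hr₁v
  have hrJ' : ∀ k, r (J k) = J (ρ k) := fun k => by
    rw [hr' _ (hJv' k), hr₁ _ ⟨k, rfl⟩, hrJ]
  have hrJi : ∀ k, r⁻¹ (J k) = J (ρ⁻¹ k) := fun k => by
    have := hrJ' (ρ⁻¹ k)
    rw [show ρ (ρ⁻¹ k) = k by simp] at this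
    rw [← this]
    simp
  have hr0 : ∀ h, Quot.mk _ (C.src (C.totalLink.vert h)) ≠ v → r h = r₀ h := fun h hh => by
    rw [hr' h (fun h' => hh (hSv _ h')), hr₁' h (fun h' => hh ((hrange h).1 h').2)]
  have hbase : ∀ h, Quot.mk _ (C.src (C.totalLink.vert h)) = v →
      (Quot.mk _ (C.src (C.totalLink.vert (r h))) : (C.contract S).V) = v := by
    intro h hh
    by_cases hhS : C.totalLink.vert h ∈ S
    · rw [hrS h hhS, vert_swap]
      exact hSv _ (hS _ hhS)
    · obtain ⟨k, rfl⟩ := (hrange h).2 ⟨hhS, hh⟩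
      rw [hrJ']
      exact hJs _
  refine ⟨r, fun d hd => ?_, hrS, fun Z y hZ hy => ?_, fun d hd h1 h2 => ?_⟩
  · by_cases hdv : (Quot.mk _ (C.src d) : (C.contract S).V) = v
    · have : {h | C.totalLink.vert h = d} = J '' {k | ((C.contract S).link v).vert k =
          ⟨⟨d, hd, fun h' => hd (hS' _ h')⟩, hdv⟩} := by
        ext h
        constructor
        · rintro rfl
          obtain ⟨k, rfl⟩ := (hrange h).2 ⟨hd, hdv⟩
          exact ⟨k, Subtype.ext (Subtype.ext (hJv k).symm), rfl⟩
        · rintro ⟨k, hk, rfl⟩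
          have hk : ((C.contract S).link v).vert k = _ := hk
          rw [Set.mem_ofPred_eq, hJv, hk]
      rw [this]
      exact (hρ _).image_of_semiconj J fun k _ => hrJ' k
    · refine (hr₀ d).congr_of_eq ?_
      rintro h rfl
      exact hr0 h hdv
  · obtain ⟨c₁, hc₁⟩ := exists_colouring_of_contract hS hJ hJf hJv hJr hρJ hrS hrJ' hZ hy
    -- off the contracted part, `r` may be replaced by `r₀`
    have hsum : ∃ y₀ : C.Corner × Bool → ZMod 2, ∀ h, y₀ (r₀ h) = y₀ h +
        if (Quot.mk _ (C.src (C.totalLink.vert h)) : (C.contract S).V) = v then 0 else Z h := by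
      refine ⟨fun h => if (Quot.mk _ (C.src (C.totalLink.vert h)) : (C.contract S).V) = v then 0
        else y h, fun h => ?_⟩
      beta_reduce
      rw [hr₀.vert_apply]
      split_ifs with hh
      · simp
      · rw [← hr0 h hh, hy]
    obtain ⟨y₀, hy₀⟩ := hsum
    have hloc : ∀ x, ∃ c : C.Corner × Bool → ZMod 2, (Quot.mk _ x : (C.contract S).V) ≠ v →
        ∀ h, C.src (C.totalLink.vert h) = x → c (flip _ h) = c h + Z h ∧ c (r₀ h) = c h + Z h := by
      intro x
      by_cases hx : (Quot.mk _ x : (C.contract S).V) = v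
      · exact ⟨0, fun h => absurd hx h⟩
      obtain ⟨c, hc⟩ := hr₀' x hx _ y₀ (fun h => by
        rw [src_vert_flip, hZ]) hy₀
      refine ⟨c, fun _ h hh => ?_⟩
      have := hc h hh
      rwa [if_neg (by rw [hh]; exact hx)] at this
    choose c₀ hc₀ using hloc
    refine ⟨fun h => if (Quot.mk _ (C.src (C.totalLink.vert h)) : (C.contract S).V) = v then c₁ h
      else c₀ (C.src (C.totalLink.vert h)) h, fun h => ?_⟩
    beta_reduce
    rw [src_vert_flip]
    by_cases hh : (Quot.mk _ (C.src (C.totalLink.vert h)) : (C.contract S).V) = v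
    · rw [if_pos hh, if_pos hh, if_pos (hbase h hh)]
      exact hc₁ h hh
    · rw [if_neg hh, if_neg hh, hr0 h hh, hr₀.vert_apply, if_neg hh]
      exact hc₀ _ hh h rfl
  · rintro h rfl
    obtain ⟨k, rfl⟩ := (hrange h).2 ⟨hd, h1⟩
    have hd' : C.totalLink.vert (C.swap (J k)) ∉ S := by
      rw [vert_swap]
      exact fun h' => hd (hS' _ h')
    obtain ⟨k', hk'⟩ := (hrange (C.swap (J k))).2 ⟨hd', by rw [vert_swap]; exact h2⟩
    have hrev : (((C.contract S).link v).vert k).1 =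
        (C.contract S).rev (((C.contract S).link v).vert k').1 := by
      refine Subtype.ext ?_
      change _ = C.rev (((C.contract S).link v).vert k').1.1
      rw [← hJv, ← hJv, hk', vert_swap, C.rev_rev]
    have hface : face k' = face k := by
      refine Subtype.ext ?_
      rw [← hJf, ← hJf, hk', cornerFace_swap]
    have := hloop k' k hrev hface
    rw [← hk', hrJ', hrJi]
    refine eq_swap ?_ ?_
    · rw [hJf, hJf, this]
    · rw [hJv, hJv, hρ.vert_apply, hρ.inv.vert_apply, ← hJv, ← hJv, hk', vert_swap]

end TwoComplex

/-! ### Planar rotators at all darts -/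

namespace TwoComplex

open MultiGraph

variable {C : TwoComplex.{u}}

/-- Rotators at all darts that are planar in all links. The rotators at a dart and at its reverse
need not be related. -/
def IsPlanarPrerotation (r : Perm (C.Corner × Bool)) : Prop :=
  C.totalLink.IsRotationSystem r ∧ JordanProperty (flip _) r

/-- Two families of rotators coincide at the vertex `v`. -/
def EqAt (r r' : Perm (C.Corner × Bool)) (v : C.V) : Prop :=
  ∀ h, C.src (C.totalLink.vert h) = v → r' h = r h

theorem ncard_link {v : C.V} {d : C.D} (hd : C.src d = v) :
    {h | (C.link v).vert h = ⟨d, hd⟩}.ncard = {h | C.totalLink.vert h = d}.ncard := by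
  rw [← Set.ncard_image_of_injective _ ofLink_injective]
  congr 1
  ext h
  constructor
  · rintro ⟨k, hk, rfl⟩
    have hk : (C.link v).vert k = ⟨d, hd⟩ := hk
    rw [Set.mem_ofPred_eq, vert_ofLink, hk]
  · intro hh
    have hh : C.totalLink.vert h = d := hh
    obtain ⟨k, rfl⟩ := exists_ofLink (k := h) (v := v) (by rw [hh, hd])
    exact ⟨k, Subtype.ext (by rw [← vert_ofLink, hh]), rfl⟩

theorem ncard_incident (d : C.D) :
    {f | C.Incident f d}.ncard = {h | C.totalLink.vert h = d}.ncard := by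
  rw [← Set.InjOn.ncard_image (f := cornerFace) (s := {h | C.totalLink.vert h = d})]
  · congr 1
    ext f
    constructor
    · intro hf
      obtain ⟨k, rfl, hk⟩ := exists_corner hf
      exact ⟨k, hk, rfl⟩
    · rintro ⟨k, rfl, rfl⟩
      exact incident_vert k
  · intro h hh h' hh' e
    exact corner_ext e (hh.trans hh'.symm)

theorem apply_inv_ofLink {r : Perm (C.Corner × Bool)} {v : C.V} {ρ : Perm (C.LinkEdge v × Bool)}
    (hρ : ∀ h, ofLink (ρ h) = r (ofLink h)) (h : C.LinkEdge v × Bool) :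
    ofLink (ρ⁻¹ h) = r⁻¹ (ofLink h) := by
  have := hρ (ρ⁻¹ h)
  rw [show ρ (ρ⁻¹ h) = h by simp] at this
  rw [this]
  simp

theorem eqAt_of_eq_link {r r' : Perm (C.Corner × Bool)} {v : C.V}
    {ρ ρ' : Perm (C.LinkEdge v × Bool)} (hρ : ∀ h, ofLink (ρ h) = r (ofLink h))
    (hρ' : ∀ h, ofLink (ρ' h) = r' (ofLink h)) (e : ρ' = ρ) : EqAt r r' v := by
  intro h hv
  obtain ⟨k, rfl⟩ := exists_ofLink hv
  rw [← hρ, ← hρ', e]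

theorem IsPlanarPrerotation.inv {r : Perm (C.Corner × Bool)} (h : IsPlanarPrerotation r) :
    IsPlanarPrerotation r⁻¹ :=
  ⟨h.1.inv, h.2.inv⟩

variable [Finite C.D] [Finite C.F]

theorem IsPlanarPrerotation.exists_link {r : Perm (C.Corner × Bool)} (h : IsPlanarPrerotation r)
    (v : C.V) : ∃ ρ, (C.link v).IsRotationSystem ρ ∧ JordanProperty (flip _) ρ ∧
      ∀ h, ofLink (ρ h) = r (ofLink h) := by
  obtain ⟨ρ, hρ, hρr⟩ := exists_link_rotation h.1 v
  have hsrc := fun k => congrArg C.src (h.1.vert_apply k)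
  exact ⟨ρ, hρ, (planarAt_iff hsrc hρr).1 ((jordanProperty_iff_planarAt hsrc).1 h.2 v), hρr⟩

/-- Planar rotation systems of the links, chosen independently, form a planar prerotation. -/
theorem exists_isPlanarPrerotation_of_links (ρ : ∀ v, Perm (C.LinkEdge v × Bool))
    (hρ : ∀ v, (C.link v).IsRotationSystem (ρ v)) (hJ : ∀ v, JordanProperty (flip _) (ρ v)) :
    ∃ r, IsPlanarPrerotation r ∧ ∀ v h, r (ofLink h) = ofLink (ρ v h) := by
  obtain ⟨r, hr, hrρ⟩ := exists_rotation_of_links ρ hρ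
  have hsrc := fun k => congrArg C.src (hr.vert_apply k)
  exact ⟨r, ⟨hr, (jordanProperty_iff_planarAt hsrc).2 fun v =>
    (planarAt_iff hsrc fun h => (hrρ v h).symm).2 (hJ v)⟩, hrρ⟩

/-- Planar rotators at the vertices can be chosen independently of each other. -/
theorem exists_isPlanarPrerotation_eqAt {R : C.V → Perm (C.Corner × Bool)}
    (hR : ∀ v, IsPlanarPrerotation (R v)) : ∃ r, IsPlanarPrerotation r ∧ ∀ v, EqAt (R v) r v := by
  choose ρ hρ hJ hρR using fun v => (hR v).exists_link v
  obtain ⟨r, hr, hrρ⟩ := exists_isPlanarPrerotation_of_links ρ hρ hJ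
  exact ⟨r, hr, fun v => eqAt_of_eq_link (hρR v) (fun h => (hrρ v h).symm) rfl⟩

theorem IsLocallyPlanar.exists_isPlanarPrerotation (h : C.IsLocallyPlanar) :
    ∃ r : Perm (C.Corner × Bool), IsPlanarPrerotation r := by
  choose ρ hρ _ using h
  simp only [isPlanarRotationSystem_iff] at hρ
  obtain ⟨r, hr, -⟩ := exists_isPlanarPrerotation_of_links ρ (fun v => (hρ v).1) fun v => (hρ v).2
  exact ⟨r, hr⟩

/-- Two planar prerotations agree up to reversal at a vertex whose link is a subdivision of a
3-connected graph. -/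
theorem IsPlanarPrerotation.eqAt_or_eqAt_inv {r r' : Perm (C.Corner × Bool)}
    (hr : IsPlanarPrerotation r) (hr' : IsPlanarPrerotation r') {v : C.V}
    (hL : (C.link v).IsSimple) (h : (C.link v).toSimpleGraph.IsSubdivisionOfThreeConnected) :
    EqAt r r' v ∨ EqAt r⁻¹ r' v := by
  obtain ⟨ρ, hρ, hJ, hρr⟩ := hr.exists_link v
  obtain ⟨ρ', hρ', hJ', hρr'⟩ := hr'.exists_link v
  exact (hρ.eq_or_eq_inv_of_isSubdivisionOfThreeConnected hL h hJ hρ' hJ').imp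
    (eqAt_of_eq_link hρr hρr') (eqAt_of_eq_link (apply_inv_ofLink hρr) hρr')

/-- At a vertex whose link is a parallel graph, a planar prerotation is determined by its rotator at
one branch vertex of the link. -/
theorem IsPlanarPrerotation.eqAt_of_isThickParallelGraph {r r' : Perm (C.Corner × Bool)}
    (hr : IsPlanarPrerotation r) (hr' : IsPlanarPrerotation r') {d : C.D}
    (hL : (C.link (C.src d)).IsSimple)
    (h : (C.link (C.src d)).toSimpleGraph.IsThickParallelGraph)
    (hd : {h | C.totalLink.vert h = d}.ncard ≠ 2)
    (he : ∀ h, C.totalLink.vert h = d → r' h = r h) : EqAt r r' (C.src d) := by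
  obtain ⟨ρ, hρ, hJ, hρr⟩ := hr.exists_link (C.src d)
  obtain ⟨ρ', hρ', hJ', hρr'⟩ := hr'.exists_link (C.src d)
  refine eqAt_of_eq_link hρr hρr' (hρ.eq_of_isThickParallelGraph hL h hJ hρ' hJ' (w := ⟨d, rfl⟩)
    (by rwa [ncard_link]) fun k hk => ofLink_injective ?_)
  rw [hρr, hρr', he]
  rw [vert_ofLink, hk]

/-- The rotator at a branch vertex of a parallel link can be prescribed. -/
theorem IsPlanarPrerotation.exists_prescribed {r π : Perm (C.Corner × Bool)}
    (hr : IsPlanarPrerotation r) {d : C.D} (hL : (C.link (C.src d)).IsSimple)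
    (h : (C.link (C.src d)).toSimpleGraph.IsThickParallelGraph)
    (hd : {h | C.totalLink.vert h = d}.ncard ≠ 2)
    (hπ : π.IsCycleOn {h | C.totalLink.vert h = d}) :
    ∃ r', IsPlanarPrerotation r' ∧ (∀ v, v ≠ C.src d → EqAt r r' v) ∧
      ∀ h, C.totalLink.vert h = d → r' h = π h := by
  classical
  -- any family of rotators with the rotator `π` at `d` induces a rotation of the link
  obtain ⟨q, hq, hq'⟩ := Equiv.Perm.exists_piecewise π r {h | C.totalLink.vert h = d}
    (fun h => hπ.apply_mem_iff) fun h => by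
      rw [Set.mem_ofPred_eq, Set.mem_ofPred_eq, hr.1.vert_apply]
  have hqrot : C.totalLink.IsRotationSystem q := by
    intro d'
    by_cases hdd : d' = d
    · subst hdd
      exact hπ.congr_of_eq hq
    · refine (hr.1 d').congr_of_eq ?_
      rintro h rfl
      exact hq' h hdd
  obtain ⟨κ, hκ, hκq⟩ := exists_link_rotation hqrot (C.src d)
  obtain ⟨σ, hσ, hσJ, hσκ⟩ := exists_rotation_of_isThickParallelGraph hL h (w := ⟨d, rfl⟩)
    (by rwa [ncard_link]) (hκ ⟨d, rfl⟩)
  choose ρ hρ hJ hρr using fun v => hr.exists_link v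
  have hex : ∀ v, ∃ ρ' : Perm (C.LinkEdge v × Bool), (C.link v).IsRotationSystem ρ' ∧
      JordanProperty (flip _) ρ' ∧ (v ≠ C.src d → ρ' = ρ v) ∧
        ∀ h, C.totalLink.vert (ofLink h) = d → ofLink (ρ' h) = π (ofLink h) := by
    intro v
    by_cases hv : v = C.src d
    · subst hv
      refine ⟨σ, hσ, hσJ, fun h => absurd rfl h, fun h hh => ?_⟩
      rw [hσκ h (Subtype.ext (by rw [← vert_ofLink, hh])), hκq, hq _ hh]
    · exact ⟨ρ v, hρ v, hJ v, fun _ => rfl, fun h hh => absurd (by rw [← hh, src_ofLink]) hv⟩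
  choose ρ' h1 h2 h3 h4 using hex
  obtain ⟨r', hr', hr'ρ⟩ := exists_isPlanarPrerotation_of_links ρ' h1 h2
  refine ⟨r', hr', fun v hv => eqAt_of_eq_link (hρr v) (fun h => (hr'ρ v h).symm) (h3 v hv),
    fun h hh => ?_⟩
  obtain ⟨k, hk⟩ := exists_ofLink (k := h) rfl
  rw [← hk, hr'ρ, h4 _ _ (by rw [hk, hh])]

/-- If the link at `v` is a free-graph or a parallel graph with few paths, then any two rotation
systems of it, planar or not, agree up to reversal. -/
theorem eqAt_or_eqAt_inv_of_isAlmostThreeConnected {r r' : Perm (C.Corner × Bool)}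
    (hr : C.totalLink.IsRotationSystem r) (hr' : C.totalLink.IsRotationSystem r') {v : C.V}
    (hL : (C.link v).IsSimple) (h : (C.link v).toSimpleGraph.IsAlmostThreeConnected)
    (h1 : ¬ (C.link v).toSimpleGraph.IsSubdivisionOfThreeConnected)
    (h2 : ¬ (C.link v).toSimpleGraph.IsThickParallelGraph) :
    EqAt r r' v ∨ EqAt r⁻¹ r' v := by
  obtain ⟨ρ, hρ, hρr⟩ := exists_link_rotation hr v
  obtain ⟨ρ', hρ', hρr'⟩ := exists_link_rotation hr' v
  exact (hρ.eq_or_eq_inv_of_isAlmostThreeConnected hL h h1 h2 hρ').imp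
    (eqAt_of_eq_link hρr hρr') (eqAt_of_eq_link (apply_inv_ofLink hρr) hρr')

end TwoComplex

namespace TwoComplex

open MultiGraph

variable {C : TwoComplex.{u}}

theorem opposite_iff {r : Perm (C.Corner × Bool)} (hr : C.totalLink.IsRotationSystem r) {d : C.D} :
    Opposite r d ↔ ∀ h, C.totalLink.vert h = d → r (C.swap (r h)) = C.swap h := by
  constructor
  · intro ho h hh
    rw [ho (r h) (by rw [hr.vert_apply, hh])]
    simp
  · intro ho h hh
    have := ho (r⁻¹ h) (by rw [hr.inv.vert_apply, hh])
    rwa [show r (r⁻¹ h) = h by simp] at this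

theorem swap_image (d : C.D) :
    C.swap '' {h | C.totalLink.vert h = C.rev d} = {h | C.totalLink.vert h = d} := by
  ext h
  constructor
  · rintro ⟨k, hk, rfl⟩
    have hk : C.totalLink.vert k = C.rev d := hk
    rw [Set.mem_ofPred_eq, vert_swap, hk, C.rev_rev]
  · rintro rfl
    exact ⟨C.swap h, vert_swap h, swap_swap h⟩

/-- Rotators at the darts in `U` are extended to the reverses of these darts. -/
theorem exists_opposite_completion [Finite C.D] [Finite C.F] {r : Perm (C.Corner × Bool)}
    (hr : IsPlanarPrerotation r) {U : Set C.D} (hU : ∀ d, d ∈ U ∨ C.rev d ∈ U)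
    (hop : ∀ d, d ∈ U → C.rev d ∈ U → Opposite r d)
    (hv : ∀ v, (∀ d, C.src d = v → d ∈ U) ∨
      ∀ r', C.totalLink.IsRotationSystem r' → EqAt r r' v ∨ EqAt r⁻¹ r' v) :
    ∃ r' : Perm (C.Corner × Bool), IsPlanarPrerotation r' ∧ ∀ d, Opposite r' d := by
  classical
  obtain ⟨r', h1, h2⟩ := Equiv.Perm.exists_piecewise r (C.swap * r⁻¹ * C.swap)
    {h | C.totalLink.vert h ∈ U}
    (fun h => by rw [Set.mem_ofPred_eq, Set.mem_ofPred_eq, hr.1.vert_apply])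
    (fun h => by
      rw [Set.mem_ofPred_eq, Set.mem_ofPred_eq, Perm.mul_apply, Perm.mul_apply, vert_swap,
        hr.1.inv.vert_apply, vert_swap, C.rev_rev])
  have h2' : ∀ h, C.totalLink.vert h ∉ U → r' h = C.swap (r⁻¹ (C.swap h)) := h2
  have hrot : C.totalLink.IsRotationSystem r' := by
    intro d
    by_cases hd : d ∈ U
    · refine (hr.1 d).congr_of_eq ?_
      rintro h rfl
      exact h1 h hd
    · rw [← swap_image]
      refine (hr.1.inv (C.rev d)).image_of_semiconj C.swap fun k hk => ?_
      have hk : C.totalLink.vert k = C.rev d := hk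
      rw [h2' _ (by rw [vert_swap, hk, C.rev_rev]; exact hd), swap_swap]
  have hsrc := fun k => congrArg C.src (hrot.vert_apply k)
  refine ⟨r', ⟨hrot, (jordanProperty_iff_planarAt hsrc).2 fun v => ?_⟩, fun d => ?_⟩
  · have hEq : EqAt r r' v ∨ EqAt r⁻¹ r' v := by
      rcases hv v with h | h
      · exact Or.inl fun k hk => h1 k (h _ hk)
      · exact h r' hrot
    obtain ⟨q, hq, hqv⟩ : ∃ q, IsPlanarPrerotation q ∧ EqAt q r' v :=
      hEq.elim (fun h => ⟨r, hr, h⟩) fun h => ⟨r⁻¹, hr.inv, h⟩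
    obtain ⟨ρ, hρ, hJ, hρq⟩ := hq.exists_link v
    refine (planarAt_iff hsrc (ρ := ρ) fun h => ?_).2 hJ
    rw [hρq, hqv _ (src_ofLink h)]
  · rw [opposite_iff hrot]
    rintro h rfl
    by_cases hd : C.totalLink.vert h ∈ U
    · rw [h1 h hd]
      by_cases hd' : C.rev (C.totalLink.vert h) ∈ U
      · rw [h1 (C.swap (r h)) (by rw [Set.mem_ofPred_eq, vert_swap, hr.1.vert_apply]; exact hd')]
        exact (opposite_iff hr.1).1 (hop _ hd hd') h rfl
      · rw [h2' (C.swap (r h)) (by rw [vert_swap, hr.1.vert_apply]; exact hd'), swap_swap]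
        simp
    · rw [h2' h hd, swap_swap]
      rw [h1 (r⁻¹ (C.swap h)) (by
        rw [Set.mem_ofPred_eq, hr.1.inv.vert_apply, vert_swap]
        exact (hU _).resolve_left hd)]
      simp

/-- Planar rotators that are reverse to each other at each pair of opposite darts form a planar
rotation system of the complex, because the half-edges of the total link at a dart correspond to the
faces incident with it. -/
theorem IsPlanarPrerotation.hasPlanarRotationSystem [Finite C.D] [Finite C.F]
    {r : Perm (C.Corner × Bool)} (hr : IsPlanarPrerotation r) (ho : ∀ d, Opposite r d) :
    C.HasPlanarRotationSystem := by
  classical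
  -- the half-edges at a dart correspond to the faces incident with its edge
  let e : ∀ d, {h // C.totalLink.vert h = d} ≃ {f // C.Incident f d} := fun d =>
    Equiv.ofBijective (fun h => ⟨cornerFace h.1, by
        have := incident_vert h.1
        rwa [h.2] at this⟩)
      ⟨fun h h' hh => Subtype.ext (corner_ext (Subtype.ext_iff.1 hh) (h.2.trans h'.2.symm)),
        fun f => by
          obtain ⟨k, hk1, hk2⟩ := exists_corner f.2
          exact ⟨⟨k, hk2⟩, Subtype.ext hk1⟩⟩
  let rot : C.D → Perm C.F := fun d =>
    (r.subtypePerm (p := fun h => C.totalLink.vert h = d)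
      fun h => by rw [hr.1.vert_apply]).extendDomain (e d)
  have hrot : ∀ h, rot (C.totalLink.vert h) (cornerFace h) = cornerFace (r h) := fun h =>
    Perm.extendDomain_apply_image _ (e (C.totalLink.vert h)) ⟨h, rfl⟩
  have hfix : ∀ d f, ¬ C.Incident f d → rot d f = f := fun d f hf =>
    Perm.extendDomain_apply_not_subtype _ (e d) hf
  have himage : ∀ d, {f | C.Incident f d} = cornerFace '' {h | C.totalLink.vert h = d} := by
    intro d
    ext f
    constructor
    · intro hf
      obtain ⟨k, hk1, hk2⟩ := exists_corner hf
      exact ⟨k, hk2, hk1⟩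
    · rintro ⟨k, rfl, rfl⟩
      exact incident_vert k
  have hrev : ∀ f d, C.Incident f (C.rev d) ↔ C.Incident f d := fun f d => by
    rw [Incident, Incident, C.rev_rev]
    exact or_comm
  refine ⟨⟨rot, fun d => ?_, hfix, fun d => ?_⟩, fun v => ?_⟩
  · rw [himage]
    refine (hr.1 d).image_of_semiconj cornerFace ?_
    rintro k rfl
    exact hrot k
  · refine Equiv.ext fun f => ?_
    rw [Perm.eq_inv_iff_eq]
    by_cases hf : C.Incident f d
    · obtain ⟨k, rfl, rfl⟩ := exists_corner hf
      have h1 := hrot (C.swap k)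
      rw [vert_swap, cornerFace_swap, ho _ k rfl, cornerFace_swap] at h1
      have h2 := hrot (r⁻¹ k)
      rw [hr.1.inv.vert_apply, show r (r⁻¹ k) = k by simp] at h2
      rw [h1, h2]
    · rw [hfix _ f fun h => hf ((hrev f d).1 h), hfix _ f hf]
  · obtain ⟨ρ, hρ, hJ, hρr⟩ := hr.exists_link v
    refine ⟨ρ, ⟨hρ, fun h => ?_⟩, isPlanarRotationSystem_iff.2 ⟨hρ, hJ⟩⟩
    rw [← cornerFace_ofLink, ← cornerFace_ofLink, hρr, ← vert_ofLink, hrot]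

end TwoComplex

/-! ### Links of simplicial complexes -/

theorem Finset.eq_of_card_eq_three {α : Type*} {s t : Finset α} (hs : s.card = 3)
    (ht : t.card = 3) {x y z : α} (hxy : x ≠ y) (hxz : x ≠ z) (hyz : y ≠ z) (hx : x ∈ s)
    (hy : y ∈ s) (hz : z ∈ s) (hx' : x ∈ t) (hy' : y ∈ t) (hz' : z ∈ t) : s = t := by
  classical
  have key : ∀ s : Finset α, s.card = 3 → x ∈ s → y ∈ s → z ∈ s → {x, y, z} = s := by
    intro s hs hx hy hz
    refine Finset.eq_of_subset_of_card_le (fun a ha => ?_) ?_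
    · simp only [Finset.mem_insert, Finset.mem_singleton] at ha
      rcases ha with rfl | rfl | rfl <;> assumption
    · rw [hs, Finset.card_eq_three.2 ⟨x, y, z, hxy, hxz, hyz, rfl⟩]
  rw [← key s hs hx hy hz, key t ht hx' hy' hz']

namespace TwoComplex

open MultiGraph

/-- Deleting a branch vertex `s` from a link that is a subdivision of a 3-connected graph or a
parallel graph leaves the other edges together: a function that is constant at the other vertices of
the link is constant at `s`. -/
theorem eq_of_invariant_off_dart {C : TwoComplex.{u}} [Finite C.D] [Finite C.F] {s : C.D}
    (hL : (C.link (C.src s)).IsSimple)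
    (hx : (C.link (C.src s)).toSimpleGraph.IsSubdivisionOfThreeConnected ∨
      (C.link (C.src s)).toSimpleGraph.IsThickParallelGraph)
    (hs : {h | C.totalLink.vert h = s}.ncard ≠ 2) {g : C.Corner × Bool → ZMod 2}
    (hg : ∀ h, g (MultiGraph.flip _ h) = g h)
    (hgv : ∀ h h', C.totalLink.vert h ≠ s → C.src (C.totalLink.vert h) = C.src s →
      C.totalLink.vert h = C.totalLink.vert h' → g h = g h')
    {a b : C.Corner × Bool} (ha : C.totalLink.vert a = s) (hb : C.totalLink.vert b = s) :
    g a = g b := by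
  obtain ⟨a, rfl⟩ := exists_ofLink (k := a) (congrArg C.src ha)
  obtain ⟨b, rfl⟩ := exists_ofLink (k := b) (congrArg C.src hb)
  refine eq_of_invariant_off hL hx (w := ⟨s, rfl⟩) (by rwa [ncard_link])
    (g := fun k => g (ofLink k)) (fun h => hg (ofLink h)) (fun h h' hh hh' => ?_) ?_ ?_
  · refine hgv _ _ (fun e => hh (Subtype.ext ?_)) (src_ofLink h) ?_
    · rw [← vert_ofLink, e]
    · rw [vert_ofLink, vert_ofLink, hh']
  · exact Subtype.ext (by rw [← vert_ofLink, ha])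
  · exact Subtype.ext (by rw [← vert_ofLink, hb])

end TwoComplex

namespace AbstractSimplicialComplex

open MultiGraph TwoComplex

variable {ι : Type u} {K : AbstractSimplicialComplex ι}

/-- The dart of a half-edge of the links, as a dart of the 1-skeleton. -/
noncomputable def dart (h : K.toTwoComplex.Corner × Bool) : K.skeleton.Dart :=
  K.toTwoComplex.totalLink.vert h

theorem dart_swap (h : K.toTwoComplex.Corner × Bool) :
    K.dart (K.toTwoComplex.swap h) = (K.dart h).symm :=
  vert_swap h

theorem dart_flip_fst (h : K.toTwoComplex.Corner × Bool) :
    (K.dart (MultiGraph.flip _ h)).fst = (K.dart h).fst :=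
  src_vert_flip h

variable (K) in
/-- The link graph at `x` is a subdivision of a `3`-connected graph or a parallel graph with
branch vertices of degree at least three. -/
def IsSolid (x : ι) : Prop :=
  (K.linkGraph x).IsSubdivisionOfThreeConnected ∨ (K.linkGraph x).IsThickParallelGraph

variable (K) in
/-- The number of faces incident with a dart is not two. -/
def IsBranchDart (d : K.skeleton.Dart) : Prop := {h | K.dart h = d}.ncard ≠ 2

theorem mem_of_incident {f : K.toTwoComplex.F} {d : K.skeleton.Dart}
    (h : K.toTwoComplex.Incident f d) : d.fst ∈ f.1 ∧ d.snd ∈ f.1 := by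
  have key : ∀ d : K.skeleton.Dart, d ∈ K.toTwoComplex.bd f → d.fst ∈ f.1 ∧ d.snd ∈ f.1 := by
    intro d hd
    obtain ⟨x, y, z, hxy, hyz, hzx, hmem, h⟩ := (K.exists_bd f).choose_spec
    have hd : d ∈ (K.exists_bd f).choose := hd
    rw [h] at hd
    have hd : d ∈ [⟨(x, y), hxy⟩, ⟨(y, z), hyz⟩, ⟨(z, x), hzx⟩] := hd
    rw [hmem, hmem]
    simp only [List.mem_cons, List.not_mem_nil, or_false] at hd
    rcases hd with rfl | rfl | rfl <;> simp
  rcases h with h | h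
  · exact key d h
  · exact (key d.symm h).symm

/-- The link of a simplicial complex has no loops and no parallel edges, because a triangle is
determined by its vertices. -/
theorem isSimple_link (v : K.toTwoComplex.V) : (K.toTwoComplex.link v).IsSimple := by
  classical
  have hmem : ∀ h : K.toTwoComplex.LinkEdge v × Bool,
      v ∈ (face h).1 ∧ (K.dart (ofLink h)).snd ∈ (face h).1 := by
    intro h
    have h1 := mem_of_incident (incident_vert (ofLink h))
    have h2 : (K.dart (ofLink h)).fst = v := src_ofLink h
    exact ⟨Eq.mp (congrArg (· ∈ (face h).1) h2) h1.1, h1.2⟩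
  have hinj : ∀ h h' : K.toTwoComplex.LinkEdge v × Bool, face h = face h' →
      (K.toTwoComplex.link v).vert h = (K.toTwoComplex.link v).vert h' → h = h' := by
    intro h h' hf hv
    refine ofLink_injective (corner_ext hf ?_)
    rw [vert_ofLink, vert_ofLink, hv]
  have hne : ∀ c, (K.toTwoComplex.link v).ends c false ≠ (K.toTwoComplex.link v).ends c true :=
    fun c hc => Bool.false_ne_true (Prod.ext_iff.1 (hinj (c, false) (c, true) rfl hc)).2
  have hsnd : ∀ h h' : K.toTwoComplex.LinkEdge v × Bool,
      (K.dart (ofLink h)).snd = (K.dart (ofLink h')).snd →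
      (K.toTwoComplex.link v).vert h = (K.toTwoComplex.link v).vert h' := by
    intro h h' e
    refine Subtype.ext ?_
    rw [← vert_ofLink, ← vert_ofLink]
    exact SimpleGraph.Dart.ext _ _ (Prod.ext ((src_ofLink h).trans (src_ofLink h').symm) e)
  -- a face is determined by `v` and the edges at `v` that it traverses
  have hface : ∀ (c : K.toTwoComplex.LinkEdge v) (h h' : K.toTwoComplex.LinkEdge v × Bool),
      face h = face h' → (K.dart (ofLink h)).snd = (K.dart (ofLink (c, false))).snd →
      (K.dart (ofLink h')).snd = (K.dart (ofLink (c, true))).snd → face (c, false) = face h := by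
    intro c h h' e e1 e2
    have h1 : v ≠ (K.dart (ofLink (c, false))).snd := fun e =>
      (K.dart (ofLink (c, false))).adj.ne ((src_ofLink (c, false)).trans e)
    have h2 : v ≠ (K.dart (ofLink (c, true))).snd := fun e =>
      (K.dart (ofLink (c, true))).adj.ne ((src_ofLink (c, true)).trans e)
    have h3 : (K.dart (ofLink (c, false))).snd ≠ (K.dart (ofLink (c, true))).snd := fun e =>
      hne c (hsnd _ _ e)
    refine Subtype.ext (Finset.eq_of_card_eq_three (face (c, false)).2.2 (face h).2.2 h1 h2 h3
      (hmem (c, false)).1 (hmem (c, false)).2 (hmem (c, true)).2 (hmem h).1 ?_ ?_)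
    · exact Eq.mp (congrArg (· ∈ (face h).1) e1) (hmem h).2
    · exact Eq.mp (congrArg₂ (fun x (f : K.toTwoComplex.F) => x ∈ f.1) e2 e.symm) (hmem h').2
  have hd : ∀ h h' : K.toTwoComplex.LinkEdge v × Bool,
      (K.toTwoComplex.link v).vert h = (K.toTwoComplex.link v).vert h' →
      (K.dart (ofLink h)).snd = (K.dart (ofLink h')).snd := by
    intro h h' e
    have : K.dart (ofLink h) = K.dart (ofLink h') :=
      (vert_ofLink h).trans ((congrArg Subtype.val e).trans (vert_ofLink h').symm)
    rw [this]
  refine ⟨hne, fun c c' e => ?_⟩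
  rcases Sym2.eq_iff.1 e with ⟨h1, h2⟩ | ⟨h1, h2⟩
  · have hf := hface c (c', false) (c', true) rfl (hd (c', false) (c, false) h1.symm)
      (hd (c', true) (c, true) h2.symm)
    exact (Prod.ext_iff.1 (hinj (c, false) (c', false) hf h1)).1
  · have hf := hface c (c', true) (c', false) rfl (hd (c', true) (c, false) h1.symm)
      (hd (c', false) (c, true) h2.symm)
    exact absurd (Prod.ext_iff.1 (hinj (c, false) (c', true) hf h1)).2 Bool.false_ne_true

/-- In a stretched out complex an edge between two solid vertices is incident with more than two
faces. -/
theorem IsStretchedOut.isBranchDart (h : K.IsStretchedOut) {d : K.skeleton.Dart}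
    (h1 : K.IsSolid d.fst) (h2 : K.IsSolid d.snd) : K.IsBranchDart d := by
  intro hd
  obtain ⟨x, rfl | rfl, hx1, hx2⟩ := h d ((ncard_incident (C := K.toTwoComplex) d).trans hd)
  · exact h1.elim hx1 hx2
  · exact h2.elim hx1 hx2

theorem IsBranchDart.three_le {d : K.skeleton.Dart} (h : K.IsBranchDart d) (hd : K.IsSolid d.fst) :
    3 ≤ {h | K.dart h = d}.ncard := by
  have := three_le_ncard_of_ne_two (isSimple_link d.fst) hd (w := ⟨d, rfl⟩)
    ((ncard_link (C := K.toTwoComplex) (d := d) rfl).trans_ne h)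
  exact this.trans_eq (ncard_link (C := K.toTwoComplex) (d := d) rfl)

theorem IsBranchDart.symm {d : K.skeleton.Dart} (h : K.IsBranchDart d) : K.IsBranchDart d.symm :=
  fun hd => h ((congrArg Set.ncard (swap_image (C := K.toTwoComplex) d)).symm.trans
    ((Set.ncard_image_of_injective _ K.toTwoComplex.swap.injective).trans hd))

theorem eq_or_eq_symm_of_edge_eq {d s : K.skeleton.Dart} (h : d.edge = s.edge) :
    d = s ∨ d = s.symm :=
  SimpleGraph.dart_edge_eq_iff d s |>.1 h

variable [Finite ι]

instance : Finite K.skeleton.Dart :=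
  Finite.of_injective (fun d => d.toProd) fun _ _ => SimpleGraph.Dart.ext _ _

instance : Finite K.toTwoComplex.D := inferInstanceAs (Finite K.skeleton.Dart)

instance : Finite K.toTwoComplex.F := inferInstanceAs (Finite {_s : Finset ι // _})

/-! ### Splitting off a path of edges -/

theorem eq_of_invariant_off_dart {s : K.skeleton.Dart} (hx : K.IsSolid s.fst)
    (hs : K.IsBranchDart s) {g : K.toTwoComplex.Corner × Bool → ZMod 2}
    (hg : ∀ h, g (MultiGraph.flip _ h) = g h)
    (hgv : ∀ d : K.skeleton.Dart, d.fst = s.fst → d ≠ s → ∀ h h', K.dart h = d → K.dart h' = d →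
      g h = g h') {a b : K.toTwoComplex.Corner × Bool} (ha : K.dart a = s) (hb : K.dart b = s) :
    g a = g b := by
  refine TwoComplex.eq_of_invariant_off_dart (C := K.toTwoComplex) (isSimple_link s.fst) hx hs hg
    (fun h h' h1 h2 h3 => hgv (K.dart h) h2 h1 h h' rfl h3.symm) ha hb

/-- A function that is constant on each of the other darts at the path `P`, and
compatible with the exchange of the ends of the edges of `P`, is constant on the dart `s`. -/
theorem eq_of_invariant_along_path {w v : ι} (P : K.skeleton.Walk w v) (hP : P.IsPath)
    (hsolid : ∀ x ∈ P.support, K.IsSolid x)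
    (hdeg : ∀ d : K.skeleton.Dart, d.edge ∈ P.edges → K.IsBranchDart d)
    {s : K.skeleton.Dart} (hs : s.fst = w) (hsP : s.edge ∉ P.edges) (hsdeg : K.IsBranchDart s)
    {g : K.toTwoComplex.Corner × Bool → ZMod 2} (hg : ∀ h, g (MultiGraph.flip _ h) = g h)
    (hgv : ∀ d : K.skeleton.Dart, d.fst ∈ P.support → d ≠ s → d.edge ∉ P.edges →
      ∀ h h', K.dart h = d → K.dart h' = d → g h = g h')
    (hgs : ∀ h, (K.dart h).edge ∈ P.edges → g (K.toTwoComplex.swap h) = g h)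
    {a b : K.toTwoComplex.Corner × Bool} (ha : K.dart a = s) (hb : K.dart b = s) : g a = g b := by
  induction P generalizing s a b with
  | nil =>
    subst hs
    refine eq_of_invariant_off_dart (hsolid _ (by simp)) hsdeg hg (fun d h1 h2 => ?_) ha hb
    exact hgv d (by simp [h1]) h2 (by simp)
  | @cons w w' v hadj P ih =>
    obtain ⟨hP', hw⟩ := SimpleGraph.Walk.cons_isPath_iff _ _ |>.1 hP
    subst hs
    let t : K.skeleton.Dart := ⟨(s.fst, w'), hadj⟩
    have htP : t.edge ∉ P.edges := fun h => hw (P.fst_mem_support_of_mem_edges h)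
    have ht' : t.symm.edge ∉ P.edges := by rwa [SimpleGraph.Dart.edge_symm]
    have htc : t.edge ∈ (SimpleGraph.Walk.cons hadj P).edges := by
      rw [SimpleGraph.Walk.edges_cons]
      exact List.mem_cons_self
    have hsub : ∀ e ∈ P.edges, e ∈ (SimpleGraph.Walk.cons hadj P).edges := fun e he => by
      rw [SimpleGraph.Walk.edges_cons]
      exact List.mem_cons_of_mem _ he
    have hsubs : ∀ x ∈ P.support, x ∈ (SimpleGraph.Walk.cons hadj P).support := fun e he => by
      rw [SimpleGraph.Walk.support_cons]
      exact List.mem_cons_of_mem _ he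
    -- the path without its first edge settles the second end of that edge
    have hts : ∀ h h', K.dart h = t.symm → K.dart h' = t.symm → g h = g h' := by
      intro h h' hh hh'
      refine ih hP' (fun x hx => hsolid x (hsubs x hx)) (fun d hd => hdeg d (hsub _ hd)) rfl ht'
        (hdeg t htc).symm (fun d h1 h2 h3 => hgv d (hsubs _ h1) ?_ ?_)
        (fun k hk => hgs k (hsub _ hk)) hh hh'
      · rintro rfl
        exact hw h1
      · rw [SimpleGraph.Walk.edges_cons, List.mem_cons, not_or]
        refine ⟨fun e => ?_, h3⟩
        rcases eq_or_eq_symm_of_edge_eq (s := t) e with rfl | rfl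
        · exact hw h1
        · exact h2 rfl
    refine eq_of_invariant_off_dart (hsolid _ (by simp)) hsdeg hg (fun d h1 h2 h h' hh hh' => ?_)
      ha hb
    by_cases hd : d = t
    · subst hd
      rw [← hgs h (by rw [hh]; exact htc), ← hgs h' (by rw [hh']; exact htc)]
      exact hts _ _ (by rw [dart_swap, hh]) (by rw [dart_swap, hh'])
    · refine hgv d (by rw [h1]; simp) h2 ?_ h h' hh hh'
      rw [SimpleGraph.Walk.edges_cons, List.mem_cons, not_or]
      refine ⟨fun e => ?_, fun h3 => ?_⟩
      · rcases eq_or_eq_symm_of_edge_eq (s := t) e with rfl | rfl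
        · exact hd rfl
        · exact hadj.ne h1.symm
      · exact hw (by
          rw [← h1]
          exact P.fst_mem_support_of_mem_edges h3)

end AbstractSimplicialComplex

namespace AbstractSimplicialComplex

open MultiGraph TwoComplex

variable {ι : Type u} {K : AbstractSimplicialComplex ι} [Finite ι]

/-- If the edges of a path are merely exchange maps of their two ends, as after contraction, then
they can be given rotators, one edge after the other. -/
theorem exists_rotation_of_exchange_along_path {w v : ι} (P : K.skeleton.Walk w v) (hP : P.IsPath)
    (hsolid : ∀ x ∈ P.support, K.IsSolid x)
    (hdeg : ∀ d : K.skeleton.Dart, d.edge ∈ P.edges → K.IsBranchDart d)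
    {r : Perm (K.toTwoComplex.Corner × Bool)}
    (hr : ∀ d : K.skeleton.Dart, d.edge ∉ P.edges → r.IsCycleOn {h | K.dart h = d})
    (hrP : ∀ h, (K.dart h).edge ∈ P.edges → r h = K.toTwoComplex.swap h)
    (hJ : JordanProperty (MultiGraph.flip _) r) :
    ∃ r' : Perm (K.toTwoComplex.Corner × Bool), IsPlanarPrerotation r' ∧
      (∀ h, (K.dart h).edge ∉ P.edges → r' h = r h) ∧
      ∀ d : K.skeleton.Dart, d.edge ∈ P.edges → Opposite (C := K.toTwoComplex) r' d := by
  induction P generalizing r with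
  | nil =>
    exact ⟨r, ⟨fun d => hr d (by simp), hJ⟩, fun h _ => rfl, fun d hd => absurd hd (by simp)⟩
  | @cons w w' v hadj P ih =>
    obtain ⟨hP', hw⟩ := SimpleGraph.Walk.cons_isPath_iff _ _ |>.1 hP
    obtain ⟨s, hs⟩ : ∃ s : K.skeleton.Dart, s = ⟨(w, w'), hadj⟩ := ⟨_, rfl⟩
    have hs1 : s.fst = w := by rw [hs]
    have hs2 : s.snd = w' := by rw [hs]
    have hmem : ∀ e, e ∈ (SimpleGraph.Walk.cons hadj P).edges ↔ e = s.edge ∨ e ∈ P.edges := by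
      intro e
      rw [SimpleGraph.Walk.edges_cons, List.mem_cons, hs]
      rfl
    have hsP : s.edge ∉ P.edges := fun h => hw (by
      rw [hs] at h
      exact P.fst_mem_support_of_mem_edges h)
    have hss : s.symm.edge = s.edge := s.edge_symm
    have hsb : K.IsBranchDart s := hdeg s ((hmem _).2 (Or.inl rfl))
    have hne : s.symm ≠ s := s.symm_ne
    have hsubs : ∀ x ∈ P.support, x ∈ (SimpleGraph.Walk.cons hadj P).support := fun e he => by
      rw [SimpleGraph.Walk.support_cons]
      exact List.mem_cons_of_mem _ he
    -- the first edge is split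
    have hdartr : ∀ h, K.dart h ≠ s → K.dart h ≠ s.symm →
        ((K.dart (r h)).fst = w ↔ (K.dart h).fst = w) := by
      intro h h1 h2
      by_cases hh : (K.dart h).edge ∈ P.edges
      · have hfst : (K.dart h).fst ∈ P.support := P.fst_mem_support_of_mem_edges hh
        have hsnd : (K.dart h).snd ∈ P.support := P.snd_mem_support_of_mem_edges hh
        rw [hrP h ((hmem _).2 (Or.inr hh)), dart_swap]
        exact iff_of_false (fun e => hw (e ▸ hsnd)) (fun e => hw (e ▸ hfst))
      · have hh' : (K.dart h).edge ∉ (SimpleGraph.Walk.cons hadj P).edges := by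
          rw [hmem, not_or]
          exact ⟨fun e => (eq_or_eq_symm_of_edge_eq e).elim h1 h2, hh⟩
        have : K.dart (r h) = K.dart h := (hr (K.dart h) hh').apply_mem_iff.2 rfl
        rw [this]
    have hrs : ∀ h, K.dart h = s ∨ K.dart h = s.symm → r h = K.toTwoComplex.swap h := by
      intro h hh
      refine hrP h ((hmem _).2 (Or.inl ?_))
      rcases hh with hh | hh
      · rw [hh]
      · rw [hh, hss]
    have hinv : ∀ (g : K.toTwoComplex.Corner × Bool → ZMod 2),
        (∀ h, h ∉ {h | K.dart h = s} ∪ {h | K.dart h = s.symm} → g (r h) = g h) →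
        ∀ d : K.skeleton.Dart, d ≠ s → d ≠ s.symm → d.edge ∉ P.edges →
          ∀ h h', K.dart h = d → K.dart h' = d → g h = g h' := by
      intro g hg d h1 h2 h3 h h' hh hh'
      have hcyc := hr d (by
        rw [hmem, not_or]
        exact ⟨fun e => (eq_or_eq_symm_of_edge_eq e).elim h1 h2, h3⟩)
      obtain ⟨n, -, rfl⟩ := hcyc.exists_pow_eq' (Set.toFinite _) hh hh'
      clear hh'
      induction n with
      | zero => rfl
      | succ n ihn =>
        have hk : K.dart ((r ^ n) h) = d := by
          have := (hcyc.1.perm_pow n).mapsTo hh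
          exact this
        rw [pow_succ', Perm.mul_apply, hg _ ?_, ← ihn]
        rintro (e | e)
        · exact h1 (hk.symm.trans e)
        · exact h2 (hk.symm.trans e)
    obtain ⟨r₁, hr₁, hr₁s, hr₁o, hr₁J⟩ := JordanProperty.split (τ := MultiGraph.flip _) (r := r)
      (X := {h | (K.dart h).fst = w}) (N := {h | K.dart h = s}) (N' := {h | K.dart h = s.symm})
      (fun h => MultiGraph.flip_flip h) hJ
      (by rintro h hh; exact (congrArg (fun d : K.skeleton.Dart => d.fst) hh).trans hs1)
      (by
        rintro h hh hh'
        have hh : K.dart h = s.symm := hh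
        have hh' : (K.dart h).fst = w := hh'
        rw [hh] at hh'
        exact hadj.ne (hh'.symm.trans hs2))
      (by
        intro h hh
        have hh : K.dart h = s := hh
        rw [hrs h (Or.inl hh), Set.mem_ofPred_eq, dart_swap, hh])
      (by
        intro h hh
        have hh : K.dart h = s.symm := hh
        rw [hrs h (Or.inr hh), Set.mem_ofPred_eq, dart_swap, hh, SimpleGraph.Dart.symm_symm])
      (by
        intro h hh
        rw [hrs h hh, hrs, swap_swap]
        rw [dart_swap]
        rcases hh with hh | hh
        · exact Or.inr (congrArg _ hh)
        · exact Or.inl ((congrArg _ hh).trans s.symm_symm))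
      (by
        intro h
        rw [Set.mem_ofPred_eq, Set.mem_ofPred_eq, dart_flip_fst])
      (by
        intro h hh
        exact hdartr h (fun e => hh (Or.inl e)) (fun e => hh (Or.inr e)))
      (by
        intro g hg1 hg2 a ha b hb
        refine eq_of_invariant_off_dart (s := s) (hsolid _ (by rw [hs1]; simp)) hsb hg1
          (fun d h1 h2 => hinv g hg2 d h2 (fun e => ?_) fun h3 => ?_) ha hb
        · rw [e] at h1
          exact s.adj.ne h1.symm
        · exact hw (by rw [← hs1, ← h1]; exact P.fst_mem_support_of_mem_edges h3))
      (by
        intro g hg1 hg2 a ha b hb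
        refine eq_of_invariant_along_path P hP' (fun x hx => hsolid x (hsubs x hx))
          (fun d hd => hdeg d ((hmem _).2 (Or.inr hd))) (s := s.symm) hs2 (by rwa [hss]) hsb.symm hg1
          (fun d h1 h2 h3 => hinv g hg2 d (fun e => ?_) h2 h3) (fun h hh => ?_) ha hb
        · rw [e, hs1] at h1
          exact hw h1
        · rw [← hrP h ((hmem _).2 (Or.inr hh))]
          refine hg2 h ?_
          rintro (e | e)
          · exact hsP ((congrArg SimpleGraph.Dart.edge e) ▸ hh)
          · exact hsP (hss ▸ (congrArg SimpleGraph.Dart.edge e) ▸ hh))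
    have hr₁' : ∀ h, (K.dart h).edge ≠ s.edge → r₁ h = r h := fun h hh => by
      refine hr₁ h ?_
      rintro (e | e)
      · exact hh (congrArg SimpleGraph.Dart.edge e)
      · exact hh ((congrArg SimpleGraph.Dart.edge e).trans hss)
    have hoppN : ∀ h, K.dart h = s → r₁ (K.toTwoComplex.swap h) = K.toTwoComplex.swap (r₁⁻¹ h) := by
      intro h hh
      have := hr₁o h (Or.inl hh)
      rw [hrs h (Or.inl hh)] at this
      rw [this]
      exact hrs _ (Or.inl (hr₁s.inv.apply_mem_iff.2 hh))
    have hr₁s' : r₁.IsCycleOn {h | K.dart h = s.symm} := by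
      have := hr₁s.inv.image_of_semiconj K.toTwoComplex.swap hoppN
      rwa [show K.toTwoComplex.swap '' {h | K.dart h = s} = {h | K.dart h = s.symm} from
        swap_image (C := K.toTwoComplex) (s.symm : K.skeleton.Dart)] at this
    have hinvs : ∀ h, K.dart h = s ∨ K.dart h = s.symm →
        K.dart (r₁⁻¹ h) = s ∨ K.dart (r₁⁻¹ h) = s.symm := fun h hh =>
      hh.imp (fun hh => hr₁s.inv.apply_mem_iff.2 hh) fun hh => hr₁s'.inv.apply_mem_iff.2 hh
    have hopp : ∀ h, K.dart h = s ∨ K.dart h = s.symm →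
        r₁ (K.toTwoComplex.swap h) = K.toTwoComplex.swap (r₁⁻¹ h) := by
      intro h hh
      have := hr₁o h hh
      rw [hrs h hh] at this
      rw [this]
      exact hrs _ (hinvs h hh)
    have hcyc : ∀ d : K.skeleton.Dart, d.edge ∉ P.edges → r₁.IsCycleOn {h | K.dart h = d} := by
      intro d hd
      by_cases hds : d = s
      · rw [hds]
        exact hr₁s
      by_cases hds' : d = s.symm
      · rw [hds']
        exact hr₁s'
      · have hde : d.edge ≠ s.edge := fun e => (eq_or_eq_symm_of_edge_eq e).elim hds hds'
        refine (hr d (by rw [hmem, not_or]; exact ⟨hde, hd⟩)).congr_of_eq ?_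
        rintro h rfl
        exact hr₁' h hde
    obtain ⟨r', hr', hr'P, hr'o⟩ := ih hP' (fun x hx => hsolid x (hsubs x hx))
      (fun d hd => hdeg d ((hmem _).2 (Or.inr hd))) hcyc (fun h hh => by
        rw [hr₁' h (fun e => hsP (e ▸ hh)), hrP h ((hmem _).2 (Or.inr hh))]) hr₁J
    refine ⟨r', hr', fun h hh => ?_, fun d hd => ?_⟩
    · rw [hmem, not_or] at hh
      rw [hr'P h hh.2, hr₁' h hh.1]
    · rcases (hmem _).1 hd with hd | hd
      · intro h hh
        have hh : K.dart h = d := hh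
        have hh' : K.dart h = s ∨ K.dart h = s.symm := by
          rw [hh]
          exact eq_or_eq_symm_of_edge_eq hd
        have hedge : ∀ k, K.dart k = s ∨ K.dart k = s.symm → r' k = r₁ k := fun k hk => by
          refine hr'P k fun hkP => ?_
          rcases hk with hk | hk
          · exact hsP (by rwa [hk] at hkP)
          · exact hsP (by rwa [hk, hss] at hkP)
        have hinv' : r'⁻¹ h = r₁⁻¹ h := by
          rw [Perm.inv_eq_iff_eq, hedge _ (hinvs h hh')]
          simp
        rw [hinv', hedge _ (by
          rw [dart_swap]
          exact hh'.symm.imp (fun e => by rw [e, SimpleGraph.Dart.symm_symm]) fun e => by rw [e]),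
          hopp h hh']
      · exact hr'o d hd

/-- If the contraction of a path is planar at the contracted vertex, then there are planar rotators
that are reverse to each other at all edges with both ends on the path. -/
theorem exists_opposite_on_path {u v : ι} (P : K.skeleton.Walk u v) (hP : P.IsPath)
    (hsolid : ∀ x ∈ P.support, K.IsSolid x)
    (hdeg : ∀ d : K.skeleton.Dart, d.edge ∈ P.edges → K.IsBranchDart d)
    {r₀ : Perm (K.toTwoComplex.Corner × Bool)} (hr₀ : IsPlanarPrerotation r₀)
    (hplanar : (K.contractEdges {a | a ∈ P.edges}).IsLoopPlanarAt
      (K.contractVertex {a | a ∈ P.edges} u)) :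
    ∃ r : Perm (K.toTwoComplex.Corner × Bool), IsPlanarPrerotation r ∧
      ∀ d : K.skeleton.Dart, d.fst ∈ P.support → d.snd ∈ P.support →
        Opposite (C := K.toTwoComplex) r d := by
  have hquot : ∀ x ∈ P.support, (Quot.mk _ x : (K.contractEdges {a | a ∈ P.edges}).V) =
      K.contractVertex {a | a ∈ P.edges} u := by
    have key : ∀ {u v : ι} (Q : K.skeleton.Walk u v), (∀ a ∈ Q.edges, a ∈ P.edges) →
        ∀ x ∈ Q.support, (Quot.mk _ x : (K.contractEdges {a | a ∈ P.edges}).V) =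
          K.contractVertex {a | a ∈ P.edges} u := by
      intro u v Q
      induction Q with
      | nil =>
        intro _ x hx
        rw [SimpleGraph.Walk.support_nil, List.mem_singleton] at hx
        rw [hx]
        rfl
      | @cons u w v hadj Q ih =>
        intro hQ x hx
        rw [SimpleGraph.Walk.edges_cons] at hQ
        rw [SimpleGraph.Walk.support_cons, List.mem_cons] at hx
        rcases hx with rfl | hx
        · rfl
        · refine (ih (fun a ha => hQ a (List.mem_cons_of_mem _ ha)) x hx).trans ?_
          exact (Quot.sound ⟨(⟨(u, w), hadj⟩ : K.skeleton.Dart), hQ _ List.mem_cons_self,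
            rfl, rfl⟩).symm
    exact key P fun a ha => ha
  have hsrc := fun k => congrArg K.toTwoComplex.src (hr₀.1.vert_apply k)
  obtain ⟨r, hr1, hr2, hrJ, hr3⟩ := exists_rotation_of_contract (C := K.toTwoComplex)
    (S := {d : K.skeleton.Dart | d.edge ∈ P.edges})
    (fun d hd => (congrArg (· ∈ P.edges) (SimpleGraph.Dart.edge_symm d)).mpr hd)
    (v := K.contractVertex {a | a ∈ P.edges} u)
    (fun d hd => hquot _ (P.fst_mem_support_of_mem_edges hd)) hplanar hr₀.1
    fun x _ => (jordanProperty_iff_planarAt hsrc).1 hr₀.2 x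
  obtain ⟨r', hr', hr'P, hr'o⟩ := exists_rotation_of_exchange_along_path P hP hsolid hdeg
    (fun d hd => hr1 d hd) (fun h hh => hr2 h hh) hrJ
  refine ⟨r', hr', fun d h1 h2 => ?_⟩
  by_cases hd : d.edge ∈ P.edges
  · exact hr'o d hd
  · have ho := hr3 d hd (hquot _ h1) (hquot _ h2)
    intro h hh
    have hh : K.dart h = d := hh
    have hi : K.dart (r⁻¹ h) = d := (hr1 d hd).inv.apply_mem_iff.2 hh
    have hinv : r'⁻¹ h = r⁻¹ h := by
      rw [Perm.inv_eq_iff_eq, hr'P _ (by rw [hi]; exact hd)]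
      simp
    rw [hinv, hr'P _ (by rw [dart_swap, hh, SimpleGraph.Dart.edge_symm]; exact hd)]
    exact ho h hh

end AbstractSimplicialComplex

/-! ### Signs on the edges of a graph -/

namespace SimpleGraph

variable {V : Type*} {G : SimpleGraph V}

/-- The product of the signs of the edges of a walk. -/
def Walk.signProd (ω : V → V → ℤˣ) {u v : V} (p : G.Walk u v) : ℤˣ :=
  (p.darts.map fun d => ω d.fst d.snd).prod

theorem Walk.signProd_nil (ω : V → V → ℤˣ) (u : V) : (nil : G.Walk u u).signProd ω = 1 := rfl

theorem Walk.signProd_cons (ω : V → V → ℤˣ) {u v w : V} (h : G.Adj u v) (p : G.Walk v w) :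
    (cons h p).signProd ω = ω u v * p.signProd ω := by
  simp [signProd]

theorem Walk.signProd_append (ω : V → V → ℤˣ) {u v w : V} (p : G.Walk u v) (q : G.Walk v w) :
    (p.append q).signProd ω = p.signProd ω * q.signProd ω := by
  simp [signProd]

theorem Walk.signProd_reverse {ω : V → V → ℤˣ} (hω : ∀ x y, ω x y = ω y x) {u v : V}
    (p : G.Walk u v) : p.reverse.signProd ω = p.signProd ω := by
  induction p with
  | nil => rfl
  | @cons u v w h p ih =>
    rw [reverse_cons, signProd_append, ih, signProd_cons, signProd_cons, signProd_nil, hω v u,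
      mul_one, mul_comm]

theorem Walk.signProd_rotate [DecidableEq V] (ω : V → V → ℤˣ) {u v : V} (p : G.Walk u u)
    (hv : v ∈ p.support) : (p.rotate v hv).signProd ω = p.signProd ω :=
  ((p.rotate_darts v hv).perm.map _).prod_eq

/-- If the sign of each edge of a walk is the product of signs at its two ends, then the product
telescopes. -/
theorem Walk.signProd_eq_mul {ω : V → V → ℤˣ} {s : V → ℤˣ} {u v : V} (p : G.Walk u v)
    (h : ∀ d ∈ p.darts, ω d.fst d.snd = s d.fst * s d.snd) : p.signProd ω = s u * s v := by
  induction p with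
  | nil => rw [signProd_nil, Int.units_mul_self]
  | @cons u v w hadj p ih =>
    rw [signProd_cons, ih fun d hd => h d (by rw [darts_cons]; exact List.mem_cons_of_mem _ hd),
      show ω u v = s u * s v from h ⟨(u, v), hadj⟩ (by rw [darts_cons]; exact List.mem_cons_self),
      mul_assoc, ← mul_assoc (s v), Int.units_mul_self, one_mul]

/-- If all shorter closed walks have product `1`, then a walk can be replaced by a path with the
same product. -/
theorem Walk.exists_isPath_signProd_eq {ω : V → V → ℤˣ} {n : ℕ}
    (hn : ∀ (u : V) (o : G.Walk u u), o.length < n → o.signProd ω = 1) {u v : V} (p : G.Walk u v)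
    (hp : p.length < n) :
    ∃ q : G.Walk u v, q.IsPath ∧ q.length ≤ p.length ∧ q.signProd ω = p.signProd ω := by
  classical
  induction p with
  | nil => exact ⟨nil, IsPath.nil, le_rfl, rfl⟩
  | @cons u v w h p ih =>
    rw [length_cons] at hp
    obtain ⟨q, hq, hql, hqs⟩ := ih (by omega)
    by_cases hu : u ∈ q.support
    · refine ⟨q.dropUntil u hu, hq.dropUntil hu, ?_, ?_⟩
      · have := congrArg length (q.take_spec hu)
        rw [length_append] at this
        rw [length_cons]
        omega
      · have h1 := congrArg length (q.take_spec hu)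
        rw [length_append] at h1
        have h2 := congrArg (signProd ω) (q.take_spec hu)
        rw [signProd_append] at h2
        have h3 := hn u (cons h (q.takeUntil u hu)) (by rw [length_cons]; omega)
        rw [signProd_cons] at h3
        rw [signProd_cons, ← hqs, ← h2, ← mul_assoc, h3, one_mul]
    · refine ⟨cons h q, (cons_isPath_iff _ _).2 ⟨hq, hu⟩, ?_, ?_⟩
      · rw [length_cons, length_cons]
        omega
      · rw [signProd_cons, signProd_cons, hqs]

/-- A walk that avoids an edge between its ends has length at least two. -/
theorem Walk.two_le_length {u v : V} (p : G.Walk u v) (hne : u ≠ v) (h : s(u, v) ∉ p.edges) :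
    2 ≤ p.length := by
  cases p with
  | nil => exact absurd rfl hne
  | cons h' p =>
    cases p with
    | nil => simp at h
    | cons => simp

/-- The chordless cycles generate all closed walks. -/
theorem signProd_eq_one {ω : V → V → ℤˣ} (hω : ∀ x y, ω x y = ω y x)
    (h : ∀ (u : V) (o : G.Walk u u), o.IsCycle → o.IsChordless → o.signProd ω = 1) :
    ∀ (n : ℕ) (u : V) (o : G.Walk u u), o.length < n → o.signProd ω = 1 := by
  classical
  intro n
  induction n with
  | zero => intro u o ho; omega
  | succ n ih =>
    intro u o ho
    cases o with
    | nil => rfl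
    | @cons _ w _ hadj p =>
      rw [Walk.length_cons] at ho
      obtain ⟨q, hq, hql, hqs⟩ := Walk.exists_isPath_signProd_eq ih p (by omega)
      rw [Walk.signProd_cons, ← hqs, ← Walk.signProd_cons ω hadj]
      by_cases he : s(u, w) ∈ q.edges
      · -- the path `q` consists of the edge `uw`
        cases q with
        | nil => exact absurd rfl hadj.ne
        | @cons _ x _ hwx q =>
          rw [Walk.cons_isPath_iff] at hq
          rw [Walk.edges_cons, List.mem_cons] at he
          rcases he with he | he
          · have hux : u = x := by
              rcases Sym2.eq_iff.1 he with ⟨h1, -⟩ | ⟨h1, -⟩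
              · exact absurd h1 hadj.ne
              · exact h1
            subst hux
            rw [(Walk.isPath_iff_nil.1 hq.1).eq_nil, Walk.signProd_cons, Walk.signProd_cons,
              Walk.signProd_nil, mul_one, hω w u, Int.units_mul_self]
          · exact absurd (q.snd_mem_support_of_mem_edges he) hq.2
      have hcyc : (Walk.cons hadj q).IsCycle := (Walk.cons_isCycle_iff _ _).2 ⟨hq, he⟩
      by_cases hch : (Walk.cons hadj q).IsChordless
      · exact h u _ hcyc hch
      -- a chord splits the cycle into two shorter closed walks
      have hlen : (Walk.cons hadj q).length ≤ n := by
        rw [Walk.length_cons]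
        omega
      rw [Walk.isChordless_iff_forall_mem_edges] at hch
      push Not at hch
      obtain ⟨x, y, hx, hy, hxy, hxye⟩ := hch
      generalize Walk.cons hadj q = o at *
      have hy' : y ∈ (o.rotate x hx).support := (o.mem_support_rotate_iff x hx).2 hy
      have hxye' : s(x, y) ∉ (o.rotate x hx).edges := fun h' =>
        hxye ((o.rotate_edges x hx).mem_iff.1 h')
      have hlen' : (o.rotate x hx).length ≤ n := by
        have := (o.rotate_darts x hx).perm.length_eq
        rw [Walk.length_darts, Walk.length_darts] at this
        omega
      rw [← o.signProd_rotate ω hx]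
      generalize o.rotate x hx = o' at *
      have hspec := o'.take_spec hy'
      have hl := congrArg Walk.length hspec
      rw [Walk.length_append] at hl
      have h1 := (o'.takeUntil y hy').two_le_length hxy.ne fun h' =>
        hxye' (by rw [← hspec, Walk.edges_append]; exact List.mem_append_left _ h')
      have h2 := (o'.dropUntil y hy').two_le_length hxy.ne.symm fun h' =>
        hxye' (by
          rw [← hspec, Walk.edges_append, Sym2.eq_swap]
          exact List.mem_append_right _ h')
      have h3 := ih y (Walk.cons hxy.symm (o'.takeUntil y hy')) (by rw [Walk.length_cons]; omega)
      have h4 := ih x (Walk.cons hxy (o'.dropUntil y hy')) (by rw [Walk.length_cons]; omega)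
      rw [Walk.signProd_cons] at h3 h4
      rw [← hspec, Walk.signProd_append]
      calc _ = ω x y * ω x y *
            ((o'.takeUntil y hy').signProd ω * (o'.dropUntil y hy').signProd ω) := by
            rw [Int.units_mul_self, one_mul]
        _ = (ω x y * (o'.takeUntil y hy').signProd ω) *
            (ω x y * (o'.dropUntil y hy').signProd ω) := mul_mul_mul_comm _ _ _ _
        _ = 1 := by rw [h4, hω x y, h3, one_mul]

/-- Signs on the edges whose product along every chordless cycle is `1` come from signs at the
vertices. -/
theorem exists_potential {ω : V → V → ℤˣ} (hω : ∀ x y, ω x y = ω y x)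
    (h : ∀ (u : V) (o : G.Walk u u), o.IsCycle → o.IsChordless → o.signProd ω = 1) :
    ∃ s : V → ℤˣ, ∀ x y, G.Adj x y → ω x y = s x * s y := by
  have hbase : ∀ x, ∃ a : ℤˣ, ∀ c, (G.connectedComponentMk x).out = c →
      ∃ p : G.Walk c x, p.signProd ω = a := by
    intro x
    have hr : G.Reachable (G.connectedComponentMk x).out x :=
      ConnectedComponent.exact (Quot.out_eq _)
    obtain ⟨p⟩ := hr
    exact ⟨p.signProd ω, by rintro c rfl; exact ⟨p, rfl⟩⟩
  choose s hs using hbase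
  refine ⟨s, fun x y hxy => ?_⟩
  have hc : G.connectedComponentMk x = G.connectedComponentMk y :=
    ConnectedComponent.sound hxy.reachable
  obtain ⟨p, hp⟩ := hs x _ rfl
  obtain ⟨q, hq⟩ := hs y _ (by rw [← hc])
  have := signProd_eq_one hω h _ _ (p.append (Walk.cons hxy q.reverse)) (Nat.lt_succ_self _)
  rw [Walk.signProd_append, Walk.signProd_cons, Walk.signProd_reverse hω, hp, hq] at this
  have h2 := eq_inv_of_mul_eq_one_right this
  rw [Int.units_inv_eq_self] at h2
  rw [← h2, mul_assoc, Int.units_mul_self, mul_one]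

/-! ### Paths through vertices with two neighbours -/

theorem Walk.IsPath.exists_two_edges {u v x : V} {p : G.Walk u v} (hp : p.IsPath)
    (hx : x ∈ p.support) (hu : x ≠ u) (hv : x ≠ v) :
    ∃ y z, y ≠ z ∧ s(x, y) ∈ p.edges ∧ s(x, z) ∈ p.edges := by
  obtain ⟨i, rfl, hi⟩ := Walk.mem_support_iff_exists_getVert.1 hx
  have hi0 : i ≠ 0 := fun h => hu (by rw [h, Walk.getVert_zero])
  have hil : i ≠ p.length := fun h => hv (by rw [h, Walk.getVert_length])
  have h2 := hp.ncard_neighborSet_toSubgraph_internal_eq_two hi0 (by omega)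
  obtain ⟨y, z, hyz, hset⟩ := Set.ncard_eq_two.1 h2
  have hmem : ∀ w ∈ p.toSubgraph.neighborSet (p.getVert i), s(p.getVert i, w) ∈ p.edges :=
    fun w hw => Walk.adj_toSubgraph_iff_mem_edges.1 hw
  exact ⟨y, z, hyz, hmem y (by rw [hset]; simp), hmem z (by rw [hset]; simp)⟩

/-- A vertex `b` satisfying `B` lies on a path inside `S` whose inner vertices satisfy `B` and which
contains all neighbours in `S` of its vertices that satisfy `B`; here each vertex satisfying `B`
is assumed to have at most two neighbours in `S`. -/
theorem exists_maximal_path [Finite V] {S B : V → Prop} (hBS : ∀ x, B x → S x)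
    (hB : ∀ x, B x → ∃ y z, ∀ w, G.Adj x w → S w → w = y ∨ w = z) {b : V} (hb : B b) :
    ∃ (u v : V) (p : G.Walk u v), p.IsPath ∧ b ∈ p.support ∧ (∀ x ∈ p.support, S x) ∧
      (∀ x ∈ p.support, x ≠ u → x ≠ v → B x) ∧
      ∀ x ∈ p.support, B x → ∀ y, G.Adj x y → S y →
        y ∈ p.support ∧ (s(x, y) ∈ p.edges ∨ x = u ∧ y = v ∨ x = v ∧ y = u) := by
  classical
  have := Fintype.ofFinite V
  let Q : ∀ {u v : V}, G.Walk u v → Prop := fun {u v} p => p.IsPath ∧ b ∈ p.support ∧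
    (∀ x ∈ p.support, S x) ∧ ∀ x ∈ p.support, x ≠ u → x ≠ v → B x
  let L : Set ℕ := {n | ∃ (u v : V) (p : G.Walk u v), Q p ∧ p.length = n}
  have hL : BddAbove L := ⟨Fintype.card V, by
    rintro n ⟨u, v, p, hp, rfl⟩
    exact hp.1.length_lt.le⟩
  obtain ⟨u, v, p, hp, hlen⟩ : sSup L ∈ L := Nat.sSup_mem
    ⟨0, b, b, Walk.nil, ⟨Walk.IsPath.nil, by simp, by simpa using hBS b hb, by simp⟩, rfl⟩ hL
  -- a longest path contains all neighbours of its last vertex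
  have hend : ∀ {u v : V} (p : G.Walk u v), Q p → p.length = sSup L → B v → ∀ y, G.Adj v y → S y →
      y ∈ p.support := by
    intro u v p hp hlen hv y hvy hy
    by_contra hyp
    have : (p.concat hvy).length ∈ L := by
      refine ⟨u, y, p.concat hvy, ⟨hp.1.concat hyp hvy, ?_, fun x hx => ?_, fun x hx h1 h2 => ?_⟩,
        rfl⟩
      · rw [Walk.support_concat]
        simp [hp.2.1]
      · rw [Walk.support_concat] at hx
        simp only [List.mem_append, List.mem_singleton] at hx
        rcases hx with hx | rfl
        · exact hp.2.2.1 x hx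
        · exact hy
      · rw [Walk.support_concat] at hx
        simp only [List.mem_append, List.mem_singleton] at hx
        by_cases hxv : x = v
        · rw [hxv]
          exact hv
        · exact hp.2.2.2 x (hx.resolve_right h2) h1 hxv
    have h3 := le_csSup hL this
    rw [Walk.length_concat] at h3
    omega
  have hrev : Q p.reverse := ⟨hp.1.reverse, by simpa using hp.2.1,
    fun x hx => hp.2.2.1 x (by simpa using hx),
    fun x hx h1 h2 => hp.2.2.2 x (by simpa using hx) h2 h1⟩
  have hinner : ∀ x ∈ p.support, x ≠ u → x ≠ v → ∀ y, G.Adj x y → S y → s(x, y) ∈ p.edges := by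
    intro x hx hu hv y hxy hy
    obtain ⟨y₁, y₂, hne, h1, h2⟩ := hp.1.exists_two_edges hx hu hv
    obtain ⟨z₁, z₂, hz⟩ := hB x (hp.2.2.2 x hx hu hv)
    have e1 := hz y₁ (p.adj_of_mem_edges h1) (hp.2.2.1 _ (p.snd_mem_support_of_mem_edges h1))
    have e2 := hz y₂ (p.adj_of_mem_edges h2) (hp.2.2.1 _ (p.snd_mem_support_of_mem_edges h2))
    have e := hz y hxy hy
    have : y = y₁ ∨ y = y₂ := by grind
    rcases this with rfl | rfl <;> assumption
  refine ⟨u, v, p, hp.1, hp.2.1, hp.2.2.1, hp.2.2.2, fun x hx hBx y hxy hy => ?_⟩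
  have hyp : y ∈ p.support := by
    by_cases hxv : x = v
    · subst hxv
      exact hend p hp hlen hBx y hxy hy
    by_cases hxu : x = u
    · subst hxu
      simpa using hend p.reverse hrev (by rw [Walk.length_reverse, hlen]) hBx y hxy hy
    exact p.snd_mem_support_of_mem_edges (hinner x hx hxu hxv y hxy hy)
  refine ⟨hyp, ?_⟩
  by_cases hxi : x = u ∨ x = v
  · by_cases hyi : y = u ∨ y = v
    · right
      have := hxy.ne
      grind
    · rw [not_or] at hyi
      left
      rw [Sym2.eq_swap]
      exact hinner y hyp hyi.1 hyi.2 x hxy.symm (hBS x hBx)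
  · rw [not_or] at hxi
    exact Or.inl (hinner x hx hxi.1 hxi.2 y hxy hy)

end SimpleGraph

/-! ### Rotators at the two ends of an edge -/

namespace TwoComplex

open MultiGraph

variable {C : TwoComplex.{u}}

theorem zpow_units_zpow_units {H : Type*} (r : Perm H) (a b : ℤˣ) :
    (r ^ (a : ℤ)) ^ (b : ℤ) = r ^ ((a * b : ℤˣ) : ℤ) := by
  rw [← zpow_mul, Units.val_mul]

/-- The rotator at the reverse of the dart `d` is the reverse of the rotator at `d` if `w = 1`, and
it is the same if `w = -1`. -/
def HasTwist (r : Perm (C.Corner × Bool)) (w : ℤˣ) (d : C.D) : Prop :=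
  ∀ h, C.totalLink.vert h = d → r (C.swap h) = C.swap ((r ^ ((-w : ℤˣ) : ℤ)) h)

theorem hasTwist_one {r : Perm (C.Corner × Bool)} {d : C.D} : HasTwist r 1 d ↔ Opposite r d := by
  simp [HasTwist, Opposite]

theorem IsPlanarPrerotation.units_zpow {r : Perm (C.Corner × Bool)} (h : IsPlanarPrerotation r)
    (a : ℤˣ) : IsPlanarPrerotation (r ^ (a : ℤ)) := by
  rcases Int.units_eq_one_or a with rfl | rfl
  · simpa using h
  · simpa using h.inv

theorem vert_units_zpow {r : Perm (C.Corner × Bool)} (hr : C.totalLink.IsRotationSystem r) (a : ℤˣ)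
    (h : C.Corner × Bool) :
    C.totalLink.vert ((r ^ (a : ℤ)) h) = C.totalLink.vert h := by
  rcases Int.units_eq_one_or a with rfl | rfl
  · simpa using hr.vert_apply h
  · simpa using hr.inv.vert_apply h

theorem EqAt.units_zpow {r r' : Perm (C.Corner × Bool)} (hr : C.totalLink.IsRotationSystem r)
    {v : C.V} (h : EqAt r r' v) (a : ℤˣ) : EqAt (r ^ (a : ℤ)) (r' ^ (a : ℤ)) v := by
  rcases Int.units_eq_one_or a with rfl | rfl
  · simpa using h
  · intro k hk
    have := h (r⁻¹ k) (by rw [hr.inv.vert_apply, hk])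
    rw [show r (r⁻¹ k) = k by simp] at this
    simp only [Units.val_neg, Units.val_one, zpow_neg, zpow_one]
    rw [Perm.inv_eq_iff_eq, this]

theorem HasTwist.units_zpow {r : Perm (C.Corner × Bool)} (hr : C.totalLink.IsRotationSystem r)
    {w : ℤˣ} {d : C.D} (hw : HasTwist r w d) (b : ℤˣ) {h : C.Corner × Bool}
    (hh : C.totalLink.vert h = d) :
    (r ^ (b : ℤ)) (C.swap h) = C.swap ((r ^ ((-(w * b) : ℤˣ) : ℤ)) h) := by
  rcases Int.units_eq_one_or b with rfl | rfl
  · simpa using hw h hh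
  · have := hw ((r ^ (w : ℤ)) h) (by rw [vert_units_zpow hr, hh])
    rw [show (r ^ ((-w : ℤˣ) : ℤ)) ((r ^ (w : ℤ)) h) = h by
      rw [Units.val_neg, zpow_neg]
      simp] at this
    simp only [mul_neg, mul_one, neg_neg, Units.val_neg, Units.val_one, zpow_neg, zpow_one]
    rw [Perm.inv_eq_iff_eq, this]

theorem HasTwist.rev {r : Perm (C.Corner × Bool)} (hr : C.totalLink.IsRotationSystem r)
    {w : ℤˣ} {d : C.D} (hw : HasTwist r w d) : HasTwist r w (C.rev d) := by
  intro k hk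
  obtain ⟨k, rfl⟩ : ∃ k', k = C.swap k' := ⟨C.swap k, by simp⟩
  rw [vert_swap] at hk
  have hk : C.totalLink.vert k = d := by rw [← C.rev_rev d, ← hk, C.rev_rev]
  rw [hw.units_zpow hr (-w) hk, swap_swap, swap_swap]
  simp

/-- The twist of an edge changes by the signs that relate the rotators at its two ends to the new
ones. -/
theorem HasTwist.transfer {q r : Perm (C.Corner × Bool)} (hq : C.totalLink.IsRotationSystem q)
    {w a b : ℤˣ} {d : C.D} (hw : HasTwist q w d) (ha : EqAt (q ^ (a : ℤ)) r (C.src d))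
    (hb : EqAt (q ^ (b : ℤ)) r (C.tgt d)) : HasTwist r (w * a * b) d := by
  rintro h rfl
  have hqa : C.totalLink.IsRotationSystem (q ^ (a : ℤ)) := by
    rcases Int.units_eq_one_or a with rfl | rfl
    · simpa using hq
    · simpa using hq.inv
  rw [hb _ (by rw [vert_swap]; rfl), hw.units_zpow hq b rfl, ha.units_zpow hqa _ h rfl,
    zpow_units_zpow_units]
  congr 4
  rw [mul_neg, mul_comm w a, mul_assoc, ← mul_assoc a a, Int.units_mul_self, one_mul]

/-- A cyclic permutation of at least three elements differs from its inverse, so the twist of an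
edge in at least three faces is well defined. -/
theorem HasTwist.unique [Finite C.D] [Finite C.F] {r : Perm (C.Corner × Bool)}
    (hr : C.totalLink.IsRotationSystem r) {w w' : ℤˣ} {d : C.D}
    (hd : 3 ≤ {h | C.totalLink.vert h = d}.ncard) (hw : HasTwist r w d) (hw' : HasTwist r w' d) :
    w = w' := by
  classical
  have key : ¬ (HasTwist r 1 d ∧ HasTwist r (-1) d) := by
    rintro ⟨h1, h2⟩
    obtain ⟨h, -, hh⟩ := exists_half_notMem hd ∅ (by simp)
    obtain ⟨k, hk, hkd⟩ := exists_half_notMem hd {h, r h} Finset.card_le_two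
    have e : r⁻¹ h = r h := by
      have := (h1 h hh).symm.trans (h2 h hh)
      simpa using C.swap.injective this
    have e2 : r (r h) = h := by
      rw [← e]
      simp
    have := hr.eq_or_eq_of_apply_apply_eq (hkd.trans hh.symm) e2
    simp only [Finset.mem_insert, Finset.mem_singleton] at hk
    exact hk this
  rcases Int.units_eq_one_or w with rfl | rfl <;> rcases Int.units_eq_one_or w' with rfl | rfl
  · rfl
  · exact absurd ⟨hw, hw'⟩ key
  · exact absurd ⟨hw', hw⟩ key
  · rfl

theorem IsPlanarPrerotation.exists_eqAt_units_zpow [Finite C.D] [Finite C.F]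
    {q r : Perm (C.Corner × Bool)}
    (hq : IsPlanarPrerotation q) (hr : IsPlanarPrerotation r) {v : C.V}
    (hL : (C.link v).IsSimple) (h : (C.link v).toSimpleGraph.IsSubdivisionOfThreeConnected) :
    ∃ a : ℤˣ, EqAt (q ^ (a : ℤ)) r v := by
  rcases hq.eqAt_or_eqAt_inv hr hL h with h | h
  · exact ⟨1, by simpa using h⟩
  · exact ⟨-1, by simpa using h⟩

end TwoComplex

namespace AbstractSimplicialComplex

open MultiGraph TwoComplex

variable {ι : Type u} {K : AbstractSimplicialComplex ι}

variable (K) in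
/-- The link graph at `x` is a parallel graph with branch vertices of degree at least three, and not
a subdivision of a `3`-connected graph. -/
def IsParallelAt (x : ι) : Prop :=
  (K.linkGraph x).IsThickParallelGraph ∧ ¬ (K.linkGraph x).IsSubdivisionOfThreeConnected

theorem IsParallelAt.isSolid {x : ι} (h : K.IsParallelAt x) : K.IsSolid x := Or.inr h.1

theorem IsSolid.isSubdivision {x : ι} (h : K.IsSolid x) (h' : ¬ K.IsParallelAt x) :
    (K.linkGraph x).IsSubdivisionOfThreeConnected := by
  by_contra hA
  exact h' ⟨h.resolve_left hA, hA⟩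

/-- A vertex with a parallel link is joined to at most two solid vertices. -/
theorem IsParallelAt.exists_neighbours (hstr : K.IsStretchedOut) {x : ι} (h : K.IsParallelAt x) :
    ∃ y z, ∀ w, K.skeleton.Adj x w → K.IsSolid w → w = y ∨ w = z := by
  obtain ⟨d₁, d₂, hd⟩ := exists_branch_of_isThickParallelGraph
    (isSimple_link (K := K) x) h.1
  let e₁ : K.skeleton.Dart := d₁.1
  let e₂ : K.skeleton.Dart := d₂.1
  refine ⟨e₁.snd, e₂.snd, fun w hxw hw => ?_⟩
  let d : K.skeleton.Dart := ⟨(x, w), hxw⟩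
  have hdb : K.IsBranchDart d := hstr.isBranchDart h.isSolid hw
  refine (hd ⟨d, rfl⟩ ((ncard_link (C := K.toTwoComplex) (d := d) rfl).trans_ne hdb)).imp ?_ ?_
  · exact fun e => congrArg (fun d : K.skeleton.Dart => d.snd) (congrArg Subtype.val e)
  · exact fun e => congrArg (fun d : K.skeleton.Dart => d.snd) (congrArg Subtype.val e)

theorem IsStretchedOut.isBranchDart_of_mem_edges (hstr : K.IsStretchedOut) {u v : ι}
    {P : K.skeleton.Walk u v} (hP : ∀ x ∈ P.support, K.IsSolid x) (d : K.skeleton.Dart)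
    (hd : d.edge ∈ P.edges) : K.IsBranchDart d :=
  hstr.isBranchDart (hP _ (P.fst_mem_support_of_mem_edges hd))
    (hP _ (P.snd_mem_support_of_mem_edges hd))

variable [Finite ι]

/-- If the contraction of a para-path is planar at the new vertex, then there are planar rotators
that are reverse to each other at all edges with both ends on the path. -/
theorem IsParaPath.exists_opposite (hstr : K.IsStretchedOut)
    {r₀ : Perm (K.toTwoComplex.Corner × Bool)} (hr₀ : IsPlanarPrerotation r₀) {u v : ι}
    {P : K.skeleton.Walk u v} (hP : K.IsParaPath P)
    (hplanar : (K.contractEdges {a | a ∈ P.edges}).IsLoopPlanarAt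
      (K.contractVertex {a | a ∈ P.edges} u)) :
    ∃ r : Perm (K.toTwoComplex.Corner × Bool), IsPlanarPrerotation r ∧
      ∀ d : K.skeleton.Dart, d.fst ∈ P.support → d.snd ∈ P.support →
        Opposite (C := K.toTwoComplex) r d := by
  have hsolid : ∀ x ∈ P.support, K.IsSolid x := by
    intro x hx
    by_cases hu : x = u
    · rw [hu]
      exact Or.inl hP.2.1
    by_cases hv : x = v
    · rw [hv]
      exact Or.inl hP.2.2.1
    exact Or.inr (hP.2.2.2 x hx hu hv)
  exact exists_opposite_on_path P hP.1 hsolid (hstr.isBranchDart_of_mem_edges hsolid) hr₀ hplanar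

variable (K) in
/-- For all chordless cycles `o` and edges `e` of `o`, the contraction of `o - e` is locally
planar. -/
def CyclesContractPlanar : Prop :=
  ∀ (u : ι) (o : K.skeleton.Walk u u), o.IsCycle → o.IsChordless → ∀ e ∈ o.edges,
    (∃ e' ∈ o.edges, e' ≠ e) → (K.contractEdges {a | a ∈ o.edges ∧ a ≠ e}).IsLocallyPlanar

/-- For a chordless cycle through solid vertices there are planar rotators that are reverse to each
other at all of its edges, the edge that is not contracted included. -/
theorem CyclesContractPlanar.exists_opposite (hcyc : K.CyclesContractPlanar)
    (hstr : K.IsStretchedOut)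
    {r₀ : Perm (K.toTwoComplex.Corner × Bool)} (hr₀ : IsPlanarPrerotation r₀) {u v : ι}
    (hadj : K.skeleton.Adj v u) (P : K.skeleton.Walk u v)
    (hP : (SimpleGraph.Walk.cons hadj P).IsCycle) (hch : (SimpleGraph.Walk.cons hadj P).IsChordless)
    (hsolid : ∀ x ∈ P.support, K.IsSolid x) :
    ∃ r : Perm (K.toTwoComplex.Corner × Bool), IsPlanarPrerotation r ∧
      ∀ d : K.skeleton.Dart, d.fst ∈ P.support → d.snd ∈ P.support →
        Opposite (C := K.toTwoComplex) r d := by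
  obtain ⟨hPp, he⟩ := (SimpleGraph.Walk.cons_isCycle_iff _ _).1 hP
  have hset : {a | a ∈ (SimpleGraph.Walk.cons hadj P).edges ∧ a ≠ s(v, u)} = {a | a ∈ P.edges} := by
    ext a
    simp only [SimpleGraph.Walk.edges_cons, List.mem_cons, Set.mem_ofPred_eq]
    constructor
    · rintro ⟨rfl | h, h'⟩
      · exact absurd rfl h'
      · exact h
    · intro h
      exact ⟨Or.inr h, fun e => he (e ▸ h)⟩
  have hloc := hcyc v _ hP hch s(v, u) (by simp) (by
    have hne : P.edges ≠ [] := fun h => by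
      have : P.length = 0 := by rw [← SimpleGraph.Walk.length_edges, h, List.length_nil]
      exact hadj.ne (P.eq_of_length_eq_zero this).symm
    obtain ⟨e', he'⟩ := List.exists_mem_of_ne_nil _ hne
    exact ⟨e', by simp [he'], fun e => he (e ▸ he')⟩)
  rw [hset] at hloc
  exact exists_opposite_on_path P hPp hsolid (hstr.isBranchDart_of_mem_edges hsolid) hr₀ (hloc _)

/-- Along a path whose vertices, apart from the first one, have parallel links, the rotators can be
made reverse to each other one link after the other. -/
theorem exists_opposite_of_isParallelAt (hstr : K.IsStretchedOut)
    {r₀ : Perm (K.toTwoComplex.Corner × Bool)} (hr₀ : IsPlanarPrerotation r₀) {u v : ι}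
    (P : K.skeleton.Walk u v) (hP : P.IsPath) (hu : K.IsSolid u)
    (hpar : ∀ x ∈ P.support, x ≠ u → K.IsParallelAt x) :
    ∃ r : Perm (K.toTwoComplex.Corner × Bool), IsPlanarPrerotation r ∧
      (∀ x, x ∉ P.support ∨ x = u → EqAt (C := K.toTwoComplex) r₀ r x) ∧
      ∀ d : K.skeleton.Dart, d.edge ∈ P.edges → Opposite (C := K.toTwoComplex) r d := by
  induction P generalizing r₀ with
  | nil => exact ⟨r₀, hr₀, fun x _ h _ => rfl, fun d hd => absurd hd (by simp)⟩
  | @cons u w v hadj P ih =>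
    obtain ⟨hP', hw⟩ := SimpleGraph.Walk.cons_isPath_iff _ _ |>.1 hP
    have hsubs : ∀ x ∈ P.support, x ∈ (SimpleGraph.Walk.cons hadj P).support := fun e he => by
      rw [SimpleGraph.Walk.support_cons]
      exact List.mem_cons_of_mem _ he
    have hpw : K.IsParallelAt w := hpar w (hsubs w P.start_mem_support) hadj.ne.symm
    obtain ⟨d, hd⟩ : ∃ d : K.skeleton.Dart, d = ⟨(w, u), hadj.symm⟩ := ⟨_, rfl⟩
    have hd1 : d.fst = w := by rw [hd]
    have hd2 : d.snd = u := by rw [hd]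
    have hpd : K.IsParallelAt d.fst := hd1 ▸ hpw
    have hdb : K.IsBranchDart d := hstr.isBranchDart hpd.isSolid (hd2 ▸ hu)
    let π : Perm (K.toTwoComplex.Corner × Bool) := K.toTwoComplex.swap * r₀⁻¹ * K.toTwoComplex.swap
    have hπ : π.IsCycleOn {h | K.dart h = d} := by
      have := (hr₀.1.inv (K.toTwoComplex.rev d)).image_of_semiconj (π' := π) K.toTwoComplex.swap
        fun k _ => by
          simp only [π, Perm.mul_apply, swap_swap]
      exact (congrArg π.IsCycleOn (swap_image (C := K.toTwoComplex) d)).mp this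
    obtain ⟨r₁, hr₁, hr₁e, hr₁d⟩ := hr₀.exists_prescribed (d := d) (isSimple_link _) hpd.1 hdb hπ
    obtain ⟨r, hr, hre, hro⟩ := ih hr₁ hP' hpw.isSolid fun x hx hxw =>
      hpar x (hsubs x hx) fun e => hw (e ▸ hx)
    have he : ∀ x, x ∉ P.support → EqAt (C := K.toTwoComplex) r₀ r x := by
      intro x hx h hh
      have hxw : x ≠ K.toTwoComplex.src d := fun e => hx (by
        rw [e]
        exact hd1 ▸ P.start_mem_support)
      rw [hre x (Or.inl hx) h hh, hr₁e x hxw h hh]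
    have hod : Opposite (C := K.toTwoComplex) r d := by
      refine (opposite_iff hr.1).2 fun h hh => ?_
      have hsrc : K.toTwoComplex.src (K.toTwoComplex.totalLink.vert h) = w := by
        rw [hh]
        exact hd1
      have hsrc' : K.toTwoComplex.src
          (K.toTwoComplex.totalLink.vert (r₀⁻¹ (K.toTwoComplex.swap h))) = u := by
        rw [hr₀.1.inv.vert_apply, vert_swap, hh]
        exact hd2
      rw [hre w (Or.inr rfl) h hsrc, hr₁d h hh]
      change r (K.toTwoComplex.swap (K.toTwoComplex.swap (r₀⁻¹ (K.toTwoComplex.swap h)))) = _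
      rw [swap_swap, he u hw _ hsrc']
      simp
    refine ⟨r, hr, fun x hx => he x ?_, fun d' hd' => ?_⟩
    · rcases hx with hx | rfl
      · exact fun h => hx (hsubs x h)
      · exact hw
    · rw [SimpleGraph.Walk.edges_cons, List.mem_cons] at hd'
      rcases hd' with hd' | hd'
      · rcases eq_or_eq_symm_of_edge_eq (s := d) (hd'.trans (by rw [hd]; exact Sym2.eq_swap))
          with rfl | rfl
        · exact hod
        · exact hod.rev hr.1
      · exact hro d' hd'

variable (K) in
/-- The graph of the edges between vertices with parallel links. -/
def parallelGraph : SimpleGraph ι where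
  Adj x y := K.skeleton.Adj x y ∧ K.IsParallelAt x ∧ K.IsParallelAt y
  symm := ⟨fun _ _ h => ⟨h.1.symm, h.2.2, h.2.1⟩⟩
  loopless := ⟨fun _ h => h.1.ne rfl⟩

variable (K) in
/-- For all para-paths `P`, the contraction of `P` is planar at the contracted vertex. -/
def ParaPathsContractPlanar : Prop :=
  ∀ (u v : ι) (P : K.skeleton.Walk u v), K.IsParaPath P →
    (K.contractEdges {a | a ∈ P.edges}).IsLoopPlanarAt (K.contractVertex {a | a ∈ P.edges} u)

/-- There are planar rotators that are reverse to each other at all edges, to solid vertices, of a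
component of the graph of the vertices with parallel links. These edges form a path or a cycle.
If they form a path between vertices whose links are not parallel, then it is a para-path; if they
form a path that has an end with parallel link, then the rotators can be chosen one by one. -/
theorem exists_opposite_component (hstr : K.IsStretchedOut)
    {r₀ : Perm (K.toTwoComplex.Corner × Bool)} (hr₀ : IsPlanarPrerotation r₀)
    (hpath : K.ParaPathsContractPlanar) (hcyc : K.CyclesContractPlanar) {b : ι}
    (hb : K.IsParallelAt b) :
    ∃ r : Perm (K.toTwoComplex.Corner × Bool), IsPlanarPrerotation r ∧
      ∀ x, K.parallelGraph.Reachable b x → ∀ d : K.skeleton.Dart, d.fst = x → K.IsSolid d.snd →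
        Opposite (C := K.toTwoComplex) r d := by
  obtain ⟨u, v, P, hP, hbP, hS, hB, hnb⟩ := SimpleGraph.exists_maximal_path (G := K.skeleton)
    (S := K.IsSolid) (B := K.IsParallelAt) (fun x hx => hx.isSolid)
    (fun x hx => hx.exists_neighbours hstr) hb
  suffices h : ∃ r : Perm (K.toTwoComplex.Corner × Bool), IsPlanarPrerotation r ∧
      ∀ d : K.skeleton.Dart, d.fst ∈ P.support → K.IsParallelAt d.fst → K.IsSolid d.snd →
        Opposite (C := K.toTwoComplex) r d by
    obtain ⟨r, hr, hro⟩ := h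
    refine ⟨r, hr, fun x hx d hd hds => ?_⟩
    obtain ⟨p⟩ := hx
    have hx : x ∈ P.support ∧ K.IsParallelAt x := by
      clear hd
      induction p with
      | nil => exact ⟨hbP, hb⟩
      | cons h p ih => exact ih h.2.2 (hnb _ hbP hb _ h.1 h.2.2.isSolid).1
    exact hro d (hd ▸ hx.1) (hd ▸ hx.2) hds
  by_cases huv : ¬ K.IsParallelAt u ∧ ¬ K.IsParallelAt v
  · have hpp : K.IsParaPath P := ⟨hP, (hS u P.start_mem_support).isSubdivision huv.1,
      (hS v P.end_mem_support).isSubdivision huv.2, fun x hx h1 h2 => (hB x hx h1 h2).1⟩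
    obtain ⟨r, hr, hro⟩ := hpp.exists_opposite hstr hr₀ (hpath u v P hpp)
    exact ⟨r, hr, fun d h1 h2 h3 => hro d h1 (hnb _ h1 h2 _ d.adj h3).1⟩
  by_cases hchord : ∃ h : K.skeleton.Adj v u, s(v, u) ∉ P.edges
  · obtain ⟨hadj, hne⟩ := hchord
    have hsupp : ∀ x, x ∈ (SimpleGraph.Walk.cons hadj P).support ↔ x ∈ P.support := by
      intro x
      rw [SimpleGraph.Walk.support_cons, List.mem_cons]
      refine ⟨?_, Or.inr⟩
      rintro (rfl | h)
      · exact P.end_mem_support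
      · exact h
    have hch : (SimpleGraph.Walk.cons hadj P).IsChordless := by
      rw [SimpleGraph.Walk.isChordless_iff_forall_mem_edges]
      intro x y hx hy hxy
      rw [hsupp] at hx hy
      rw [SimpleGraph.Walk.edges_cons, List.mem_cons]
      have key : ∀ x y, x ∈ P.support → y ∈ P.support → K.skeleton.Adj x y → K.IsParallelAt x →
          s(x, y) = s(v, u) ∨ s(x, y) ∈ P.edges := by
        intro x y hx hy hxy hBx
        rcases (hnb x hx hBx y hxy (hS y hy)).2 with h | ⟨rfl, rfl⟩ | ⟨rfl, rfl⟩
        · exact Or.inr h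
        · exact Or.inl Sym2.eq_swap
        · exact Or.inl rfl
      by_cases hBx : K.IsParallelAt x
      · exact key x y hx hy hxy hBx
      by_cases hBy : K.IsParallelAt y
      · rw [Sym2.eq_swap]
        exact key y x hy hx hxy.symm hBy
      -- only the ends of the path may have a link that is not parallel
      have hx' : x = u ∨ x = v := by
        by_contra h
        rw [not_or] at h
        exact hBx (hB x hx h.1 h.2)
      have hy' : y = u ∨ y = v := by
        by_contra h
        rw [not_or] at h
        exact hBy (hB y hy h.1 h.2)
      have := hxy.ne
      rcases hx' with rfl | rfl <;> rcases hy' with rfl | rfl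
      · exact absurd rfl this
      · exact Or.inl Sym2.eq_swap
      · exact Or.inl rfl
      · exact absurd rfl this
    obtain ⟨r, hr, hro⟩ := hcyc.exists_opposite hstr hr₀ hadj P
      ((SimpleGraph.Walk.cons_isCycle_iff _ _).2 ⟨hP, hne⟩) hch hS
    exact ⟨r, hr, fun d h1 h2 h3 => hro d h1 (hnb _ h1 h2 _ d.adj h3).1⟩
  have hedges : ∀ d : K.skeleton.Dart, d.fst ∈ P.support → K.IsParallelAt d.fst →
      K.IsSolid d.snd → d.edge ∈ P.edges := by
    intro d h1 h2 h3
    rcases (hnb _ h1 h2 _ d.adj h3).2 with h | ⟨e1, e2⟩ | ⟨e1, e2⟩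
    · exact h
    · by_contra h
      exact hchord ⟨by rw [← e1, ← e2]; exact d.adj.symm, by
        have e : d.edge = s(v, u) := Sym2.eq_iff.2 (Or.inr ⟨e1, e2⟩)
        rwa [← e]⟩
    · by_contra h
      exact hchord ⟨by rw [← e1, ← e2]; exact d.adj, by
        have e : d.edge = s(v, u) := Sym2.eq_iff.2 (Or.inl ⟨e1, e2⟩)
        rwa [← e]⟩
  by_cases hv : K.IsParallelAt v
  · obtain ⟨r, hr, -, hro⟩ := exists_opposite_of_isParallelAt hstr hr₀ P hP
      (hS u P.start_mem_support) fun x hx hxu => by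
        by_cases hxv : x = v
        · rwa [hxv]
        · exact hB x hx hxu hxv
    exact ⟨r, hr, fun d h1 h2 h3 => hro d (hedges d h1 h2 h3)⟩
  · have hu : K.IsParallelAt u := by
      by_contra hu
      exact huv ⟨hu, hv⟩
    obtain ⟨r, hr, -, hro⟩ := exists_opposite_of_isParallelAt hstr hr₀ P.reverse hP.reverse
      (hS v P.end_mem_support) fun x hx hxv => by
        rw [SimpleGraph.Walk.support_reverse, List.mem_reverse] at hx
        by_cases hxu : x = u
        · rwa [hxu]
        · exact hB x hx hxu hxv
    refine ⟨r, hr, fun d h1 h2 h3 => hro d ?_⟩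
    rw [SimpleGraph.Walk.edges_reverse, List.mem_reverse]
    exact hedges d h1 h2 h3

end AbstractSimplicialComplex

/-! ### Consistent rotators at the solid vertices -/

namespace AbstractSimplicialComplex

open MultiGraph TwoComplex

variable {ι : Type u} {K : AbstractSimplicialComplex ι}

variable (K) in
/-- The graph of the edges between solid vertices. -/
def solidGraph : SimpleGraph ι where
  Adj x y := K.skeleton.Adj x y ∧ K.IsSolid x ∧ K.IsSolid y
  symm := ⟨fun _ _ h => ⟨h.1.symm, h.2.2, h.2.1⟩⟩
  loopless := ⟨fun _ h => h.1.ne rfl⟩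

theorem solidGraph_le : K.solidGraph ≤ K.skeleton := fun _ _ h => h.1

variable [Finite ι]

/-- There are planar rotators that at the two ends of each edge between solid vertices agree or are
reverse to each other; and they are reverse if both ends have parallel links. -/
theorem exists_hasTwist (hstr : K.IsStretchedOut)
    {r₀ : Perm (K.toTwoComplex.Corner × Bool)} (hr₀ : IsPlanarPrerotation r₀)
    (hpath : K.ParaPathsContractPlanar) (hcyc : K.CyclesContractPlanar) :
    ∃ r : Perm (K.toTwoComplex.Corner × Bool), IsPlanarPrerotation r ∧
      ∀ d : K.skeleton.Dart, K.IsSolid d.fst → K.IsSolid d.snd →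
        ∃ w : ℤˣ, HasTwist (C := K.toTwoComplex) r w d ∧
          (K.IsParallelAt d.fst → K.IsParallelAt d.snd → w = 1) := by
  classical
  -- each component of vertices with parallel links has its own family of rotators
  have hcomp : ∀ b, ∃ q : Perm (K.toTwoComplex.Corner × Bool), IsPlanarPrerotation q ∧
      ∀ x, K.parallelGraph.Reachable b x → K.IsParallelAt x → ∀ d : K.skeleton.Dart, d.fst = x →
        K.IsSolid d.snd → Opposite (C := K.toTwoComplex) q d := by
    intro b
    by_cases hb : K.IsParallelAt b
    · obtain ⟨q, hq, hqo⟩ := exists_opposite_component hstr hr₀ hpath hcyc hb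
      exact ⟨q, hq, fun x hx _ => hqo x hx⟩
    · refine ⟨r₀, hr₀, fun x hx hpx => absurd hpx ?_⟩
      obtain ⟨p⟩ := hx
      cases p with
      | nil => exact hb
      | cons h _ => exact absurd h.2.1 hb
  choose q hq hqo using hcomp
  let rep : ι → ι := fun x => (K.parallelGraph.connectedComponentMk x).out
  have hrep : ∀ x, K.parallelGraph.Reachable (rep x) x := fun x =>
    SimpleGraph.ConnectedComponent.exact (Quot.out_eq _)
  obtain ⟨r, hr, hrR⟩ := exists_isPlanarPrerotation_eqAt (C := K.toTwoComplex)
    (R := fun x : ι => if K.IsParallelAt x then q (rep x) else r₀) fun x => by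
      split_ifs
      · exact hq _
      · exact hr₀
  have hrq : ∀ x : ι, K.IsParallelAt x → EqAt (C := K.toTwoComplex) (q (rep x)) r x := fun x hx => by
    have := hrR x
    beta_reduce at this
    rwa [if_pos hx] at this
  have hfst : ∀ d : K.skeleton.Dart, K.IsParallelAt d.fst → K.IsSolid d.snd →
      ∃ w : ℤˣ, HasTwist (C := K.toTwoComplex) r w d ∧ (K.IsParallelAt d.snd → w = 1) := by
    intro d h1 h2
    have ho := hasTwist_one.2 (hqo _ _ (hrep d.fst) h1 d rfl h2)
    have he : EqAt (C := K.toTwoComplex) (q (rep d.fst) ^ ((1 : ℤˣ) : ℤ)) r d.fst := by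
      simpa using hrq _ h1
    by_cases h3 : K.IsParallelAt d.snd
    · have hreq : rep d.fst = rep d.snd := by
        have hadj : K.parallelGraph.Adj d.fst d.snd := ⟨d.adj, h1, h3⟩
        simp only [rep, SimpleGraph.ConnectedComponent.sound hadj.reachable]
      have he' : EqAt (C := K.toTwoComplex) (q (rep d.fst) ^ ((1 : ℤˣ) : ℤ)) r d.snd := by
        rw [hreq]
        simpa using hrq _ h3
      exact ⟨_, ho.transfer (hq _).1 he he', fun _ => rfl⟩
    · obtain ⟨a, ha⟩ := (hq (rep d.fst)).exists_eqAt_units_zpow hr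
        (isSimple_link (K := K) d.snd) (h2.isSubdivision h3)
      exact ⟨_, ho.transfer (hq _).1 he ha, fun h => absurd h h3⟩
  refine ⟨r, hr, fun d h1 h2 => ?_⟩
  by_cases h3 : K.IsParallelAt d.fst
  · obtain ⟨w, hw, hw'⟩ := hfst d h3 h2
    exact ⟨w, hw, fun _ => hw'⟩
  by_cases h4 : K.IsParallelAt d.snd
  · obtain ⟨w, hw, -⟩ := hfst d.symm h4 h1
    refine ⟨w, ?_, fun h => absurd h h3⟩
    have := hw.rev hr.1
    rwa [show K.toTwoComplex.rev (d.symm : K.skeleton.Dart) = d from d.symm_symm] at this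
  -- an edge between two vertices whose links are not parallel is a para-path
  have hpp : K.IsParaPath (SimpleGraph.Walk.cons d.adj SimpleGraph.Walk.nil) := by
    refine ⟨?_, h1.isSubdivision h3, h2.isSubdivision h4, fun x hx hx1 hx2 => ?_⟩
    · rw [SimpleGraph.Walk.cons_isPath_iff]
      exact ⟨SimpleGraph.Walk.IsPath.nil, by simp⟩
    · simp only [SimpleGraph.Walk.support_cons, SimpleGraph.Walk.support_nil, List.mem_cons,
        List.not_mem_nil, or_false] at hx
      exact absurd hx (not_or.2 ⟨hx1, hx2⟩)
  obtain ⟨q', hq', hqo'⟩ := hpp.exists_opposite hstr hr₀ (hpath _ _ _ hpp)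
  obtain ⟨a, ha⟩ := hq'.exists_eqAt_units_zpow hr (isSimple_link (K := K) d.fst)
    (h1.isSubdivision h3)
  obtain ⟨b, hb⟩ := hq'.exists_eqAt_units_zpow hr (isSimple_link (K := K) d.snd)
    (h2.isSubdivision h4)
  exact ⟨_, (hasTwist_one.2 (hqo' d (by simp) (by simp))).transfer hq'.1 ha hb,
    fun h => absurd h h3⟩

/-- Along the edges of a walk, a relation up to reversal of two planar families of rotators is
passed on. -/
theorem exists_eqAt_units_zpow_of_walk (hstr : K.IsStretchedOut)
    {q r : Perm (K.toTwoComplex.Corner × Bool)}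
    (hq : IsPlanarPrerotation q) (hr : IsPlanarPrerotation r) {x y : ι}
    (p : K.solidGraph.Walk x y)
    (hqo : ∀ d : K.skeleton.Dart, d.fst ∈ p.support → d.snd ∈ p.support →
      Opposite (C := K.toTwoComplex) q d)
    (hrt : ∀ d : K.skeleton.Dart, K.IsSolid d.fst → K.IsSolid d.snd →
      ∃ w : ℤˣ, HasTwist (C := K.toTwoComplex) r w d)
    (hx : ∃ a : ℤˣ, EqAt (C := K.toTwoComplex) (q ^ (a : ℤ)) r x) :
    ∃ a : ℤˣ, EqAt (C := K.toTwoComplex) (q ^ (a : ℤ)) r y := by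
  induction p with
  | nil => exact hx
  | @cons x z y hxz p ih =>
    have hsubs : ∀ t ∈ p.support, t ∈ (SimpleGraph.Walk.cons hxz p).support := fun e he => by
      rw [SimpleGraph.Walk.support_cons]
      exact List.mem_cons_of_mem _ he
    refine ih (fun d h1 h2 => hqo d (hsubs _ h1) (hsubs _ h2)) ?_
    by_cases hz : K.IsParallelAt z
    · -- the rotators at the dart from `z` to `x` agree up to reversal, and they determine the
      -- rotators at `z`
      obtain ⟨a, ha⟩ := hx
      obtain ⟨d, hd⟩ : ∃ d : K.skeleton.Dart, d = ⟨(x, z), hxz.1⟩ := ⟨_, rfl⟩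
      have hd1 : d.fst = x := by rw [hd]
      have hd2 : d.snd = z := by rw [hd]
      have hs1 : K.IsSolid d.fst := hd1 ▸ hxz.2.1
      have hs2 : K.IsSolid d.snd := hd2 ▸ hxz.2.2
      obtain ⟨w, hw⟩ := hrt d hs1 hs2
      have ho := hasTwist_one.2 (hqo d (by rw [hd1]; simp) (by
        rw [hd2]
        exact hsubs _ p.start_mem_support))
      rw [← hd1] at ha
      refine ⟨w * a, ?_⟩
      rw [← hd2] at hz ⊢
      refine (hq.units_zpow (w * a)).eqAt_of_isThickParallelGraph hr (d := d.symm)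
        (isSimple_link _) hz.1 (hstr.isBranchDart hs1 hs2).symm fun h hh => ?_
      obtain ⟨k, rfl⟩ : ∃ k, h = K.toTwoComplex.swap k := ⟨K.toTwoComplex.swap h, by simp⟩
      have hk : K.dart k = d := by
        have hh : K.dart (K.toTwoComplex.swap k) = d.symm := hh
        rw [dart_swap] at hh
        rw [← (K.dart k).symm_symm, hh, SimpleGraph.Dart.symm_symm]
      rw [hw k hk, ho.units_zpow hq.1 (w * a) hk]
      have hqa := (hq.units_zpow a).1
      rw [ha.units_zpow hqa (-w) k (congrArg (fun d : K.skeleton.Dart => d.fst) hk),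
        zpow_units_zpow_units]
      congr 4
      rw [one_mul, mul_neg, mul_comm]
    · exact hq.exists_eqAt_units_zpow hr (isSimple_link (K := K) z) (hxz.2.2.isSubdivision hz)

/-- There are planar rotators that are reverse to each other at all edges between solid vertices. -/
theorem exists_opposite_of_isSolid (hstr : K.IsStretchedOut)
    {r₀ : Perm (K.toTwoComplex.Corner × Bool)} (hr₀ : IsPlanarPrerotation r₀)
    (hpath : K.ParaPathsContractPlanar) (hcyc : K.CyclesContractPlanar) :
    ∃ r : Perm (K.toTwoComplex.Corner × Bool), IsPlanarPrerotation r ∧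
      ∀ d : K.skeleton.Dart, K.IsSolid d.fst → K.IsSolid d.snd →
        Opposite (C := K.toTwoComplex) r d := by
  classical
  obtain ⟨r, hr, hrt⟩ := exists_hasTwist hstr hr₀ hpath hcyc
  have huniq : ∀ {d : K.skeleton.Dart} {w w' : ℤˣ}, K.IsSolid d.fst → K.IsSolid d.snd →
      HasTwist (C := K.toTwoComplex) r w d → HasTwist (C := K.toTwoComplex) r w' d → w = w' :=
    fun h1 h2 hw hw' => hw.unique hr.1 ((hstr.isBranchDart h1 h2).three_le h1) hw'
  have hω : ∃ ω : ι → ι → ℤˣ, (∀ x y, ω x y = ω y x) ∧ ∀ d : K.skeleton.Dart, K.IsSolid d.fst →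
      K.IsSolid d.snd → HasTwist (C := K.toTwoComplex) r (ω d.fst d.snd) d := by
    refine ⟨fun x y => if ∀ h : K.skeleton.Adj x y,
      Opposite (C := K.toTwoComplex) r (⟨(x, y), h⟩ : K.skeleton.Dart) then 1 else -1,
      fun x y => ?_, fun d h1 h2 => ?_⟩
    · have key : ∀ x y, (∀ h : K.skeleton.Adj x y,
          Opposite (C := K.toTwoComplex) r (⟨(x, y), h⟩ : K.skeleton.Dart)) →
          ∀ h : K.skeleton.Adj y x,
            Opposite (C := K.toTwoComplex) r (⟨(y, x), h⟩ : K.skeleton.Dart) :=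
        fun x y hxy h => (hxy h.symm).rev hr.1
      exact if_congr ⟨key x y, key y x⟩ rfl rfl
    · beta_reduce
      split_ifs with h
      · exact hasTwist_one.2 (h d.adj)
      · obtain ⟨w, hw, -⟩ := hrt d h1 h2
        rcases Int.units_eq_one_or w with rfl | rfl
        · exact absurd (fun _ => hasTwist_one.1 hw) h
        · exact hw
  obtain ⟨ω, hωs, hωt⟩ := hω
  obtain ⟨s, hs⟩ := SimpleGraph.exists_potential (G := K.solidGraph) hωs fun u o ho hch => by
    have hsolid : ∀ d ∈ o.darts, K.IsSolid d.fst ∧ K.IsSolid d.snd := fun d _ => d.adj.2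
    by_cases hpar : ∀ x ∈ o.support, K.IsParallelAt x
    · -- the rotators are reverse to each other at all edges of the cycle
      rw [o.signProd_eq_mul (s := fun _ => 1) fun d hd => ?_, mul_one]
      obtain ⟨w, hw, hw1⟩ := hrt ⟨d.toProd, d.adj.1⟩ d.adj.2.1 d.adj.2.2
      have := huniq (d := ⟨d.toProd, d.adj.1⟩) d.adj.2.1 d.adj.2.2 hw
        (hωt ⟨d.toProd, d.adj.1⟩ d.adj.2.1 d.adj.2.2)
      rw [← this, hw1 (hpar _ (o.dart_fst_mem_support_of_mem_darts hd))
        (hpar _ (o.dart_snd_mem_support_of_mem_darts hd)), mul_one]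
    -- otherwise compare with rotators `q` that are reverse to each other along the whole cycle
    push Not at hpar
    obtain ⟨x₀, hx₀, hx₀p⟩ := hpar
    have hsol : ∀ x ∈ o.support, K.IsSolid x := by
      intro x hx
      have hnil : ¬ (o.rotate x hx).Nil := fun h => ho.not_nil ((o.nil_rotate hx).1 h)
      cases h : o.rotate x hx with
      | nil => exact absurd (h ▸ SimpleGraph.Walk.Nil.nil) hnil
      | cons hadj _ => exact hadj.2.1
    have hq : ∃ q : Perm (K.toTwoComplex.Corner × Bool), IsPlanarPrerotation q ∧
        ∀ d : K.skeleton.Dart, d.fst ∈ o.support → d.snd ∈ o.support →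
          Opposite (C := K.toTwoComplex) q d := by
      have hch' : (o.mapLe solidGraph_le).IsChordless := by
        rw [SimpleGraph.Walk.isChordless_iff_forall_mem_edges] at hch ⊢
        intro x y hx hy hxy
        rw [SimpleGraph.Walk.support_mapLe_eq_support] at hx hy
        rw [SimpleGraph.Walk.edges_mapLe_eq_edges]
        exact hch hx hy ⟨hxy, hsol x hx, hsol y hy⟩
      have ho' := ho.mapLe solidGraph_le
      have hsupp := fun x => congrArg (x ∈ ·) (o.support_mapLe_eq_support solidGraph_le)
      generalize o.mapLe solidGraph_le = o' at hch' ho' hsupp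
      cases o' with
      | nil => exact absurd ho' SimpleGraph.Walk.not_isCycle_nil
      | cons hadj P =>
        have hmem : ∀ x ∈ o.support, x ∈ P.support := by
          intro x hx
          have := (hsupp x).mpr hx
          rw [SimpleGraph.Walk.support_cons, List.mem_cons] at this
          rcases this with rfl | h
          · exact P.end_mem_support
          · exact h
        obtain ⟨q, hq, hqo⟩ := hcyc.exists_opposite hstr hr₀ hadj P ho' hch' fun x hx =>
          hsol x ((hsupp x).mp (by
            rw [SimpleGraph.Walk.support_cons]
            exact List.mem_cons_of_mem _ hx))
        exact ⟨q, hq, fun d h1 h2 => hqo d (hmem _ h1) (hmem _ h2)⟩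
    obtain ⟨q, hq, hqo⟩ := hq
    -- on the cycle, `r` and `q` agree up to a sign at each vertex, starting at `x₀`
    have hgood : ∀ x, ∃ a : ℤˣ, x ∈ o.support → EqAt (C := K.toTwoComplex) (q ^ (a : ℤ)) r x := by
      intro x
      by_cases hx : x ∈ o.support
      · have hx' : x ∈ (o.rotate x₀ hx₀).support := (o.mem_support_rotate_iff x₀ hx₀).2 hx
        have hsub : ∀ y ∈ ((o.rotate x₀ hx₀).takeUntil x hx').support, y ∈ o.support := fun y hy =>
          (o.mem_support_rotate_iff x₀ hx₀).1
            ((o.rotate x₀ hx₀).support_takeUntil_subset_support hx' hy)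
        obtain ⟨a, ha⟩ := exists_eqAt_units_zpow_of_walk hstr hq hr
          ((o.rotate x₀ hx₀).takeUntil x hx') (fun d h1 h2 => hqo d (hsub _ h1) (hsub _ h2))
          (fun d h1 h2 => (hrt d h1 h2).imp fun w hw => hw.1)
          (hq.exists_eqAt_units_zpow hr (isSimple_link (K := K) x₀)
            ((hsol x₀ hx₀).isSubdivision hx₀p))
        exact ⟨a, fun _ => ha⟩
      · exact ⟨1, fun h => absurd h hx⟩
    choose a ha using hgood
    rw [o.signProd_eq_mul (s := a) fun d hd => ?_, Int.units_mul_self]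
    have h1 := o.dart_fst_mem_support_of_mem_darts hd
    have h2 := o.dart_snd_mem_support_of_mem_darts hd
    have ht := (hasTwist_one.2 (hqo ⟨d.toProd, d.adj.1⟩ h1 h2)).transfer hq.1 (ha _ h1) (ha _ h2)
    rw [one_mul] at ht
    exact huniq (d := ⟨d.toProd, d.adj.1⟩) d.adj.2.1 d.adj.2.2
      (hωt ⟨d.toProd, d.adj.1⟩ d.adj.2.1 d.adj.2.2) ht
  -- reverse the rotators at the vertices with negative sign
  obtain ⟨r', hr', hr'e⟩ := exists_isPlanarPrerotation_eqAt (C := K.toTwoComplex)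
    (R := fun x : ι => r ^ (s x : ℤ)) fun x => hr.units_zpow _
  refine ⟨r', hr', fun d h1 h2 => hasTwist_one.1 ?_⟩
  have := (hωt d h1 h2).transfer hr.1 (hr'e d.fst) (hr'e d.snd)
  rwa [hs d.fst d.snd ⟨d.adj, h1, h2⟩, mul_assoc, Int.units_mul_self] at this

end AbstractSimplicialComplex

theorem mainTheorem5 {ι : Type u} [Finite ι] (K : AbstractSimplicialComplex ι)
    (hdim : K.IsTwoDimensional)
    (hconn : K.IsLocallyAlmostThreeConnected)
    (hstr : K.IsStretchedOut) :
    K.toTwoComplex.HasPlanarRotationSystem ∨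
      ¬ K.toTwoComplex.IsLocallyPlanar ∨
      (∃ (u v : ι) (P : K.skeleton.Walk u v), K.IsParaPath P ∧
        ¬ (K.contractEdges {a | a ∈ P.edges}).IsLoopPlanarAt
          (K.contractVertex {a | a ∈ P.edges} u)) ∨
      (∃ (u : ι) (o : K.skeleton.Walk u u), o.IsCycle ∧ o.IsChordless ∧
        ∃ e ∈ o.edges, (∃ e' ∈ o.edges, e' ≠ e) ∧
          ¬ (K.contractEdges {a | a ∈ o.edges ∧ a ≠ e}).IsLocallyPlanar) := by
  by_contra hcon
  simp only [not_or, not_exists, not_and, not_not] at hcon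
  obtain ⟨hno, hloc, hpath, hcyc⟩ := hcon
  obtain ⟨r₀, hr₀⟩ := hloc.exists_isPlanarPrerotation
  obtain ⟨r, hr, hro⟩ := AbstractSimplicialComplex.exists_opposite_of_isSolid hstr hr₀ hpath
    hcyc
  obtain ⟨n, ⟨φ⟩⟩ := Finite.exists_equiv_fin ι
  -- the darts that determine the rotators at their edges; edges without solid ends are oriented
  let U : Set K.skeleton.Dart :=
    {d | K.IsSolid d.fst ∨ ¬ K.IsSolid d.snd ∧ φ d.fst < φ d.snd}
  obtain ⟨r', hr', hr'o⟩ := TwoComplex.exists_opposite_completion (C := K.toTwoComplex) hr (U := U)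
    (fun (d : K.skeleton.Dart) => by
      change (K.IsSolid d.fst ∨ ¬ K.IsSolid d.snd ∧ φ d.fst < φ d.snd) ∨
        (K.IsSolid d.snd ∨ ¬ K.IsSolid d.fst ∧ φ d.snd < φ d.fst)
      have := lt_or_gt_of_ne fun e => d.adj.ne (φ.injective e)
      tauto)
    (fun (d : K.skeleton.Dart) (h1 : K.IsSolid d.fst ∨ ¬ K.IsSolid d.snd ∧ φ d.fst < φ d.snd)
        (h2 : K.IsSolid d.snd ∨ ¬ K.IsSolid d.fst ∧ φ d.snd < φ d.fst) => by
      rcases h1 with h1 | ⟨h1, hlt⟩ <;> rcases h2 with h2 | ⟨h2, hlt'⟩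
      · exact hro d h1 h2
      · exact absurd h1 h2
      · exact absurd h2 h1
      · exact absurd hlt hlt'.le.not_gt)
    (fun v => by
      by_cases hv : K.IsSolid v
      · refine Or.inl fun d hd => Or.inl ?_
        have hd : (d : K.skeleton.Dart).fst = v := hd
        rwa [hd]
      · exact Or.inr fun r' hr' => TwoComplex.eqAt_or_eqAt_inv_of_isAlmostThreeConnected hr.1 hr'
          (AbstractSimplicialComplex.isSimple_link v) (hconn v) (fun h => hv (Or.inl h))
          fun h => hv (Or.inr h))
  exact hno (hr'.hasPlanarRotationSystem hr'o)
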